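/- Consider the Gaussian interference channel $$Y_1 = X_1 + \alpha_1 X_2 + N_1,\qquad Y_2 = \alpha_2 X_1 + X_2 + N_2,$$ with real gains satisfying $0\le\alpha_1^2\le 1$ and $0\le\alpha_2^2\le 1$ (weak interference), where $N_1,N_2$ are independent standard Gaussian noises, independent of the inputs and memoryless over channel uses, and where base stations 1 and 2 (BS1, BS2) have power constraints $P_1,P_2\ge 0$. A secret key sharing code of block length $n$ works as follows. BS1 and BS2 send independent, possibly random, input blocks $X_1^n$ and $X_2^n$ with $\sum_{t=1}^n X_{i,t}^2\le nP_i$ almost surely. User $i$ observes $Y_i^n$ and generates a key $K_i$ and a public message $F_i$, with values in finite sets, as a (joint) stochastic function of $Y_i^n$; $(F_1,F_2)$ is sent over a noiseless public channel. BS$i$ then generates a key $\hat K_i$ in the alphabet of $K_i$ as a stochastic function of $(X_i^n,F_1,F_2)$. The local randomness used by the different terminals is independent. A pair $(R_1,R_2)$ is an achievable key rate pair if for every $\varepsilon>0$ and all sufficiently large $n$ there is such a code with $$\tfrac1n H(K_i)>R_i-\varepsilon,\qquad \Pr\{K_i\neq\hat K_i\}<\varepsilon\qquad (i=1,2),$$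 $$\tfrac1n I(K_1;K_2,Y_2^n,F_1,F_2)<\varepsilon,\qquad \tfrac1n I(K_2;K_1,Y_1^n,F_1,F_2)<\varepsilon.$$ Let $C(x)=\frac12\log(1+x)$ and $[x]^+=\max(x,0)$, with all logarithms (also in $H$ and $I$) natural. Then for all power-control parameters $\beta_1,\beta_2\in[0,1]$ and all power-splitting parameters $\lambda_1,\lambda_2\in[0,1]$, every pair $(R_1,R_2)$ with $$0\le R_1\le \Big[C\Big(\tfrac{(1-\lambda_1)\beta_1P_1}{1+\alpha_1^2\beta_2P_2+\lambda_1\beta_1P_1}\Big)-C\Big(\tfrac{(1-\lambda_1)\alpha_2^2\beta_1P_1}{1+\alpha_2^2\lambda_1\beta_1P_1+\lambda_2\beta_2P_2}\Big)\Big]^+ +\Big[C\Big(\tfrac{(1-\alpha_1\alpha_2)^2\lambda_1\lambda_2\beta_1\beta_2P_1P_2+\alpha_1^2\lambda_2\beta_2P_2+\lambda_1\beta_1P_1}{1+\alpha_2^2\lambda_1\beta_1P_1+\lambda_2\beta_2P_2}\Big)-C(\alpha_1^2\beta_2P_2)\Big]^+,$$ $$0\le R_2\le \Big[C\Big(\tfrac{(1-\lambda_2)\beta_2P_2}{1+\alpha_2^2\beta_1P_1+\lambda_2\beta_2P_2}\Big)-C\Big(\tfrac{(1-\lambda_2)\alpha_1^2\beta_2P_2}{1+\alpha_1^2\lambda_2\beta_2P_2+\lambda_1\beta_1P_1}\Big)\Big]^+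 +\Big[C\Big(\tfrac{(1-\alpha_1\alpha_2)^2\lambda_1\lambda_2\beta_1\beta_2P_1P_2+\alpha_2^2\lambda_1\beta_1P_1+\lambda_2\beta_2P_2}{1+\alpha_1^2\lambda_2\beta_2P_2+\lambda_1\beta_1P_1}\Big)-C(\alpha_2^2\beta_1P_1)\Big]^+$$ is an achievable key rate pair. -/

import Mathlib

open MeasureTheory ProbabilityTheory

/-- `C x = (1/2) log (1 + x)`, in nats. -/
noncomputable def gaussCap (x : ℝ) : ℝ := (1 / 2) * Real.log (1 + x)

/-- The positive part `[x]⁺`. -/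
noncomputable def plusPart (x : ℝ) : ℝ := max x 0

/-- Shannon entropy (in nats) of a random variable `K` with values in a finite set. -/
noncomputable def entropyOf {Ω A : Type*} [MeasurableSpace Ω] [MeasurableSpace A] [Fintype A]
    (μ : Measure Ω) (K : Ω → A) : ℝ :=
  ∑ a, Real.negMulLog ((μ.map K).real {a})

/-- Mutual information `I(X; Y)` (in nats) of two arbitrary random variables: the relative entropy
of their joint law with respect to the product of the marginal laws, with values in `[0, ∞]`. -/
noncomputable def mutualInfo {Ω A B : Type*} [MeasurableSpace Ω] [MeasurableSpace A]
    [MeasurableSpace B] (μ : Measure Ω) (X : Ω → A) (Y : Ω → B) : ENNReal :=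
  InformationTheory.klDiv (μ.map fun ω => (X ω, Y ω)) ((μ.map X).prod (μ.map Y))

/-- A secret key sharing code of block length `n` over the Gaussian interference channel with
power constraints `P₁`, `P₂`. The alphabets of the keys and of the public messages are
`Fin k₁`, `Fin k₂`, `Fin f₁`, `Fin f₂`. Stochastic functions are Markov kernels. -/
structure KeyCode (P₁ P₂ : ℝ) (n : ℕ) where
  /-- sizes of the key alphabets -/
  (k₁ k₂ : ℕ)
  /-- sizes of the public message alphabets -/
  (f₁ f₂ : ℕ)
  /-- law of the input block sent by base station 1 -/
  input₁ : Measure (Fin n → ℝ)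
  /-- law of the input block sent by base station 2 -/
  input₂ : Measure (Fin n → ℝ)
  prob₁ : IsProbabilityMeasure input₁
  prob₂ : IsProbabilityMeasure input₂
  power₁ : ∀ᵐ x ∂input₁, ∑ t, x t ^ 2 ≤ n * P₁
  power₂ : ∀ᵐ x ∂input₂, ∑ t, x t ^ 2 ≤ n * P₂
  /-- user 1 generates its key and its public message from its output block -/
  user₁ : Kernel (Fin n → ℝ) (Fin k₁ × Fin f₁)
  /-- user 2 generates its key and its public message from its output block -/
  user₂ : Kernel (Fin n → ℝ) (Fin k₂ × Fin f₂)
  markov_user₁ : IsMarkovKernel user₁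
  markov_user₂ : IsMarkovKernel user₂
  /-- base station 1 generates its key from its input block and both public messages -/
  station₁ : Kernel ((Fin n → ℝ) × (Fin f₁ × Fin f₂)) (Fin k₁)
  /-- base station 2 generates its key from its input block and both public messages -/
  station₂ : Kernel ((Fin n → ℝ) × (Fin f₁ × Fin f₂)) (Fin k₂)
  markov_station₁ : IsMarkovKernel station₁
  markov_station₂ : IsMarkovKernel station₂

namespace KeyCode

attribute [instance] prob₁ prob₂ markov_user₁ markov_user₂ markov_station₁ markov_station₂

variable {P₁ P₂ : ℝ} {n : ℕ}

/-- Law of `n` i.i.d. standard Gaussian noise samples. -/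
noncomputable def noise (n : ℕ) : Measure (Fin n → ℝ) :=
  Measure.pi fun _ => gaussianReal 0 1

/-- Joint law of `((X₁, X₂), (Y₁, Y₂))`: independent inputs, independent noises, and
`Y₁ = X₁ + α₁ X₂ + N₁`, `Y₂ = α₂ X₁ + X₂ + N₂` in each of the `n` channel uses. -/
noncomputable def channelLaw (c : KeyCode P₁ P₂ n) (α₁ α₂ : ℝ) :
    Measure (((Fin n → ℝ) × (Fin n → ℝ)) × ((Fin n → ℝ) × (Fin n → ℝ))) :=
  ((c.input₁.prod c.input₂).prod ((noise n).prod (noise n))).map fun z =>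
    ((z.1.1, z.1.2),
      (fun t => z.1.1 t + α₁ * z.1.2 t + z.2.1 t, fun t => α₂ * z.1.1 t + z.1.2 t + z.2.2 t))

/-- Joint law of `((X₁, X₂), (Y₁, Y₂))` and `((K₁, F₁), (K₂, F₂))`: given the channel inputs and
outputs, the users act independently, each on its own output. -/
noncomputable def userLaw (c : KeyCode P₁ P₂ n) (α₁ α₂ : ℝ) :
    Measure ((((Fin n → ℝ) × (Fin n → ℝ)) × ((Fin n → ℝ) × (Fin n → ℝ))) ×
      ((Fin c.k₁ × Fin c.f₁) × (Fin c.k₂ × Fin c.f₂))) :=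
  (c.channelLaw α₁ α₂).compProd
    ((c.user₁.parallelComp c.user₂).comap (fun z => z.2) measurable_snd)

/-- Sample space of all the random variables of a run of the code:
`(((X₁, X₂), (Y₁, Y₂)), ((K₁, F₁), (K₂, F₂)))` and `(K̂₁, K̂₂)`. -/
abbrev Run (c : KeyCode P₁ P₂ n) : Type :=
  ((((Fin n → ℝ) × (Fin n → ℝ)) × ((Fin n → ℝ) × (Fin n → ℝ))) ×
      ((Fin c.k₁ × Fin c.f₁) × (Fin c.k₂ × Fin c.f₂))) × (Fin c.k₁ × Fin c.k₂)

/-- Joint law of a run of the code: given everything else, the base stations act independently,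
station `i` on `(Xᵢ, F₁, F₂)`. -/
noncomputable def law (c : KeyCode P₁ P₂ n) (α₁ α₂ : ℝ) : Measure c.Run :=
  (c.userLaw α₁ α₂).compProd
    ((c.station₁.parallelComp c.station₂).comap
      (fun z => ((z.1.1.1, (z.2.1.2, z.2.2.2)), (z.1.1.2, (z.2.1.2, z.2.2.2))))
      (by fun_prop))

/-- Output block of user 1. -/
def Y₁ (c : KeyCode P₁ P₂ n) (ω : c.Run) : Fin n → ℝ := ω.1.1.2.1
/-- Output block of user 2. -/
def Y₂ (c : KeyCode P₁ P₂ n) (ω : c.Run) : Fin n → ℝ := ω.1.1.2.2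
/-- Key of user 1. -/
def K₁ (c : KeyCode P₁ P₂ n) (ω : c.Run) : Fin c.k₁ := ω.1.2.1.1
/-- Public message of user 1. -/
def F₁ (c : KeyCode P₁ P₂ n) (ω : c.Run) : Fin c.f₁ := ω.1.2.1.2
/-- Key of user 2. -/
def K₂ (c : KeyCode P₁ P₂ n) (ω : c.Run) : Fin c.k₂ := ω.1.2.2.1
/-- Public message of user 2. -/
def F₂ (c : KeyCode P₁ P₂ n) (ω : c.Run) : Fin c.f₂ := ω.1.2.2.2
/-- Key of base station 1. -/
def K₁hat (c : KeyCode P₁ P₂ n) (ω : c.Run) : Fin c.k₁ := ω.2.1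
/-- Key of base station 2. -/
def K₂hat (c : KeyCode P₁ P₂ n) (ω : c.Run) : Fin c.k₂ := ω.2.2

end KeyCode

/-- `(R₁, R₂)` is an achievable key rate pair of the Gaussian interference channel with gains
`α₁`, `α₂` and power constraints `P₁`, `P₂`. -/
def AchievableKeyRates (α₁ α₂ P₁ P₂ R₁ R₂ : ℝ) : Prop :=
  ∀ ε : ℝ, 0 < ε → ∃ n₀ : ℕ, ∀ n : ℕ, n₀ ≤ n → ∃ c : KeyCode P₁ P₂ n,
    R₁ - ε < entropyOf (c.law α₁ α₂) c.K₁ / n ∧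
    R₂ - ε < entropyOf (c.law α₁ α₂) c.K₂ / n ∧
    (c.law α₁ α₂).real {ω | c.K₁ ω ≠ c.K₁hat ω} < ε ∧
    (c.law α₁ α₂).real {ω | c.K₂ ω ≠ c.K₂hat ω} < ε ∧
    mutualInfo (c.law α₁ α₂) c.K₁ (fun ω => (c.K₂ ω, c.Y₂ ω, c.F₁ ω, c.F₂ ω)) / n
      < ENNReal.ofReal ε ∧
    mutualInfo (c.law α₁ α₂) c.K₂ (fun ω => (c.K₁ ω, c.Y₁ ω, c.F₁ ω, c.F₂ ω)) / n
      < ENNReal.ofReal ε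

/-- The set of all achievable key rate pairs. -/
def secretKeyCapacityRegion (α₁ α₂ P₁ P₂ : ℝ) : Set (ℝ × ℝ) :=
  {R | AchievableKeyRates α₁ α₂ P₁ P₂ R.1 R.2}

/-- The key rate region of the artificial noise scheme with power control parameters `β₁`, `β₂`
and power splitting parameters `l₁`, `l₂`. -/
def artificialNoiseRegion (α₁ α₂ P₁ P₂ β₁ β₂ l₁ l₂ : ℝ) : Set (ℝ × ℝ) :=
  {R | (0 ≤ R.1 ∧ R.1 ≤
        plusPart
          (gaussCap ((1 - l₁) * β₁ * P₁ / (1 + α₁ ^ 2 * β₂ * P₂ + l₁ * β₁ * P₁))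
            - gaussCap ((1 - l₁) * α₂ ^ 2 * β₁ * P₁
                / (1 + α₂ ^ 2 * l₁ * β₁ * P₁ + l₂ * β₂ * P₂)))
        + plusPart
          (gaussCap (((1 - α₁ * α₂) ^ 2 * l₁ * l₂ * β₁ * β₂ * P₁ * P₂
                + α₁ ^ 2 * l₂ * β₂ * P₂ + l₁ * β₁ * P₁)
                / (1 + α₂ ^ 2 * l₁ * β₁ * P₁ + l₂ * β₂ * P₂))
            - gaussCap (α₁ ^ 2 * β₂ * P₂))) ∧
      (0 ≤ R.2 ∧ R.2 ≤
        plusPart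
          (gaussCap ((1 - l₂) * β₂ * P₂ / (1 + α₂ ^ 2 * β₁ * P₁ + l₂ * β₂ * P₂))
            - gaussCap ((1 - l₂) * α₁ ^ 2 * β₂ * P₂
                / (1 + α₁ ^ 2 * l₂ * β₂ * P₂ + l₁ * β₁ * P₁)))
        + plusPart
          (gaussCap (((1 - α₁ * α₂) ^ 2 * l₁ * l₂ * β₁ * β₂ * P₁ * P₂
                + α₂ ^ 2 * l₁ * β₁ * P₁ + l₂ * β₂ * P₂)
                / (1 + α₁ ^ 2 * l₂ * β₂ * P₂ + l₁ * β₁ * P₁))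
            - gaussCap (α₂ ^ 2 * β₁ * P₁)))}

/-! Each base station transmits a word of a fixed Gaussian codebook, of power `u`, plus fresh
Gaussian dummy noise of power `v`. Here `u` and `v` are the shares (1-l)βP and lβP, multiplied by a
factor γ slightly below 1 that makes room for the power constraint. Its user decodes the message m,
treating all the rest as noise, quantizes its output into a cell w of side Δ, and applies one fixed
binning to (m, w); the bin index is the pair (key, public message). The station knows its block x.
It recovers m by running the user's decoder on x plus a fixed noise vector, lists the cells near x,
and takes a listed cell whose public message agrees.

Reliability. The codebook rate R lies below C(u/(v+1+α²(u'+v'))) (`exists_decoder`). Given x, the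
output is spread by a Gaussian of variance s = 1+α²(u'+v'), so about exp(n(½log(2πe s) - log Δ))
cells are listed (`exists_cell_lists`); a public rate slightly above this exponent makes a second
match unlikely.

Secrecy. By the leftover hash lemma `exists_nearUniform_binning`, a random bin index is nearly
uniform and independent of the other output Z as soon as the number of bins is small against the
inverse of the ratio between the joint density of (m, w, Z) and a reference density of Z. The other
message is handed to the eavesdropper as well. Given the noise in Z, the noise in Y is Gaussian of
variance `varE`, so on typical runs this ratio is about exp(-nR) Δ^n exp(-n(½log(2πe `varE`) -
C(α'²u/`varB`))). After subtraction of the public rate Δ cancels, and every key rate below R -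
C(α'²u/`varB`) + ½log `varE` - ½log s is possible; with R near capacity this is `wordRate` +
`outputRate`. If `outputRate` is not positive the output is not quantized; if `wordRate` is not
positive the codeword gets power 0, which only reduces interference for the other side. Hence the
two positive parts.

Near uniformity is measured in total variation, with a fixed small error η. As log k is linear in n,
`NearUniform.le_entropyOf` and `NearUniform.mutualInfo_le` give an entropy deficit and a leakage of
order η per channel use, so no exponential decay is needed. One pair of codebooks serving both sides
is found by averaging (`exists_codebooks`), a binning is then chosen for each side (`exists_hash`),
and continuity in γ recovers the closed region. -/

/-! ### Gaussian vectors: linear combinations, densities, concentration of energy. -/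

/-- The centred Gaussian law with variance `s` (a point mass when `s ≤ 0`). -/
noncomputable def gs (s : ℝ) : Measure ℝ := gaussianReal 0 s.toNNReal

instance (s : ℝ) : IsProbabilityMeasure (gs s) := by unfold gs; infer_instance

/-- The law of `n` i.i.d. centred Gaussian samples of variance `s`. -/
noncomputable def gv (n : ℕ) (s : ℝ) : Measure (Fin n → ℝ) := Measure.pi fun _ => gs s

instance (n : ℕ) (s : ℝ) : IsProbabilityMeasure (gv n s) := by unfold gv; infer_instance

theorem noise_eq_gv (n : ℕ) : KeyCode.noise n = gv n 1 := by
  simp [KeyCode.noise, gv, gs]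

theorem gs_map_mul (a s : ℝ) : (gs s).map (fun x => a * x) = gs (a ^ 2 * s) := by
  rw [gs, gs, gaussianReal_map_const_mul]
  congr 1
  · simp
  · ext
    simp only [NNReal.coe_mul, NNReal.coe_mk]
    rcases le_or_gt 0 s with h | h
    · rw [Real.coe_toNNReal _ h, Real.coe_toNNReal _ (by positivity)]
    · rw [Real.toNNReal_of_nonpos h.le, Real.toNNReal_of_nonpos]
      · simp
      · nlinarith [sq_nonneg a]

theorem gs_lin {s t : ℝ} (hs : 0 ≤ s) (ht : 0 ≤ t) (a b : ℝ) :
    MeasurePreserving (fun p : ℝ × ℝ => a * p.1 + b * p.2) ((gs s).prod (gs t))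
      (gs (a ^ 2 * s + b ^ 2 * t)) := by
  refine ⟨by fun_prop, ?_⟩
  have h1 : (fun p : ℝ × ℝ => a * p.1 + b * p.2)
      = (fun p : ℝ × ℝ => p.1 + p.2) ∘ Prod.map (fun x => a * x) (fun x => b * x) := rfl
  rw [h1, ← Measure.map_map (by fun_prop) (by fun_prop),
    ← Measure.map_prod_map _ _ (by fun_prop) (by fun_prop), gs_map_mul, gs_map_mul]
  change Measure.conv _ _ = _
  rw [gs, gs, gaussianReal_conv_gaussianReal, gs, Real.toNNReal_add (by positivity) (by positivity),
    add_zero]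

/-- Transfers a single-letter identity in law to blocks, because the channel and all Gaussian laws
are memoryless. -/
theorem measurePreserving_pi_prod {n : ℕ} {S S' R : Type*} [MeasurableSpace S]
    [MeasurableSpace S'] [MeasurableSpace R] {μ : Measure S} {ν : Measure S'} {ρ : Measure R}
    [IsProbabilityMeasure μ] [IsProbabilityMeasure ν] [IsProbabilityMeasure ρ] {φ : S × S' → R}
    (h : MeasurePreserving φ (μ.prod ν) ρ) :
    MeasurePreserving (fun (p : (Fin n → S) × (Fin n → S')) t => φ (p.1 t, p.2 t))
      ((Measure.pi fun _ => μ).prod (Measure.pi fun _ => ν)) (Measure.pi fun _ => ρ) :=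
  (measurePreserving_pi (fun _ => μ.prod ν) (fun _ => ρ) fun _ => h).comp
    (measurePreserving_arrowProdEquivProdArrow S S' (Fin n) (fun _ => μ) fun _ => ν).symm

theorem gv_lin {n : ℕ} {s t : ℝ} (hs : 0 ≤ s) (ht : 0 ≤ t) (a b : ℝ) :
    MeasurePreserving (fun p : (Fin n → ℝ) × (Fin n → ℝ) => a • p.1 + b • p.2)
      ((gv n s).prod (gv n t)) (gv n (a ^ 2 * s + b ^ 2 * t)) :=
  measurePreserving_pi_prod (gs_lin hs ht a b)

theorem lintegral_pi_prod {n : ℕ} (f : Fin n → ℝ → ENNReal) (hf : ∀ i, Measurable (f i))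
    (μ : Fin n → Measure ℝ) [∀ i, SigmaFinite (μ i)] :
    ∫⁻ x, ∏ i, f i (x i) ∂(Measure.pi μ) = ∏ i, ∫⁻ x, f i x ∂(μ i) := by
  induction n with
  | zero => simp [lintegral_unique]
  | succ n ih =>
    have := (measurePreserving_piFinSuccAbove μ 0).symm
    rw [← this.lintegral_comp (by fun_prop), lintegral_prod _ (by fun_prop)]
    simp only [Fin.prod_univ_succ]
    simp [MeasurableEquiv.piFinSuccAbove]
    rw [← ih _ (fun i => hf _), ← lintegral_mul_const _ (hf 0)]
    congr with x
    rw [lintegral_const_mul _ (by fun_prop)]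

/-- The density of `gs s`. -/
noncomputable def ph (s x : ℝ) : ℝ := gaussianPDFReal 0 s.toNNReal x

/-- The density of `gv n s`. -/
noncomputable def phv {n : ℕ} (s : ℝ) (x : Fin n → ℝ) : ℝ := ∏ t, ph s (x t)

@[fun_prop]
theorem measurable_ph (s : ℝ) : Measurable (ph s) := measurable_gaussianPDFReal _ _

@[fun_prop]
theorem measurable_phv {n : ℕ} (s : ℝ) : Measurable (phv s : (Fin n → ℝ) → ℝ) := by
  unfold phv; fun_prop

theorem ph_eq {s : ℝ} (hs : 0 < s) (x : ℝ) :
    ph s x = Real.exp (-(Real.log (2 * Real.pi * s) / 2) - x ^ 2 / (2 * s)) := by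
  have : 0 < 2 * Real.pi * s := by positivity
  rw [ph, gaussianPDFReal, Real.coe_toNNReal _ hs.le, sub_zero, sub_eq_add_neg, Real.exp_add,
    Real.exp_neg (_ / 2), Real.sqrt_eq_rpow, Real.rpow_def_of_pos this]
  congr 3 <;> ring

/-- In this form the density depends on the block only through its energy, so every density
comparison below becomes an energy estimate. -/
theorem phv_eq {n : ℕ} {s : ℝ} (hs : 0 < s) (x : Fin n → ℝ) :
    phv s x = Real.exp (-(n * (Real.log (2 * Real.pi * s) / 2)) - (∑ t, x t ^ 2) / (2 * s)) := by
  rw [phv, Finset.prod_congr rfl fun t _ => ph_eq hs (x t), ← Real.exp_sum,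
    Finset.sum_sub_distrib, Finset.sum_div]
  simp

theorem phv_pos {n : ℕ} {s : ℝ} (hs : 0 < s) (x : Fin n → ℝ) : 0 < phv s x := by
  rw [phv_eq hs]; positivity

theorem gv_eq_withDensity (n : ℕ) {s : ℝ} (hs : 0 < s) :
    gv n s = volume.withDensity fun x => ENNReal.ofReal (phv s x) := by
  refine Measure.pi_eq fun S hS => ?_
  rw [withDensity_apply _ (MeasurableSet.univ_pi hS)]
  have h1 : ∀ i : Fin n, gs s (S i)
      = ∫⁻ x, (S i).indicator (fun x => ENNReal.ofReal (ph s x)) x := by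
    intro i
    rw [gs, gaussianReal_of_var_ne_zero _ (by simpa using hs), withDensity_apply _ (hS i),
      lintegral_indicator (hS i)]
    rfl
  simp_rw [h1]
  rw [← lintegral_pi_prod _ (fun i => (by fun_prop : Measurable _).indicator (hS i)),
    ← lintegral_indicator (MeasurableSet.univ_pi hS)]
  refine lintegral_congr fun x => ?_
  by_cases hx : x ∈ Set.univ.pi S
  · rw [Set.indicator_of_mem hx, phv, ENNReal.ofReal_prod_of_nonneg]
    · exact Finset.prod_congr rfl fun i _ => (Set.indicator_of_mem (hx i trivial)
        fun x => ENNReal.ofReal (ph s x)).symm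
    · intro i _; exact gaussianPDFReal_nonneg _ _ _
  · rw [Set.indicator_of_notMem hx]
    simp only [Set.mem_pi, not_forall] at hx
    obtain ⟨i, _, hi⟩ := hx
    exact (Finset.prod_eq_zero (Finset.mem_univ i) (Set.indicator_of_notMem hi _)).symm

theorem integral_sq_gs {s : ℝ} (hs : 0 ≤ s) : ∫ x, x ^ 2 ∂(gs s) = s := by
  have h := variance_fun_id_gaussianReal (μ := 0) (v := s.toNNReal)
  rw [variance_eq_integral (by fun_prop)] at h
  simpa [gs, integral_id_gaussianReal, hs] using h

theorem memLp_sq_gs (s : ℝ) : MemLp (fun x : ℝ => x ^ 2) 2 (gs s) := by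
  have h := (memLp_id_gaussianReal' (μ := 0) (v := s.toNNReal) 4 (by simp))
  have h2 : MemLp (fun x : ℝ => x * x) 2 (gs s) := by
    have : ENNReal.HolderTriple 4 4 2 := ⟨by
      rw [← ENNReal.toReal_eq_toReal_iff' (by simp) (by simp),
        ENNReal.toReal_add (by simp) (by simp)]
      simp; norm_num⟩
    exact h.mul h
  simpa [sq] using h2

/-- Weak law of large numbers for the energy of a Gaussian vector. -/
theorem gv_energy {s : ℝ} (hs : 0 ≤ s) {δ η : ℝ} (hδ : 0 < δ) (hη : 0 < η) :
    ∃ n₀ : ℕ, ∀ n ≥ n₀,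
      gv n s {x | n * δ ≤ |(∑ t, x t ^ 2) - n * s|} ≤ ENNReal.ofReal η := by
  set V := variance (fun x : ℝ => x ^ 2) (gs s) with hV
  -- Chebyshev bounds the probability by nV/(nδ)², which is at most η once n ≥ V/(δ²η).
  obtain ⟨n₀, hn₀⟩ := exists_nat_gt (V / (δ ^ 2 * η))
  refine ⟨n₀ + 1, fun n hn => ?_⟩
  have hn1 : (1 : ℝ) ≤ n := by exact_mod_cast (by omega : 1 ≤ n)
  have hn2 : (n₀ : ℝ) ≤ n := by exact_mod_cast (by omega : n₀ ≤ n)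
  have hm : ∀ t : Fin n, MemLp (fun x : Fin n → ℝ => x t ^ 2) 2 (gv n s) := fun t =>
    (memLp_sq_gs s).comp_measurePreserving (measurePreserving_eval (fun _ => gs s) t)
  have hsum : MemLp (fun x : Fin n → ℝ => ∑ t, x t ^ 2) 2 (gv n s) :=
    memLp_finsetSum _ fun t _ => hm t
  have hmean : ∫ x, ∑ t, x t ^ 2 ∂(gv n s) = n * s := by
    rw [integral_finsetSum _ fun t _ => (hm t).integrable (by norm_num)]
    have : ∀ t : Fin n, ∫ x : Fin n → ℝ, x t ^ 2 ∂(gv n s) = s := fun t => by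
      refine Eq.trans ?_ (integral_sq_gs hs)
      exact integral_comp_eval (μ := fun _ : Fin n => gs s) (i := t) (f := fun x : ℝ => x ^ 2)
        (by fun_prop)
    simp [this]
  have hvar : variance (fun x : Fin n → ℝ => ∑ t, x t ^ 2) (gv n s) = n * V := by
    have := variance_sum_pi (μ := fun _ : Fin n => gs s) (X := fun _ x => x ^ 2)
      fun _ => memLp_sq_gs s
    simp only [Finset.sum_const, Finset.card_univ, Fintype.card_fin, nsmul_eq_mul] at this
    rw [hV, ← this, gv]
    congr 1
    ext x; simp
  have key := meas_ge_le_variance_div_sq hsum (c := n * δ) (by positivity)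
  rw [hmean, hvar] at key
  refine key.trans (ENNReal.ofReal_le_ofReal ?_)
  rw [div_lt_iff₀ (by positivity)] at hn₀
  rw [div_le_iff₀ (by positivity)]
  have h1 : V ≤ n * (δ ^ 2 * η) := hn₀.le.trans (by gcongr)
  calc (n : ℝ) * V ≤ n * (n * (δ ^ 2 * η)) := by gcongr
    _ = η * (n * δ) ^ 2 := by ring

theorem gv_energy_ge {s r η : ℝ} (hs : 0 ≤ s) (hr : s < r) (hη : 0 < η) :
    ∃ n₀ : ℕ, ∀ n ≥ n₀, gv n s {x | n * r ≤ ∑ t, x t ^ 2} ≤ ENNReal.ofReal η := by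
  obtain ⟨n₀, h⟩ := gv_energy hs (sub_pos.2 hr) hη
  refine ⟨n₀, fun n hn => (measure_mono fun x hx => ?_).trans (h n hn)⟩
  simp only [Set.mem_ofPred_eq] at hx ⊢
  exact le_trans (by linarith) (le_abs_self _)

theorem gv_energy_le {s r η : ℝ} (hs : 0 ≤ s) (hr : r < s) (hη : 0 < η) :
    ∃ n₀ : ℕ, ∀ n ≥ n₀, gv n s {x | ∑ t, x t ^ 2 ≤ n * r} ≤ ENNReal.ofReal η := by
  obtain ⟨n₀, h⟩ := gv_energy hs (sub_pos.2 hr) hη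
  refine ⟨n₀, fun n hn => (measure_mono fun x hx => ?_).trans (h n hn)⟩
  simp only [Set.mem_ofPred_eq] at hx ⊢
  exact le_trans (by linarith) (neg_le_abs _)

/-! ### Joint law of the two output noises by Gaussian regression. -/

theorem gs_lin_four {s t s' t' : ℝ} (hs : 0 ≤ s) (ht : 0 ≤ t) (hs' : 0 ≤ s') (ht' : 0 ≤ t')
    (a b c d : ℝ) :
    MeasurePreserving (fun p : (ℝ × ℝ) × (ℝ × ℝ) => a * p.1.1 + b * p.1.2 + (c * p.2.1 + d * p.2.2))
      (((gs s).prod (gs t)).prod ((gs s').prod (gs t')))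
      (gs (a ^ 2 * s + b ^ 2 * t + (c ^ 2 * s' + d ^ 2 * t'))) := by
  have h := (gs_lin (s := a ^ 2 * s + b ^ 2 * t) (t := c ^ 2 * s' + d ^ 2 * t') (by positivity)
    (by positivity) 1 1).comp ((gs_lin hs ht a b).prod (gs_lin hs' ht' c d))
  simpa [Function.comp_def] using h

/-- Cramér–Wold in the plane: the characteristic function at a functional depends only on the law of
that functional. -/
theorem measure_prod_ext_of_lin {μ ν : Measure (ℝ × ℝ)} [IsFiniteMeasure μ] [IsFiniteMeasure ν]
    (h : ∀ a b : ℝ, μ.map (fun p => a * p.1 + b * p.2) = ν.map (fun p => a * p.1 + b * p.2)) :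
    μ = ν := by
  refine Measure.ext_of_charFunDual (funext fun L => ?_)
  have hL : (L : ℝ × ℝ → ℝ) = fun p => L (1, 0) * p.1 + L (0, 1) * p.2 := by
    ext p
    conv_lhs => rw [show p = p.1 • ((1 : ℝ), (0 : ℝ)) + p.2 • ((0 : ℝ), (1 : ℝ)) by ext <;> simp]
    rw [map_add, map_smul, map_smul, smul_eq_mul, smul_eq_mul, mul_comm, mul_comm p.2]
  rw [charFunDual_eq_charFun_map_one, charFunDual_eq_charFun_map_one, hL, h]

/-- Variance of the interference and noise in the output of the other user. -/
noncomputable def varB (α' v v' : ℝ) : ℝ := 1 + α' ^ 2 * v + v'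

/-- Regression coefficient of one output noise on the other one. -/
noncomputable def regr (α α' v v' : ℝ) : ℝ := (α' * v + α * v') / varB α' v v'

/-- Conditional variance of one output noise given the other one. -/
noncomputable def varE (α α' v v' : ℝ) : ℝ :=
  1 + ((1 - α * α') ^ 2 * v * v' + α ^ 2 * v' + v) / varB α' v v'

theorem varB_pos {α' v v' : ℝ} (hv : 0 ≤ v) (hv' : 0 ≤ v') : 0 < varB α' v v' := by
  unfold varB; positivity

theorem varE_pos {α α' v v' : ℝ} (hv : 0 ≤ v) (hv' : 0 ≤ v') : 0 < varE α α' v v' := by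
  have := varB_pos (α' := α') hv hv'
  unfold varE; positivity

/-- Regression of jointly Gaussian variables: the own noise is `regr` times the other noise plus an
independent remainder of variance `varE`. It suffices to match the variance of every linear
combination. -/
theorem pair_law_one {α α' v v' : ℝ} (hv : 0 ≤ v) (hv' : 0 ≤ v') :
    (((gs v).prod (gs 1)).prod ((gs v').prod (gs 1))).map
      (fun p => (p.1.1 + α * p.2.1 + p.1.2, α' * p.1.1 + p.2.1 + p.2.2))
    = ((gs (varE α α' v v')).prod (gs (varB α' v v'))).map
      (fun p => (regr α α' v v' * p.2 + p.1, p.2)) := by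
  have hB := varB_pos (α' := α') hv hv'
  have hE := varE_pos (α := α) (α' := α') hv hv'
  have i1 : IsProbabilityMeasure ((((gs v).prod (gs 1)).prod ((gs v').prod (gs 1))).map
      (fun p => (p.1.1 + α * p.2.1 + p.1.2, α' * p.1.1 + p.2.1 + p.2.2))) :=
    Measure.isProbabilityMeasure_map (by fun_prop)
  have i2 : IsProbabilityMeasure (((gs (varE α α' v v')).prod (gs (varB α' v v'))).map
      (fun p => (regr α α' v v' * p.2 + p.1, p.2))) :=
    Measure.isProbabilityMeasure_map (by fun_prop)
  refine measure_prod_ext_of_lin fun a b => ?_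
  rw [Measure.map_map (by fun_prop) (by fun_prop), Measure.map_map (by fun_prop) (by fun_prop)]
  have h1 := (gs_lin_four hv zero_le_one hv' zero_le_one (a + b * α') a (a * α + b) b).map_eq
  have h2 := (gs_lin hE.le hB.le a (a * regr α α' v v' + b)).map_eq
  convert! h1.trans ((congrArg gs ?_).trans h2.symm) using 2
  · ext p; simp; ring
  · ext p; simp; ring
  · unfold regr varE
    field_simp
    unfold varB
    ring

theorem lintegral_pair_law {n : ℕ} {α α' v v' : ℝ} (hv : 0 ≤ v) (hv' : 0 ≤ v')
    {G : (Fin n → ℝ) × (Fin n → ℝ) → ENNReal} (hG : Measurable G) :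
    ∫⁻ p, G (p.1.1 + α • p.2.1 + p.1.2, α' • p.1.1 + p.2.1 + p.2.2)
      ∂(((gv n v).prod (gv n 1)).prod ((gv n v').prod (gv n 1)))
    = ∫⁻ b, ∫⁻ e, G (regr α α' v v' • b + e, b) ∂(gv n (varE α α' v v'))
        ∂(gv n (varB α' v v')) := by
  set ν := ((gs (varE α α' v v')).prod (gs (varB α' v v'))).map
      (fun p => (regr α α' v v' * p.2 + p.1, p.2)) with hν
  have i2 : IsProbabilityMeasure ν := Measure.isProbabilityMeasure_map (by fun_prop)
  have m1 : MeasurePreserving (fun p : (ℝ × ℝ) × (ℝ × ℝ) =>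
      (p.1.1 + α * p.2.1 + p.1.2, α' * p.1.1 + p.2.1 + p.2.2))
      (((gs v).prod (gs 1)).prod ((gs v').prod (gs 1))) ν :=
    ⟨by fun_prop, pair_law_one hv hv'⟩
  have m2 : MeasurePreserving (fun p : ℝ × ℝ => (regr α α' v v' * p.2 + p.1, p.2))
      ((gs (varE α α' v v')).prod (gs (varB α' v v'))) ν := ⟨by fun_prop, rfl⟩
  have M1 := (measurePreserving_pi_prod (n := n) m1).comp
    ((measurePreserving_pi_prod (n := n) (.id ((gs v).prod (gs 1)))).prod
      (measurePreserving_pi_prod (n := n) (.id ((gs v').prod (gs 1)))))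
  have M2 := measurePreserving_pi_prod (n := n) m2
  have hG' : Measurable fun w : Fin n → ℝ × ℝ => G (fun t => (w t).1, fun t => (w t).2) := by
    fun_prop
  have e1 := M1.lintegral_comp hG'
  have e2 := M2.lintegral_comp hG'
  refine (e1.trans e2.symm).trans ?_
  exact lintegral_prod_symm _ (by fun_prop)

theorem lintegral_gv {n : ℕ} {s : ℝ} (hs : 0 < s) {g : (Fin n → ℝ) → ENNReal} (hg : Measurable g) :
    ∫⁻ x, g x ∂(gv n s) = ∫⁻ x, ENNReal.ofReal (phv s x) * g x := by
  rw [gv_eq_withDensity n hs, lintegral_withDensity_eq_lintegral_mul _ (by fun_prop) hg]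
  rfl

/-- Joint density of the two outputs, given the parts `p`, `q` of the signals. -/
noncomputable def pairDens {n : ℕ} (α α' v v' : ℝ) (p q y z : Fin n → ℝ) : ℝ :=
  phv (varE α α' v v') (y - p - regr α α' v v' • (z - q)) * phv (varB α' v v') (z - q)

/-- Identifies `pairDens` as the conditional density of both outputs: integrate the regression form
against the two Gaussian densities, then translate first z, then y. -/
theorem lintegral_pair_dens {n : ℕ} {α α' v v' : ℝ} (hv : 0 ≤ v) (hv' : 0 ≤ v')
    {G : (Fin n → ℝ) × (Fin n → ℝ) → ENNReal} (hG : Measurable G) (x q : Fin n → ℝ) :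
    ∫⁻ p, G (x + (p.1.1 + α • p.2.1 + p.1.2), q + (α' • p.1.1 + p.2.1 + p.2.2))
      ∂(((gv n v).prod (gv n 1)).prod ((gv n v').prod (gv n 1)))
    = ∫⁻ z, ∫⁻ y, ENNReal.ofReal (pairDens α α' v v' x q y z) * G (y, z) := by
  have hB := varB_pos (α' := α') hv hv'
  have hE := varE_pos (α := α) (α' := α') hv hv'
  rw [lintegral_pair_law (G := fun w => G (x + w.1, q + w.2)) hv hv' (by fun_prop),
    lintegral_gv hB (Measurable.lintegral_prod_right' (f := fun w : (Fin n → ℝ) × (Fin n → ℝ) =>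
      G (x + (regr α α' v v' • w.1 + w.2), q + w.1)) (by fun_prop)),
    ← lintegral_sub_right_eq_self _ q]
  refine lintegral_congr fun z => ?_
  rw [lintegral_gv hE (by fun_prop), ← lintegral_const_mul _ (by fun_prop),
    ← lintegral_sub_right_eq_self _ (x + regr α α' v v' • (z - q))]
  refine lintegral_congr fun y => ?_
  rw [← mul_assoc, ← ENNReal.ofReal_mul (phv_pos hB _).le, pairDens, sub_sub, mul_comm (phv _ _)]
  congr 3 <;> ext t <;> simp [← add_assoc]

/-! ### Near uniformity in total variation. -/

/-- `K` is, up to total variation `δ`, uniform and independent of `V`. -/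
def NearUniform {Ω A B : Type*} [MeasurableSpace Ω] [MeasurableSpace B] [Fintype A]
    (μ : Measure Ω) (K : Ω → A) (V : Ω → B) (δ : ℝ) : Prop :=
  ∀ S : A → Set B, (∀ i, MeasurableSet (S i)) →
    ∑ i, μ.real {ω | K ω = i ∧ V ω ∈ S i}
      ≤ (Fintype.card A : ℝ)⁻¹ * ∑ i, μ.real {ω | V ω ∈ S i} + δ

namespace NearUniform

variable {Ω A B D : Type*} [MeasurableSpace Ω] [MeasurableSpace B] [MeasurableSpace D] [Fintype A]
  {μ : Measure Ω} {K : Ω → A} {V : Ω → B} {δ : ℝ}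

/-- Data processing for the eavesdropper. -/
theorem comp (h : NearUniform μ K V δ) {g : B → D} (hg : Measurable g) :
    NearUniform μ K (fun ω => g (V ω)) δ :=
  fun S hS => h (fun i => g ⁻¹' S i) fun i => hg (hS i)

theorem mono (h : NearUniform μ K V δ) {δ' : ℝ} (hδ : δ ≤ δ') : NearUniform μ K V δ' :=
  fun S hS => (h S hS).trans (by gcongr)

theorem sum_real_eq [IsFiniteMeasure μ] [DecidableEq A] [MeasurableSpace A]
    [MeasurableSingletonClass A] (hK : Measurable K) {T : Set Ω}
    (hT : MeasurableSet T) : ∑ i, μ.real {ω | K ω = i ∧ ω ∈ T} = μ.real T := by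
  rw [← measureReal_iUnion_fintype]
  · congr 1; ext ω; simp
  · intro i j hij
    refine Set.disjoint_left.2 fun ω h1 h2 => hij (h1.1.symm.trans h2.1)
  · intro i
    exact (hK (measurableSet_singleton i)).inter hT

/-- Changing the random variables on an event of probability `η` costs `2 η`. -/
theorem congr_off [IsFiniteMeasure μ] [MeasurableSpace A] [MeasurableSingletonClass A]
    (h : NearUniform μ K V δ) {K' : Ω → A} {V' : Ω → B} (hK' : Measurable K') {Bad : Set Ω}
    (hBad : MeasurableSet Bad)
    (hoff : ∀ ω, ω ∉ Bad → K' ω = K ω ∧ V' ω = V ω) :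
    NearUniform μ K' V' (δ + 2 * μ.real Bad) := by
  classical
  intro S hS
  have h1 : ∀ i, μ.real {ω | K' ω = i ∧ V' ω ∈ S i}
      ≤ μ.real {ω | K ω = i ∧ V ω ∈ S i} + μ.real {ω | K' ω = i ∧ ω ∈ Bad} := by
    intro i
    refine (measureReal_mono ?_).trans (measureReal_union_le _ _)
    intro ω hω
    by_cases hb : ω ∈ Bad
    · exact Or.inr ⟨hω.1, hb⟩
    · obtain ⟨e1, e2⟩ := hoff ω hb
      exact Or.inl ⟨e1 ▸ hω.1, e2 ▸ hω.2⟩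
  have h2 : ∀ i, μ.real {ω | V ω ∈ S i} ≤ μ.real {ω | V' ω ∈ S i} + μ.real Bad := by
    intro i
    refine (measureReal_mono ?_).trans (measureReal_union_le _ _)
    intro ω hω
    by_cases hb : ω ∈ Bad
    · exact Or.inr hb
    · exact Or.inl (show V' ω ∈ S i from (hoff ω hb).2 ▸ hω)
  have h3 : (Fintype.card A : ℝ)⁻¹ * ∑ i, μ.real {ω | V ω ∈ S i}
      ≤ (Fintype.card A : ℝ)⁻¹ * ∑ i, μ.real {ω | V' ω ∈ S i} + μ.real Bad := by
    calc _ ≤ (Fintype.card A : ℝ)⁻¹ * ∑ i, (μ.real {ω | V' ω ∈ S i} + μ.real Bad) := by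
          gcongr with i; exact h2 i
      _ = (Fintype.card A : ℝ)⁻¹ * ∑ i, μ.real {ω | V' ω ∈ S i}
          + (Fintype.card A : ℝ)⁻¹ * Fintype.card A * μ.real Bad := by
          rw [Finset.sum_add_distrib, mul_add]; simp; ring
      _ ≤ _ := by
          gcongr
          calc _ ≤ 1 * μ.real Bad := by
                gcongr
                exact inv_mul_le_one
            _ = _ := one_mul _
  calc _ ≤ ∑ i, (μ.real {ω | K ω = i ∧ V ω ∈ S i} + μ.real {ω | K' ω = i ∧ ω ∈ Bad}) :=
        Finset.sum_le_sum fun i _ => h1 i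
    _ = ∑ i, μ.real {ω | K ω = i ∧ V ω ∈ S i} + μ.real Bad := by
        rw [Finset.sum_add_distrib, sum_real_eq hK' hBad]
    _ ≤ _ := by linarith [h S hS]

/-- If the pair `(K, F)` is nearly uniform given `V`, then `K` is nearly uniform given `(V, F)`. -/
theorem fst {F : Type*} [Fintype F] [MeasurableSpace F] [MeasurableSingletonClass F]
    [MeasurableSpace A] [MeasurableSingletonClass A] [IsProbabilityMeasure μ]
    {W : Ω → A × F} (hW : Measurable W) (hV : Measurable V) (h : NearUniform μ W V δ) :
    NearUniform μ (fun ω => (W ω).1) (fun ω => (V ω, (W ω).2)) (2 * δ) := by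
  classical
  intro S hS
  have hSf : ∀ i f, MeasurableSet {b | (b, f) ∈ S i} := fun i f =>
    (measurable_id.prodMk measurable_const) (hS i)
  have e1 : ∀ i, μ.real {ω | (W ω).1 = i ∧ (V ω, (W ω).2) ∈ S i}
      = ∑ f, μ.real {ω | W ω = (i, f) ∧ V ω ∈ {b | (b, f) ∈ S i}} := by
    intro i
    rw [← sum_real_eq (K := fun ω => (W ω).2) (by fun_prop)]
    · refine Finset.sum_congr rfl fun f _ => ?_
      congr 1; ext ω
      simp only [Set.mem_ofPred_eq, Prod.ext_iff]
      constructor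
      · rintro ⟨rfl, h2, h3⟩; exact ⟨⟨h2, rfl⟩, h3⟩
      · rintro ⟨⟨h2, rfl⟩, h3⟩; exact ⟨rfl, h2, h3⟩
    · exact ((measurable_fst.comp hW) (measurableSet_singleton i)).inter
        ((hV.prodMk (measurable_snd.comp hW)) (hS i))
  have hcard : (Fintype.card (A × F) : ℝ) = Fintype.card A * Fintype.card F := by
    rw [Fintype.card_prod]; push_cast; ring
  have h1 := h (fun p => {b | (b, p.2) ∈ S p.1}) fun p => hSf p.1 p.2
  rw [Fintype.sum_prod_type, Fintype.sum_prod_type, hcard] at h1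
  have hne : Nonempty Ω := Measure.nonempty_of_neZero μ
  obtain ⟨ω₀⟩ := hne
  have hA : (0 : ℝ) < Fintype.card A := by
    have : Nonempty A := ⟨(W ω₀).1⟩
    exact_mod_cast Fintype.card_pos
  have hF : (0 : ℝ) < Fintype.card F := by
    have : Nonempty F := ⟨(W ω₀).2⟩
    exact_mod_cast Fintype.card_pos
  -- the public part alone is nearly uniform given `V`, from below
  have h2 : ∀ i, (Fintype.card F : ℝ)⁻¹ * ∑ f, μ.real {ω | V ω ∈ {b | (b, f) ∈ S i}} - δ
      ≤ μ.real {ω | (V ω, (W ω).2) ∈ S i} := by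
    intro i
    -- The hypothesis only bounds probabilities from above; complements, taken independent of the
    -- key component, turn it into the lower bound.
    have h3 := h (fun p => {b | (b, p.2) ∈ S i}ᶜ) fun p => (hSf i p.2).compl
    rw [Fintype.sum_prod_type_right, Fintype.sum_prod_type_right, hcard] at h3
    have e2 : ∑ f, ∑ x, μ.real {ω | W ω = (x, f) ∧ V ω ∈ {b | (b, f) ∈ S i}ᶜ}
        = 1 - μ.real {ω | (V ω, (W ω).2) ∈ S i} := by
      have hm : MeasurableSet {ω | (V ω, (W ω).2) ∈ S i} :=
        (hV.prodMk (measurable_snd.comp hW)) (hS i)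
      rw [← probReal_compl_eq_one_sub hm, ← sum_real_eq (K := W) hW hm.compl,
        Fintype.sum_prod_type_right]
      refine Finset.sum_congr rfl fun f _ => Finset.sum_congr rfl fun x _ => ?_
      congr 1; ext ω
      simp only [Set.mem_ofPred_eq, Set.mem_compl_iff]
      constructor
      · rintro ⟨h1, h2⟩; refine ⟨h1, ?_⟩; rw [h1]; exact h2
      · rintro ⟨h1, h2⟩; refine ⟨h1, ?_⟩; rw [h1] at h2; exact h2
    have e3 : ∀ f, μ.real {ω | V ω ∈ {b | (b, f) ∈ S i}ᶜ}
        = 1 - μ.real {ω | V ω ∈ {b | (b, f) ∈ S i}} := fun f =>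
      probReal_compl_eq_one_sub (hV (hSf i f))
    rw [e2] at h3
    simp only [e3, Finset.sum_const, Finset.card_univ, nsmul_eq_mul, Finset.sum_sub_distrib,
      ← Finset.mul_sum, mul_one] at h3
    rw [mul_sub, mul_sub] at h3
    have e4 : ((Fintype.card A : ℝ) * Fintype.card F)⁻¹ * (Fintype.card A * Fintype.card F) = 1 :=
      inv_mul_cancel₀ (by positivity)
    have e5 : ∀ x : ℝ, ((Fintype.card A : ℝ) * Fintype.card F)⁻¹ * (Fintype.card A * x)
        = (Fintype.card F : ℝ)⁻¹ * x := fun x => by field_simp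
    simp only [Finset.mul_sum (Finset.univ : Finset F)] at h3
    simp only [← Finset.mul_sum (Finset.univ : Finset F)] at h3
    linarith [e5 (∑ f, μ.real {ω | V ω ∈ {b | (b, f) ∈ S i}})]
  have h4 : (Fintype.card A : ℝ)⁻¹ * ∑ i, (Fintype.card F : ℝ)⁻¹ *
        ∑ f, μ.real {ω | V ω ∈ {b | (b, f) ∈ S i}} - δ
      ≤ (Fintype.card A : ℝ)⁻¹ * ∑ i, μ.real {ω | (V ω, (W ω).2) ∈ S i} := by
    calc _ = (Fintype.card A : ℝ)⁻¹ * ∑ i, ((Fintype.card F : ℝ)⁻¹ *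
        ∑ f, μ.real {ω | V ω ∈ {b | (b, f) ∈ S i}} - δ) := by
          rw [Finset.sum_sub_distrib, mul_sub]
          simp [hA.ne']
      _ ≤ _ := by gcongr with i; exact h2 i
  rw [← Finset.mul_sum, ← mul_assoc, ← mul_inv] at h4
  simp only [e1]
  linarith

end NearUniform

/-! ### From near uniformity to entropy and mutual information. -/

/-- Pointwise price of passing from total variation to divergence. For f > 1/k split f = 1/k + (f -
1/k) and use log x ≤ x - 1 on the first part and log(kf) ≤ log k on the second. -/
theorem mul_log_mul_le {k f : ℝ} (hk : 1 ≤ k) (h0 : 0 ≤ f) (h1 : f ≤ 1) :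
    f * Real.log (k * f) ≤ max (f - k⁻¹) 0 * (1 + Real.log k) := by
  have hk0 : 0 < k := by linarith
  have hlk := Real.log_nonneg hk
  rcases le_or_gt f k⁻¹ with h | h
  · rw [max_eq_right (by linarith), zero_mul]
    refine mul_nonpos_of_nonneg_of_nonpos h0 (Real.log_nonpos (by positivity) ?_)
    calc k * f ≤ k * k⁻¹ := by gcongr
      _ = 1 := mul_inv_cancel₀ hk0.ne'
  · rw [max_eq_left (by linarith)]
    have hf : 0 < f := lt_trans (by positivity) h
    have e1 : Real.log (k * f) ≤ k * f - 1 := Real.log_le_sub_one_of_pos (by positivity)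
    have e2 : Real.log (k * f) ≤ Real.log k :=
      Real.log_le_log (by positivity) (by nlinarith)
    have e3 : f * Real.log (k * f) = k⁻¹ * Real.log (k * f) + (f - k⁻¹) * Real.log (k * f) := by
      ring
    have e4 : k⁻¹ * Real.log (k * f) ≤ f - k⁻¹ := by
      calc k⁻¹ * Real.log (k * f) ≤ k⁻¹ * (k * f - 1) := by gcongr
        _ = f - k⁻¹ := by field_simp
    have e5 : (f - k⁻¹) * Real.log (k * f) ≤ (f - k⁻¹) * Real.log k :=
      mul_le_mul_of_nonneg_left e2 (by linarith)
    linarith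

/-- Summed over an alphabet of size k, this says that the divergence from the uniform law is
nonnegative. -/
theorem sub_inv_le_mul_log {k p : ℝ} (hk : 0 < k) (hp : 0 ≤ p) :
    p - k⁻¹ ≤ p * Real.log (k * p) := by
  rcases hp.eq_or_lt with rfl | hp
  · simp [hk.le]
  · have := Real.one_sub_inv_le_log_of_pos (x := k * p) (by positivity)
    calc p - k⁻¹ = p * (1 - (k * p)⁻¹) := by field_simp
      _ ≤ _ := by gcongr

/-- A version of the conditional probability of K = i given V, truncated so that it lies in [0, 1]
everywhere and not just almost everywhere. -/
theorem exists_density_of_eq {Ω A B : Type*} [MeasurableSpace Ω] [MeasurableSpace B] {μ : Measure Ω}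
    [IsProbabilityMeasure μ] {K : Ω → A} {V : Ω → B} (hV : Measurable V) (i : A) :
    ∃ f : B → ℝ, Measurable f ∧ (∀ v, 0 ≤ f v) ∧ (∀ v, f v ≤ 1) ∧
      ∀ S, MeasurableSet S → μ {ω | K ω = i ∧ V ω ∈ S}
        = ∫⁻ v in S, ENNReal.ofReal (f v) ∂(μ.map V) := by
  set m := (μ.restrict {ω | K ω = i}).map V with hm
  have hle : m ≤ μ.map V := Measure.map_mono Measure.restrict_le_self hV
  have hac : m ≪ μ.map V := Measure.absolutelyContinuous_of_le hle
  have : IsFiniteMeasure m := by rw [hm]; infer_instance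
  have : IsProbabilityMeasure (μ.map V) := Measure.isProbabilityMeasure_map hV.aemeasurable
  have h1 : ∀ᵐ v ∂(μ.map V), m.rnDeriv (μ.map V) v ≤ 1 := Measure.rnDeriv_le_one_of_le hle
  refine ⟨fun v => (min (m.rnDeriv (μ.map V) v) 1).toReal, by fun_prop, fun v => by positivity,
    fun v => ?_, fun S hS => ?_⟩
  · exact ENNReal.toReal_le_of_le_ofReal zero_le_one (by simp)
  · have e : μ {ω | K ω = i ∧ V ω ∈ S} = m S := by
      rw [hm, Measure.map_apply hV hS, Measure.restrict_apply (hV hS), Set.inter_comm]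
      rfl
    rw [e, ← Measure.setLIntegral_rnDeriv hac]
    refine lintegral_congr_ae (ae_restrict_of_ae ?_)
    filter_upwards [h1] with v hv
    rw [min_eq_left hv, ENNReal.ofReal_toReal (ne_top_of_le_ne_top (by simp) hv)]

namespace NearUniform

variable {Ω A B : Type*} [MeasurableSpace Ω] [MeasurableSpace B] [Fintype A]
  {μ : Measure Ω} {K : Ω → A} {V : Ω → B} {δ : ℝ}

theorem one_le_card (μ : Measure Ω) [IsProbabilityMeasure μ] (K : Ω → A) :
    (1 : ℝ) ≤ Fintype.card A := by
  have hne : Nonempty Ω := Measure.nonempty_of_neZero μ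
  obtain ⟨ω₀⟩ := hne
  have : Nonempty A := ⟨K ω₀⟩
  exact_mod_cast Fintype.card_pos (α := A)

variable [MeasurableSpace A] [MeasurableSingletonClass A] [IsProbabilityMeasure μ]

theorem sum_prob (hK : Measurable K) : ∑ i, μ.real {ω | K ω = i} = 1 := by
  classical
  have := sum_real_eq (μ := μ) hK MeasurableSet.univ
  simpa using this

/-- The deficit log k - H(K) is Σ p log(kp), which `mul_log_mul_le` bounds by the total variation
excess times 1 + log k. -/
theorem le_entropyOf (h : NearUniform μ K V δ) (hK : Measurable K) :
    Real.log (Fintype.card A) - δ * (1 + Real.log (Fintype.card A)) ≤ entropyOf μ K := by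
  classical
  set k : ℝ := (Fintype.card A : ℝ) with hk
  have hk1 : 1 ≤ k := one_le_card μ K
  set p : A → ℝ := fun i => μ.real {ω | K ω = i} with hp
  have hp1 : ∑ i, p i = 1 := sum_prob hK
  have hd : ∑ i, max (p i - k⁻¹) 0 ≤ δ := by
    -- These sets ignore V; they sum up the excess of the marginal of K over the uniform law.
    have h1 := h (fun i => if k⁻¹ < p i then Set.univ else ∅) fun i => by
      split_ifs <;> simp
    have e1 : ∀ i, μ.real {ω | K ω = i ∧ V ω ∈ (if k⁻¹ < p i then Set.univ else ∅ : Set B)}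
        = if k⁻¹ < p i then p i else 0 := fun i => by
      split_ifs <;> simp [hp]
    have e2 : ∀ i, μ.real {ω | V ω ∈ (if k⁻¹ < p i then Set.univ else ∅ : Set B)}
        = if k⁻¹ < p i then 1 else 0 := fun i => by
      split_ifs <;> simp
    simp only [e1, e2, Finset.mul_sum] at h1
    rw [← sub_le_iff_le_add', ← Finset.sum_sub_distrib] at h1
    refine le_trans (Finset.sum_le_sum fun i _ => ?_) h1
    split_ifs with hi
    · rw [max_eq_left (by linarith), mul_one]
    · rw [max_eq_right (by linarith [not_lt.1 hi])]; simp
  have hent : entropyOf μ K = Real.log k - ∑ i, p i * Real.log (k * p i) := by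
    have e : ∀ i, p i * Real.log (k * p i) = p i * Real.log k + p i * Real.log (p i) := fun i => by
      rcases eq_or_ne (p i) 0 with h0 | h0
      · simp [h0]
      · rw [Real.log_mul (by positivity) h0, mul_add]
    rw [Finset.sum_congr rfl fun i _ => e i, Finset.sum_add_distrib, ← Finset.sum_mul, hp1, one_mul,
      sub_add_cancel_left, entropyOf, ← Finset.sum_neg_distrib]
    refine Finset.sum_congr rfl fun i _ => ?_
    rw [Real.negMulLog, map_measureReal_apply hK (measurableSet_singleton i), neg_mul]
    rfl
  rw [hent]
  have : ∑ i, p i * Real.log (k * p i) ≤ δ * (1 + Real.log k) :=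
    calc _ ≤ ∑ i, max (p i - k⁻¹) 0 * (1 + Real.log k) :=
          Finset.sum_le_sum fun i _ => mul_log_mul_le hk1 measureReal_nonneg
            measureReal_le_one
      _ = (∑ i, max (p i - k⁻¹) 0) * (1 + Real.log k) := by rw [Finset.sum_mul]
      _ ≤ _ := by
        have := Real.log_nonneg hk1
        gcongr
  linarith

/-- With f i the conditional probability of K = i given V, the information is Σ ∫ f i log(k f i) - Σ
p i log(k p i). The first sum is at most δ(1 + log k) by `mul_log_mul_le`; the second is nonnegative
by `sub_inv_le_mul_log`. -/
theorem mutualInfo_le (h : NearUniform μ K V δ) (hK : Measurable K) (hV : Measurable V) :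
    mutualInfo μ K V ≤ ENNReal.ofReal (δ * (1 + Real.log (Fintype.card A))) := by
  classical
  set k : ℝ := (Fintype.card A : ℝ) with hk
  have hk1 : 1 ≤ k := one_le_card μ K
  have hk0 : 0 < k := by linarith
  have hlk := Real.log_nonneg hk1
  set ν := μ.map V with hν
  have : IsProbabilityMeasure ν := Measure.isProbabilityMeasure_map hV.aemeasurable
  have : IsProbabilityMeasure (μ.map K) := Measure.isProbabilityMeasure_map hK.aemeasurable
  choose f hfm hf0 hf1 hfS using fun i => exists_density_of_eq (μ := μ) (K := K) hV i
  have hint : ∀ i, Integrable (f i) ν := fun i =>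
    Integrable.of_bound (hfm i).aestronglyMeasurable 1 (ae_of_all _ fun v => by
      rw [Real.norm_eq_abs, abs_of_nonneg (hf0 i v)]; exact hf1 i v)
  set p : A → ℝ := fun i => μ.real {ω | K ω = i} with hp
  have hp1 : ∑ i, p i = 1 := sum_prob hK
  have hp0 : ∀ i, 0 ≤ p i := fun i => measureReal_nonneg
  have hreal : ∀ i S, MeasurableSet S → μ.real {ω | K ω = i ∧ V ω ∈ S} = ∫ v in S, f i v ∂ν := by
    intro i S hS
    rw [measureReal_def, hfS i S hS, integral_eq_lintegral_of_nonneg_ae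
      (ae_of_all _ fun v => hf0 i v) (hfm i).aestronglyMeasurable]
  have hpi : ∀ i, ∫ v, f i v ∂ν = p i := by
    intro i
    have := hreal i _ MeasurableSet.univ
    simpa [hp] using this.symm
  -- the excess over the uniform law
  have hdint : ∀ i, Integrable (fun v => max (f i v - k⁻¹) 0) ν := fun i =>
    ((hint i).sub (integrable_const _)).pos_part
  have hd : ∑ i, ∫ v, max (f i v - k⁻¹) 0 ∂ν ≤ δ := by
    have hS : ∀ i, MeasurableSet {v | k⁻¹ < f i v} := fun i =>
      measurableSet_lt measurable_const (hfm i)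
    -- The sets where the conditional probability exceeds 1/k are extremal for total variation.
    have h1 := h (fun i => {v | k⁻¹ < f i v}) hS
    rw [← sub_le_iff_le_add', Finset.mul_sum, ← Finset.sum_sub_distrib] at h1
    refine le_trans (Finset.sum_le_sum fun i _ => le_of_eq ?_) h1
    have e2 : μ.real {ω | V ω ∈ {v | k⁻¹ < f i v}} = ∫ v in {v | k⁻¹ < f i v}, (1 : ℝ) ∂ν := by
      rw [setIntegral_const, smul_eq_mul, mul_one, hν, map_measureReal_apply hV (hS i)]
      rfl
    rw [hreal i _ (hS i), e2, ← integral_const_mul, ← integral_sub (hint i).integrableOn (by simp),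
      ← integral_indicator (hS i)]
    refine integral_congr_ae (ae_of_all _ fun v => ?_)
    by_cases hv : k⁻¹ < f i v
    · rw [Set.indicator_of_mem (show v ∈ {v | k⁻¹ < f i v} from hv)]
      simp only [mul_one]
      exact max_eq_left (by linarith)
    · rw [Set.indicator_of_notMem (show v ∉ {v | k⁻¹ < f i v} from hv)]
      exact max_eq_right (by linarith [not_lt.1 hv])
  have hPi : ∀ i, (μ.map K) {i} = ENNReal.ofReal (p i) := fun i => by
    rw [Measure.map_apply hK (measurableSet_singleton i), hp, ofReal_measureReal]
    rfl
  set g : A × B → ENNReal := fun x => ENNReal.ofReal (f x.1 x.2 / p x.1) with hg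
  have hgm : Measurable g :=
    (measurable_from_prod_countable_right fun i => by
      simp only [hg]; exact ((hfm i).div_const _).ennreal_ofReal)
  have hjoint : μ.map (fun ω => (K ω, V ω)) = ((μ.map K).prod ν).withDensity g := by
    ext S hS
    have hSi : ∀ i, MeasurableSet {v | (i, v) ∈ S} := fun i => measurable_prodMk_left hS
    rw [Measure.map_apply (hK.prodMk hV) hS, withDensity_apply _ hS, ← lintegral_indicator hS,
      lintegral_prod _ (hgm.indicator hS).aemeasurable, lintegral_fintype]
    have e1 : μ ((fun ω => (K ω, V ω)) ⁻¹' S) = ∑ i, μ {ω | K ω = i ∧ V ω ∈ {v | (i, v) ∈ S}} := by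
      rw [← tsum_fintype (L := .unconditional A), ← measure_iUnion]
      · congr 1; ext ω; simp
      · intro i j hij
        exact Set.disjoint_left.2 fun ω h1 h2 => hij (h1.1.symm.trans h2.1)
      · intro i
        exact (hK (measurableSet_singleton i)).inter (hV (hSi i))
    rw [e1]
    refine Finset.sum_congr rfl fun i _ => ?_
    rw [hfS i _ (hSi i), hPi, ← lintegral_indicator (hSi i)]
    -- If p i = 0 the quotient in g is 0 by convention; no harm is done, since f i then has integral
    -- 0.
    rcases (hp0 i).eq_or_lt with h0 | h0
    · rw [← h0, ENNReal.ofReal_zero, mul_zero]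
      have : ∫⁻ v, ENNReal.ofReal (f i v) ∂ν = 0 := by
        rw [← ofReal_integral_eq_lintegral_ofReal (hint i) (ae_of_all _ (hf0 i)), hpi, ← h0]
        simp
      refine le_antisymm (this ▸ lintegral_mono fun v => Set.indicator_le_self _ _ _) zero_le
    · rw [← lintegral_mul_const' _ _ ENNReal.ofReal_ne_top]
      refine lintegral_congr fun v => ?_
      by_cases hv : (i, v) ∈ S
      · rw [Set.indicator_of_mem (show v ∈ {v | (i, v) ∈ S} from hv), Set.indicator_of_mem hv, hg,
          ← ENNReal.ofReal_mul (div_nonneg (hf0 i v) h0.le), div_mul_cancel₀ _ h0.ne']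
      · rw [Set.indicator_of_notMem (show v ∉ {v | (i, v) ∈ S} from hv),
          Set.indicator_of_notMem hv, zero_mul]
  have hIpos : ∀ i, 0 < p i → ∀ v, p i * InformationTheory.klFun (f i v / p i)
      ≤ max (f i v - k⁻¹) 0 * (1 + Real.log k) - f i v * Real.log (k * p i) + p i - f i v := by
    intro i hi v
    have e : p i * InformationTheory.klFun (f i v / p i)
        = f i v * Real.log (k * f i v) - f i v * Real.log (k * p i) + p i - f i v := by
      rw [InformationTheory.klFun]
      rcases (hf0 i v).eq_or_lt with h0 | h0
      · simp [← h0]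
      · rw [Real.log_div h0.ne' hi.ne', Real.log_mul hk0.ne' h0.ne', Real.log_mul hk0.ne' hi.ne']
        field_simp
        ring
    rw [e]
    have := mul_log_mul_le hk1 (hf0 i v) (hf1 i v)
    linarith
  set I : A → ℝ := fun i => (∫ v, max (f i v - k⁻¹) 0 ∂ν) * (1 + Real.log k)
    - p i * Real.log (k * p i) with hI
  have hterm : ∀ i, 0 ≤ I i ∧
      (∫⁻ v, ENNReal.ofReal (InformationTheory.klFun (g (i, v)).toReal) ∂ν) * ENNReal.ofReal (p i)
        ≤ ENNReal.ofReal (I i) := by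
    intro i
    rcases (hp0 i).eq_or_lt with h0 | h0
    · have : 0 ≤ ∫ v, max (f i v - k⁻¹) 0 ∂ν := integral_nonneg fun v => le_max_right _ _
      refine ⟨?_, by simp [← h0]⟩
      rw [hI]; simp only [← h0]; simp; positivity
    · set R : B → ℝ := fun v => max (f i v - k⁻¹) 0 * (1 + Real.log k)
        - f i v * Real.log (k * p i) + p i - f i v with hR
      have hRint : Integrable R ν :=
        ((((hdint i).mul_const _).sub ((hint i).mul_const _)).add (integrable_const _)).sub (hint i)
      have hRI : ∫ v, R v ∂ν = I i := by
        have i1 : Integrable (fun v => max (f i v - k⁻¹) 0 * (1 + Real.log k)) ν :=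
          (hdint i).mul_const _
        have i2 : Integrable (fun v => f i v * Real.log (k * p i)) ν := (hint i).mul_const _
        have i3 : Integrable (fun v => max (f i v - k⁻¹) 0 * (1 + Real.log k)
          - f i v * Real.log (k * p i)) ν := i1.sub i2
        have i4 : Integrable (fun v => max (f i v - k⁻¹) 0 * (1 + Real.log k)
          - f i v * Real.log (k * p i) + p i) ν := i3.add (integrable_const _)
        rw [hR, integral_sub i4 (hint i), integral_add i3 (integrable_const _), integral_sub i1 i2,
          integral_mul_const, integral_mul_const, hpi]
        simp [hI]
      have hkl : ∀ v, 0 ≤ p i * InformationTheory.klFun (f i v / p i) := fun v =>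
        mul_nonneg h0.le (InformationTheory.klFun_nonneg (div_nonneg (hf0 i v) h0.le))
      have hR0 : ∀ v, 0 ≤ R v := fun v => (hkl v).trans (hIpos i h0 v)
      refine ⟨hRI ▸ integral_nonneg hR0, ?_⟩
      rw [← hRI, ofReal_integral_eq_lintegral_ofReal hRint (ae_of_all _ hR0),
        ← lintegral_mul_const' _ _ ENNReal.ofReal_ne_top]
      refine lintegral_mono fun v => ?_
      rw [hg]
      simp only
      rw [ENNReal.toReal_ofReal (div_nonneg (hf0 i v) h0.le), mul_comm,
        ← ENNReal.ofReal_mul h0.le]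
      exact ENNReal.ofReal_le_ofReal (hIpos i h0 v)
  have hfin : IsFiniteMeasure (((μ.map K).prod ν).withDensity g) := by
    rw [← hjoint]; infer_instance
  rw [mutualInfo, ← hν, hjoint, InformationTheory.klDiv_eq_lintegral_klFun]
  have hac : ((μ.map K).prod ν).withDensity g ≪ (μ.map K).prod ν :=
    withDensity_absolutelyContinuous _ _
  rw [if_pos hac]
  have hcongr : ∀ᵐ x ∂((μ.map K).prod ν), ENNReal.ofReal (InformationTheory.klFun
      ((((μ.map K).prod ν).withDensity g).rnDeriv ((μ.map K).prod ν) x).toReal)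
      = ENNReal.ofReal (InformationTheory.klFun (g x).toReal) := by
    filter_upwards [Measure.rnDeriv_withDensity ((μ.map K).prod ν) hgm] with x hx
    rw [hx]
  rw [lintegral_congr_ae hcongr, lintegral_prod _ (by fun_prop), lintegral_fintype]
  simp only [hPi]
  calc _ ≤ ∑ i, ENNReal.ofReal (I i) := Finset.sum_le_sum fun i _ => (hterm i).2
    _ = ENNReal.ofReal (∑ i, I i) := (ENNReal.ofReal_sum_of_nonneg fun i _ => (hterm i).1).symm
    _ ≤ _ := by
      refine ENNReal.ofReal_le_ofReal ?_
      rw [hI, Finset.sum_sub_distrib, ← Finset.sum_mul]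
      have e1 : ∑ i, (p i - k⁻¹) ≤ ∑ i, p i * Real.log (k * p i) :=
        Finset.sum_le_sum fun i _ => sub_inv_le_mul_log hk0 (hp0 i)
      rw [Finset.sum_sub_distrib, hp1] at e1
      simp only [Finset.sum_const, Finset.card_univ, nsmul_eq_mul, ← hk, mul_inv_cancel₀ hk0.ne',
        sub_self] at e1
      have e2 : (∑ i, ∫ v, max (f i v - k⁻¹) 0 ∂ν) * (1 + Real.log k) ≤ δ * (1 + Real.log k) := by
        gcongr
      linarith

end NearUniform

/-! ### Leftover hashing by random binning. -/

section RandomBinning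

variable {W I : Type*} [Fintype W] [Fintype I]

/-- Pairwise independence of a uniformly random function: with its values off w frozen, its value at
w is still uniform. -/
theorem sum_hash_pair [DecidableEq W] {w w' : W} (hne : w' ≠ w) (g : I → I → ℝ) {c : ℝ}
    (hg : ∀ j, ∑ i, g i j = c) :
    (Fintype.card I : ℝ) * ∑ h : W → I, g (h w) (h w') = c * Fintype.card (W → I) := by
  have e1 : ∑ h : W → I, g (h w) (h w')
      = ∑ x : I × ({j // j ≠ w} → I), g x.1 (x.2 ⟨w', hne⟩) := by
    refine Fintype.sum_equiv (Equiv.funSplitAt w I) _ _ fun h => ?_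
    simp
  rw [e1, Fintype.sum_prod_type_right, Finset.sum_congr rfl fun x _ => hg _,
    Fintype.card_congr (Equiv.funSplitAt w I), Fintype.card_prod]
  simp
  ring

variable [DecidableEq I]

/-- Total mass of the bin `i` under the binning `h`. -/
def binMass (p : W → ℝ) (h : W → I) (i : I) : ℝ := ∑ w, if h w = i then p w else 0

theorem sum_binMass (p : W → ℝ) (h : W → I) : ∑ i, binMass p h i = ∑ w, p w := by
  unfold binMass
  rw [Finset.sum_comm]
  simp

variable [DecidableEq W]

/-- Average over all binnings of the squared deviation of the bin masses from their mean. -/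
theorem sum_sq_binMass [Nonempty I] (p : W → ℝ) :
    ∑ h : W → I, ∑ i, (binMass p h i - (Fintype.card I : ℝ)⁻¹ * ∑ w, p w) ^ 2
      = Fintype.card (W → I) * (1 - (Fintype.card I : ℝ)⁻¹) * ∑ w, p w ^ 2 := by
  set κ : ℝ := (Fintype.card I : ℝ) with hκ
  have hκ0 : κ ≠ 0 := by rw [hκ]; exact_mod_cast Fintype.card_ne_zero
  set H : ℝ := (Fintype.card (W → I) : ℝ) with hH
  set s := ∑ w, p w with hs
  have e1 : ∀ h : W → I, ∑ i, (binMass p h i - κ⁻¹ * s) ^ 2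
      = (∑ w, ∑ w', p w * p w' * if h w = h w' then 1 else 0) - κ⁻¹ * s ^ 2 := by
    intro h
    have e2 : ∑ i, binMass p h i ^ 2
        = ∑ w, ∑ w', p w * p w' * if h w = h w' then 1 else 0 := by
      simp only [binMass, sq, Finset.sum_mul_sum]
      rw [Finset.sum_comm]
      refine Finset.sum_congr rfl fun w _ => ?_
      rw [Finset.sum_comm]
      refine Finset.sum_congr rfl fun w' _ => ?_
      rw [Finset.sum_eq_single (h w)]
      · by_cases hww : h w = h w' <;> simp [hww, eq_comm]
      · intro i _ hi; simp [hi.symm]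
      · simp
    calc _ = ∑ i, (binMass p h i ^ 2 - 2 * κ⁻¹ * s * binMass p h i + (κ⁻¹ * s) ^ 2) := by
          refine Finset.sum_congr rfl fun i _ => ?_; ring
      _ = _ := by
          rw [Finset.sum_add_distrib, Finset.sum_sub_distrib, ← Finset.mul_sum, sum_binMass, e2]
          simp only [Finset.sum_const, Finset.card_univ, nsmul_eq_mul, ← hκ, ← hs]
          field_simp
          ring
  -- Distinct points collide in a fraction 1/κ of all binnings; the diagonal carries the remaining
  -- variance.
  have e3 : ∀ w w', ∑ h : W → I, p w * p w' * (if h w = h w' then (1 : ℝ) else 0)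
      = p w * p w' * (κ⁻¹ * H) + if w = w' then p w * p w' * (H * (1 - κ⁻¹)) else 0 := by
    intro w w'
    rw [← Finset.mul_sum]
    by_cases hw : w = w'
    · subst hw
      simp only [if_true, mul_one, Finset.sum_const, Finset.card_univ, nsmul_eq_mul, ← hH]
      ring
    · have := sum_hash_pair (I := I) (fun h => hw h.symm : w' ≠ w)
        (fun i j => if i = j then (1 : ℝ) else 0) (c := 1) (by simp)
      rw [← hκ, one_mul, ← hH] at this
      rw [if_neg hw, add_zero, ← this]
      field_simp
  rw [Finset.sum_congr rfl fun h _ => e1 h, Finset.sum_sub_distrib, Finset.sum_comm]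
  rw [Finset.sum_congr rfl fun w _ => Finset.sum_comm]
  simp only [e3, Finset.sum_add_distrib, Finset.sum_ite_eq, Finset.mem_univ, if_true]
  simp only [← Finset.sum_mul, ← Finset.mul_sum, ← hs]
  simp only [Finset.sum_const, Finset.card_univ, nsmul_eq_mul, ← hH, sq]
  ring

/-- Second moment method: x ≤ κx²/(2τP) + τP/(2κ) trades the positive part for the squared
deviation, and p² ≤ bP p makes the result linear in p. The second term adds up to τP/2 over the κ
bins. -/
theorem sum_pos_dev_binMass_le [Nonempty I] {p : W → ℝ} {b P τ : ℝ} (hP : 0 < P) (hτ : 0 < τ)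
    (hp0 : ∀ w, 0 ≤ p w) (hp : ∀ w, p w ≤ b * P) :
    ∑ h : W → I, ∑ i, max (binMass p h i - (Fintype.card I : ℝ)⁻¹ * ∑ w, p w) 0
      ≤ Fintype.card (W → I) *
        ((Fintype.card I - 1) * b / (2 * τ) * ∑ w, p w + τ / 2 * P) := by
  have hκ0 : (1 : ℝ) ≤ Fintype.card I := by exact_mod_cast Fintype.card_pos
  set κ : ℝ := (Fintype.card I : ℝ) with hκ
  have amgm : ∀ x : ℝ, max x 0 ≤ κ / (2 * τ * P) * x ^ 2 + τ * P / (2 * κ) := by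
    intro x
    have h1 : κ / (2 * τ * P) * x ^ 2 + τ * P / (2 * κ) - x
        = (κ * x - τ * P) ^ 2 / (2 * τ * P * κ) := by
      field_simp; ring
    have h2 : 0 ≤ (κ * x - τ * P) ^ 2 / (2 * τ * P * κ) := by positivity
    exact max_le (by linarith) (by positivity)
  have hsq : ∑ w, p w ^ 2 ≤ b * P * ∑ w, p w := by
    rw [Finset.mul_sum]
    refine Finset.sum_le_sum fun w _ => ?_
    rw [sq]
    exact mul_le_mul_of_nonneg_right (hp w) (hp0 w)
  calc _ ≤ ∑ h : W → I, ∑ i, (κ / (2 * τ * P) * (binMass p h i - κ⁻¹ * ∑ w, p w) ^ 2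
          + τ * P / (2 * κ)) := Finset.sum_le_sum fun h _ => Finset.sum_le_sum fun i _ => amgm _
    _ = Fintype.card (W → I) * ((κ - 1) / (2 * τ * P) * ∑ w, p w ^ 2 + τ / 2 * P) := by
        simp only [Finset.sum_add_distrib, ← Finset.mul_sum]
        rw [sum_sq_binMass]
        simp only [Finset.sum_const, Finset.card_univ, nsmul_eq_mul, ← hκ]
        field_simp
    _ ≤ Fintype.card (W → I) * ((κ - 1) / (2 * τ * P) * (b * P * ∑ w, p w) + τ / 2 * P) := by
        have : 0 ≤ κ - 1 := by linarith
        gcongr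
    _ = _ := by field_simp

/-- Leftover hash lemma, for randomness `V` of the eavesdropper with a density. -/
theorem exists_nearUniform_binning [Nonempty I] {Ω Z : Type*} [MeasurableSpace Ω]
    [MeasurableSpace Z] [MeasurableSpace W] [MeasurableSingletonClass W]
    {μ : Measure Ω} [IsProbabilityMeasure μ] {ref : Measure Z} {X : Ω → W} {V : Ω → Z}
    (hX : Measurable X) (hV : Measurable V) {T : Set Ω} (hT : MeasurableSet T)
    {p : W → Z → ℝ} {P : Z → ℝ} {b τ : ℝ} (hτ : 0 < τ)
    (hpm : ∀ w, Measurable (p w)) (hp0 : ∀ w z, 0 ≤ p w z) (hPm : Measurable P)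
    (hP0 : ∀ z, 0 < P z) (hP1 : ∫⁻ z, ENNReal.ofReal (P z) ∂ref = 1)
    (hpP : ∀ w z, p w z ≤ b * P z) (hb : (Fintype.card I - 1) * b ≤ τ ^ 2)
    (hlaw : ∀ w S, MeasurableSet S →
      μ {ω | X ω = w ∧ V ω ∈ S ∧ ω ∈ T} = ∫⁻ z in S, ENNReal.ofReal (p w z) ∂ref) :
    ∃ δ : (W → I) → ℝ, (∑ h, δ h ≤ Fintype.card (W → I) * τ) ∧ (∀ h, 0 ≤ δ h) ∧
      ∀ h, NearUniform μ (fun ω => h (X ω)) V (δ h + μ.real Tᶜ) := by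
  have hpint : ∀ w, Integrable (p w) ref := fun w => by
    refine ⟨(hpm w).aestronglyMeasurable, ?_⟩
    rw [hasFiniteIntegral_iff_ofReal (ae_of_all _ (hp0 w)), ← setLIntegral_univ,
      ← hlaw w _ MeasurableSet.univ]
    exact measure_lt_top _ _
  have hPint : Integrable P ref := by
    refine ⟨hPm.aestronglyMeasurable, ?_⟩
    rw [hasFiniteIntegral_iff_ofReal (ae_of_all _ fun z => (hP0 z).le), hP1]
    exact ENNReal.one_lt_top
  have hPI : ∫ z, P z ∂ref = 1 := by
    rw [integral_eq_lintegral_of_nonneg_ae (ae_of_all _ fun z => (hP0 z).le)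
      hPm.aestronglyMeasurable, hP1, ENNReal.toReal_one]
  have hreal : ∀ w S, MeasurableSet S →
      μ.real {ω | X ω = w ∧ V ω ∈ S ∧ ω ∈ T} = ∫ z in S, p w z ∂ref := by
    intro w S hS
    rw [measureReal_def, hlaw w S hS, integral_eq_lintegral_of_nonneg_ae
      (ae_of_all _ fun z => hp0 w z) (hpm w).aestronglyMeasurable]
  have hsumreal : ∀ S, MeasurableSet S →
      ∑ w, ∫ z in S, p w z ∂ref = μ.real {ω | V ω ∈ S ∧ ω ∈ T} := by
    intro S hS
    rw [← NearUniform.sum_real_eq hX (T := {ω | V ω ∈ S ∧ ω ∈ T}) ((hV hS).inter hT)]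
    exact Finset.sum_congr rfl fun w _ => (hreal w S hS).symm
  set κ : ℝ := (Fintype.card I : ℝ) with hκ
  have hbint : ∀ (h : W → I) i, Integrable (fun z => binMass (fun w => p w z) h i) ref := by
    intro h i
    refine integrable_finsetSum _ fun w _ => ?_
    by_cases hw : h w = i
    · simp only [if_pos hw]; exact hpint w
    · simp only [if_neg hw]; exact integrable_zero _ _ _
  have hsint : Integrable (fun z => ∑ w, p w z) ref := integrable_finsetSum _ fun w _ => hpint w
  have hdev : ∀ (h : W → I) i, Integrable (fun z =>
      max (binMass (fun w => p w z) h i - κ⁻¹ * ∑ w, p w z) 0) ref := fun h i =>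
    ((hbint h i).sub (hsint.const_mul _)).pos_part
  -- The error of a binning is the integrated excess of its bin masses over the uniform share,
  -- computed with the densities cut down to T; leaving T is paid for separately.
  refine ⟨fun h => ∑ i, ∫ z, max (binMass (fun w => p w z) h i - κ⁻¹ * ∑ w, p w z) 0 ∂ref,
    ?_, fun h => Finset.sum_nonneg fun i _ => integral_nonneg fun z => le_max_right _ _,
    fun h S hS => ?_⟩
  · calc _ = ∫ z, ∑ h : W → I, ∑ i,
          max (binMass (fun w => p w z) h i - κ⁻¹ * ∑ w, p w z) 0 ∂ref := by
          rw [integral_finsetSum _ fun h _ => integrable_finsetSum _ fun i _ => hdev h i]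
          refine Finset.sum_congr rfl fun h _ => ?_
          rw [integral_finsetSum _ fun i _ => hdev h i]
      _ ≤ ∫ z, Fintype.card (W → I) *
          ((κ - 1) * b / (2 * τ) * ∑ w, p w z + τ / 2 * P z) ∂ref := by
          refine integral_mono
            (integrable_finsetSum _ fun h _ => integrable_finsetSum _ fun i _ => hdev h i)
            (((hsint.const_mul _).add (hPint.const_mul _)).const_mul _) fun z => ?_
          exact sum_pos_dev_binMass_le (hP0 z) hτ (fun w => hp0 w z) fun w => hpP w z
      _ = Fintype.card (W → I) * ((κ - 1) * b / (2 * τ) * (∫ z, ∑ w, p w z ∂ref) + τ / 2) := by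
          rw [integral_const_mul, integral_add (hsint.const_mul _) (hPint.const_mul _),
            integral_const_mul, integral_const_mul, hPI, mul_one]
      _ ≤ Fintype.card (W → I) * τ := by
          have h1 : ∫ z, ∑ w, p w z ∂ref ≤ 1 := by
            rw [integral_finsetSum _ fun w _ => hpint w]
            have := hsumreal _ MeasurableSet.univ
            simp only [setIntegral_univ] at this
            rw [this]
            exact measureReal_le_one
          have h0 : 0 ≤ ∫ z, ∑ w, p w z ∂ref :=
            integral_nonneg fun z => Finset.sum_nonneg fun w _ => hp0 w z
          -- The bound (κ - 1) b ≤ τ² makes this half of the estimate no larger than the other one.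
          have h2 : (κ - 1) * b / (2 * τ) ≤ τ / 2 := by
            rw [div_le_iff₀ (by positivity)]; linarith
          have h3 : (κ - 1) * b / (2 * τ) * (∫ z, ∑ w, p w z ∂ref) ≤ τ / 2 * 1 :=
            (mul_le_mul_of_nonneg_right h2 h0).trans
              (mul_le_mul_of_nonneg_left h1 (by positivity))
          gcongr
          linarith
  · have e1 : ∀ i, μ.real {ω | h (X ω) = i ∧ V ω ∈ S i ∧ ω ∈ T}
        = ∫ z in S i, binMass (fun w => p w z) h i ∂ref := by
      intro i
      have e2 : ∀ w, ∫ z in S i, (if h w = i then p w z else 0) ∂ref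
          = if h w = i then μ.real {ω | X ω = w ∧ V ω ∈ S i ∧ ω ∈ T} else 0 := by
        intro w
        split_ifs with hw
        · rw [hreal w _ (hS i)]
        · simp
      unfold binMass
      rw [integral_finsetSum, Finset.sum_congr rfl fun w _ => e2 w]
      · rw [← NearUniform.sum_real_eq hX
          (T := {ω | h (X ω) = i ∧ V ω ∈ S i ∧ ω ∈ T})]
        · refine Finset.sum_congr rfl fun w _ => ?_
          split_ifs with hw
          · congr 1; ext ω
            simp only [Set.mem_ofPred_eq]
            constructor
            · rintro ⟨rfl, _, h3⟩; exact ⟨rfl, h3⟩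
            · rintro ⟨rfl, h3⟩; exact ⟨rfl, hw, h3⟩
          · convert! measureReal_empty using 2
            ext ω
            simp only [Set.mem_ofPred_eq, Set.mem_empty_iff_false, iff_false]
            rintro ⟨rfl, h2, _⟩; exact hw h2
        · exact (hX (MeasurableSet.of_discrete (s := {w | h w = i}))).inter ((hV (hS i)).inter hT)
      · intro w _
        by_cases hw : h w = i
        · simp only [if_pos hw]; exact (hpint w).integrableOn
        · simp only [if_neg hw]; exact integrable_zero _ _ _
    have e3 : ∀ i, ∫ z in S i, binMass (fun w => p w z) h i ∂ref
        ≤ κ⁻¹ * μ.real {ω | V ω ∈ S i}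
          + ∫ z, max (binMass (fun w => p w z) h i - κ⁻¹ * ∑ w, p w z) 0 ∂ref := by
      intro i
      calc _ ≤ ∫ z in S i, (κ⁻¹ * ∑ w, p w z
            + max (binMass (fun w => p w z) h i - κ⁻¹ * ∑ w, p w z) 0) ∂ref := by
            refine integral_mono (hbint h i).integrableOn
              ((hsint.const_mul _).add (hdev h i)).integrableOn fun z => ?_
            have := le_max_left (binMass (fun w => p w z) h i - κ⁻¹ * ∑ w, p w z) 0
            simp only
            linarith
        _ = κ⁻¹ * μ.real {ω | V ω ∈ S i ∧ ω ∈ T}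
            + ∫ z in S i, max (binMass (fun w => p w z) h i - κ⁻¹ * ∑ w, p w z) 0 ∂ref := by
            rw [integral_add (hsint.const_mul _).integrableOn (hdev h i).integrableOn,
              integral_const_mul, integral_finsetSum _ fun w _ => (hpint w).integrableOn,
              hsumreal _ (hS i)]
        _ ≤ _ := by
            refine add_le_add (mul_le_mul_of_nonneg_left (measureReal_mono fun ω hω => hω.1)
              (by positivity)) ?_
            exact setIntegral_le_integral (hdev h i) (ae_of_all _ fun z => le_max_right _ _)
    have e4 : ∀ i, μ.real {ω | h (X ω) = i ∧ V ω ∈ S i}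
        ≤ μ.real {ω | h (X ω) = i ∧ V ω ∈ S i ∧ ω ∈ T} + μ.real {ω | h (X ω) = i ∧ ω ∈ Tᶜ} := by
      intro i
      refine (measureReal_mono ?_).trans (measureReal_union_le _ _)
      intro ω hω
      by_cases ht : ω ∈ T
      · exact Or.inl ⟨hω.1, hω.2, ht⟩
      · exact Or.inr ⟨hω.1, ht⟩
    have e5 : ∑ i, μ.real {ω | h (X ω) = i ∧ ω ∈ Tᶜ} = μ.real Tᶜ := by
      let _ : MeasurableSpace I := ⊤
      exact NearUniform.sum_real_eq ((measurable_of_finite h).comp hX) hT.compl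
    calc _ ≤ ∑ i, ((κ⁻¹ * μ.real {ω | V ω ∈ S i}
          + ∫ z, max (binMass (fun w => p w z) h i - κ⁻¹ * ∑ w, p w z) 0 ∂ref)
          + μ.real {ω | h (X ω) = i ∧ ω ∈ Tᶜ}) :=
          Finset.sum_le_sum fun i _ => (e4 i).trans (by rw [e1 i]; gcongr; exact e3 i)
      _ = _ := by
          rw [Finset.sum_add_distrib, Finset.sum_add_distrib, e5, ← Finset.mul_sum, add_assoc]

end RandomBinning

/-! ### Random coding with a threshold decoder. -/

section Decoder

/-- The law of a random Gaussian codebook with `M` words. -/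
noncomputable def codebook (M n : ℕ) (u : ℝ) : Measure (Fin M → Fin n → ℝ) :=
  Measure.pi fun _ => gv n u

instance (M n : ℕ) (u : ℝ) : IsProbabilityMeasure (codebook M n u) := by
  unfold codebook; infer_instance

theorem measurePreserving_codeword (M n : ℕ) (u : ℝ) (m : Fin M) :
    MeasurePreserving (fun C : Fin M → Fin n → ℝ => C m) (codebook M n u) (gv n u) :=
  measurePreserving_eval (fun _ => gv n u) m

theorem measurePreserving_codeword_pair {M n : ℕ} (u : ℝ) {m m' : Fin M} (h : m' ≠ m) :
    MeasurePreserving (fun C : Fin M → Fin n → ℝ => (C m', C m)) (codebook M n u)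
      ((gv n u).prod (gv n u)) := by
  refine ⟨by fun_prop, ?_⟩
  have hi : IndepFun (fun C : Fin M → Fin n → ℝ => C m') (fun C => C m) (codebook M n u) :=
    (iIndepFun_pi (μ := fun _ : Fin M => gv n u) (X := fun _ x => x)
      fun _ => aemeasurable_id).indepFun h
  rw [(indepFun_iff_map_prod_eq_prod_map_map (measurable_pi_apply m').aemeasurable
    (measurable_pi_apply m).aemeasurable).1 hi,
    (measurePreserving_codeword M n u m').map_eq, (measurePreserving_codeword M n u m).map_eq]

/-- The pairs (codeword, output) that pass the threshold test with rate `g`. -/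
def decTest (n : ℕ) (u σ g : ℝ) : Set ((Fin n → ℝ) × (Fin n → ℝ)) :=
  {p | Real.exp (n * g) * phv (u + σ) p.2 ≤ phv σ (p.2 - p.1)}

theorem measurableSet_decTest (n : ℕ) (u σ g : ℝ) : MeasurableSet (decTest n u σ g) :=
  measurableSet_le (by fun_prop) (by fun_prop)

/-- Change of measure: on the test set the density of an independent output is at most exp(-ng)
times the channel density, which integrates to 1. -/
theorem decTest_indep_le {n : ℕ} {u σ : ℝ} (hu : 0 ≤ u) (hσ : 0 < σ) (g : ℝ) :
    ((gv n u).prod (gv n (u + σ))) (decTest n u σ g) ≤ ENNReal.ofReal (Real.exp (-(n * g))) := by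
  have huσ : 0 < u + σ := by positivity
  rw [Measure.prod_apply (measurableSet_decTest n u σ g)]
  have h1 : ∀ x : Fin n → ℝ, gv n (u + σ) (Prod.mk x ⁻¹' decTest n u σ g)
      ≤ ENNReal.ofReal (Real.exp (-(n * g))) := by
    intro x
    have hm : MeasurableSet (Prod.mk x ⁻¹' decTest n u σ g) :=
      measurable_prodMk_left (measurableSet_decTest n u σ g)
    rw [gv_eq_withDensity n huσ, withDensity_apply _ hm]
    calc _ ≤ ∫⁻ y in Prod.mk x ⁻¹' decTest n u σ g,
          ENNReal.ofReal (Real.exp (-(n * g))) * ENNReal.ofReal (phv σ (y - x)) := by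
          refine setLIntegral_mono (by fun_prop) fun y hy => ?_
          rw [← ENNReal.ofReal_mul (Real.exp_pos _).le]
          refine ENNReal.ofReal_le_ofReal ?_
          have hy' : Real.exp (n * g) * phv (u + σ) y ≤ phv σ (y - x) := hy
          rw [Real.exp_neg, ← div_eq_inv_mul, le_div_iff₀ (Real.exp_pos _)]
          linarith
      _ ≤ ∫⁻ y, ENNReal.ofReal (Real.exp (-(n * g))) * ENNReal.ofReal (phv σ (y - x)) :=
          setLIntegral_le_lintegral _ _
      _ = ENNReal.ofReal (Real.exp (-(n * g))) := by
          rw [lintegral_const_mul _ (by fun_prop),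
            lintegral_sub_right_eq_self (fun y => ENNReal.ofReal (phv σ y)) x]
          have := lintegral_gv (n := n) hσ (g := fun _ => 1) measurable_const
          simp only [lintegral_const, measure_univ, mul_one] at this
          rw [← this, mul_one]
  calc _ ≤ ∫⁻ _, ENNReal.ofReal (Real.exp (-(n * g))) ∂(gv n u) := lintegral_mono h1
    _ = _ := by simp

/-- The log-likelihood ratio is nC plus a difference of two normalized energies. With the noise
energy at most n(1+δ) times its variance and the output energy at least n(1-δ) times its variance,
it is at least n(C - δ) = ng. -/
theorem decTest_true {u σ g η : ℝ} (hu : 0 ≤ u) (hσ : 0 < σ) (hg : g < gaussCap (u / σ))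
    (hη : 0 < η) : ∃ n₀ : ℕ, ∀ n ≥ n₀, ((gv n u).prod (gv n σ))
      {p | (p.1, p.1 + p.2) ∉ decTest n u σ g} ≤ ENNReal.ofReal η := by
  set δ := gaussCap (u / σ) - g with hδ
  have hδ0 : 0 < δ := by linarith
  have huσ : 0 < u + σ := by positivity
  obtain ⟨n₁, h₁⟩ := gv_energy_ge hσ.le (r := σ * (1 + δ)) (by nlinarith) (half_pos hη)
  obtain ⟨n₂, h₂⟩ := gv_energy_le huσ.le (r := (u + σ) * (1 - δ)) (by nlinarith) (half_pos hη)
  refine ⟨max n₁ n₂, fun n hn => ?_⟩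
  have hsub : {p : (Fin n → ℝ) × (Fin n → ℝ) | (p.1, p.1 + p.2) ∉ decTest n u σ g}
      ⊆ Prod.snd ⁻¹' {x | n * (σ * (1 + δ)) ≤ ∑ t, x t ^ 2} ∪
        (fun p : (Fin n → ℝ) × (Fin n → ℝ) => (1 : ℝ) • p.1 + (1 : ℝ) • p.2) ⁻¹'
          {x | ∑ t, x t ^ 2 ≤ n * ((u + σ) * (1 - δ))} := by
    intro p hp
    by_contra hcon
    simp only [Set.mem_union, Set.mem_preimage, Set.mem_ofPred_eq, not_or, not_le, one_smul]
      at hcon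
    refine hp ?_
    obtain ⟨c1, c2⟩ := hcon
    simp only [decTest, Set.mem_ofPred_eq, add_sub_cancel_left]
    rw [phv_eq huσ, phv_eq hσ, ← Real.exp_add]
    refine Real.exp_le_exp.2 ?_
    have d1 : (∑ t, p.2 t ^ 2) / (2 * σ) ≤ n * (1 + δ) / 2 := by
      rw [div_le_iff₀ (by positivity)]; linarith
    have d2 : n * (1 - δ) / 2 ≤ (∑ t, (p.1 + p.2) t ^ 2) / (2 * (u + σ)) := by
      rw [le_div_iff₀ (by positivity)]; linarith
    have d3 : gaussCap (u / σ) = Real.log (2 * Real.pi * (u + σ)) / 2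
        - Real.log (2 * Real.pi * σ) / 2 := by
      rw [gaussCap, ← sub_div, ← Real.log_div (by positivity) (by positivity)]
      rw [show 1 + u / σ = 2 * Real.pi * (u + σ) / (2 * Real.pi * σ) by field_simp; ring]
      ring
    have d4 : (n : ℝ) * g = n * (gaussCap (u / σ)) - n * δ := by rw [hδ]; ring
    rw [d4, d3]
    linarith
  refine (measure_mono hsub).trans ((measure_union_le _ _).trans ?_)
  have hm1 : MeasurableSet {x : Fin n → ℝ | n * (σ * (1 + δ)) ≤ ∑ t, x t ^ 2} :=
    measurableSet_le (by fun_prop) (by fun_prop)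
  have hm2 : MeasurableSet {x : Fin n → ℝ | ∑ t, x t ^ 2 ≤ n * ((u + σ) * (1 - δ))} :=
    measurableSet_le (by fun_prop) (by fun_prop)
  have hl := gv_lin (n := n) hu hσ.le 1 1
  rw [one_pow, one_mul, one_mul] at hl
  rw [measurePreserving_snd.measure_preimage hm1.nullMeasurableSet,
    hl.measure_preimage hm2.nullMeasurableSet]
  calc _ ≤ ENNReal.ofReal (η / 2) + ENNReal.ofReal (η / 2) :=
        add_le_add (h₁ n (le_trans (le_max_left _ _) hn)) (h₂ n (le_trans (le_max_right _ _) hn))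
    _ = _ := by rw [← ENNReal.ofReal_add (by positivity) (by positivity), add_halves]

theorem exists_exp_neg_le {δ η : ℝ} (hδ : 0 < δ) (hη : 0 < η) :
    ∃ n₀ : ℕ, ∀ n ≥ n₀, Real.exp (-((n : ℝ) * δ)) ≤ η := by
  have h : Filter.Tendsto (fun n : ℕ => Real.exp (-((n : ℝ) * δ))) Filter.atTop (nhds 0) :=
    Real.tendsto_exp_neg_atTop_nhds_zero.comp
      (tendsto_natCast_atTop_atTop.atTop_mul_const hδ)
  obtain ⟨n₀, h₀⟩ := Filter.eventually_atTop.1 (h.eventually_lt_const hη)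
  exact ⟨n₀, fun n hn => (h₀ n hn).le⟩

/-- The event that the threshold decoder does not single out the word `m`. -/
def decFail {M n : ℕ} (D : Set ((Fin n → ℝ) × (Fin n → ℝ))) (m : Fin M) :
    Set ((Fin M → Fin n → ℝ) × (Fin n → ℝ)) :=
  {p | (p.1 m, p.1 m + p.2) ∉ D} ∪ ⋃ m' ∈ {m' | m' ≠ m}, {p | (p.1 m', p.1 m + p.2) ∈ D}

theorem measurableSet_decFail {M n : ℕ} {D : Set ((Fin n → ℝ) × (Fin n → ℝ))}
    (hD : MeasurableSet D) (m : Fin M) : MeasurableSet (decFail D m) := by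
  refine MeasurableSet.union ?_ (MeasurableSet.biUnion (Set.to_countable _) fun m' _ => ?_)
  · exact ((by fun_prop : Measurable fun p : (Fin M → Fin n → ℝ) × (Fin n → ℝ) =>
      (p.1 m, p.1 m + p.2)) hD).compl
  · exact (by fun_prop : Measurable fun p : (Fin M → Fin n → ℝ) × (Fin n → ℝ) =>
      (p.1 m', p.1 m + p.2)) hD

/-- Random coding for the Gaussian channel with noise variance `σ`, below capacity. -/
theorem exists_decoder {u σ R : ℝ} (hu : 0 ≤ u) (hσ : 0 < σ) (hR : R < gaussCap (u / σ))
    {η : ℝ} (hη : 0 < η) :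
    ∃ n₀ : ℕ, ∀ n ≥ n₀, ∃ D : Set ((Fin n → ℝ) × (Fin n → ℝ)), MeasurableSet D ∧
      ∀ M : ℕ, (M : ℝ) - 1 ≤ Real.exp (n * R) → ∀ m : Fin M,
        ((codebook M n u).prod (gv n σ)) (decFail D m) ≤ ENNReal.ofReal η := by
  -- A threshold below capacity accepts the true word; above R it beats the union bound over the M -
  -- 1 wrong words. Counting M - 1 admits R < 0 with M = 1.
  obtain ⟨g, hg1, hg2⟩ := exists_between hR
  obtain ⟨n₁, h₁⟩ := decTest_true hu hσ hg2 (half_pos hη)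
  obtain ⟨n₂, h₂⟩ := exists_exp_neg_le (sub_pos.2 hg1) (half_pos hη)
  refine ⟨max n₁ n₂, fun n hn => ⟨decTest n u σ g, measurableSet_decTest n u σ g,
    fun M hM m => ?_⟩⟩
  have hD := measurableSet_decTest n u σ g
  refine (measure_union_le _ _).trans ?_
  have e1 : ((codebook M n u).prod (gv n σ)) {p | (p.1 m, p.1 m + p.2) ∉ decTest n u σ g}
      ≤ ENNReal.ofReal (η / 2) := by
    have hp := (measurePreserving_codeword M n u m).prod (.id (gv n σ))
    refine le_trans (le_of_eq ?_) (h₁ n (le_trans (le_max_left _ _) hn))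
    refine hp.measure_preimage (s := {p | (p.1, p.1 + p.2) ∉ decTest n u σ g})
      (MeasurableSet.nullMeasurableSet ?_)
    exact ((by fun_prop : Measurable fun p : (Fin n → ℝ) × (Fin n → ℝ) =>
      (p.1, p.1 + p.2)) hD).compl
  have e2 : ∀ m' ≠ m, ((codebook M n u).prod (gv n σ))
      {p | (p.1 m', p.1 m + p.2) ∈ decTest n u σ g} ≤ ENNReal.ofReal (Real.exp (-(n * g))) := by
    intro m' hm'
    have hp := (measurePreserving_codeword_pair (n := n) u hm').prod (.id (gv n σ))
    have hl := gv_lin (n := n) hu hσ.le 1 1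
    rw [one_pow, one_mul, one_mul] at hl
    have hq := ((MeasurePreserving.id (gv n u)).prod hl).comp
      ((measurePreserving_prodAssoc (gv n u) (gv n u) (gv n σ)).comp hp)
    refine le_trans (le_of_eq ?_) (decTest_indep_le hu hσ g)
    rw [← hq.measure_preimage hD.nullMeasurableSet]
    congr 1
    ext p
    simp [MeasurableEquiv.prodAssoc]
  have e3 : ((codebook M n u).prod (gv n σ))
      (⋃ m' ∈ {m' | m' ≠ m}, {p | (p.1 m', p.1 m + p.2) ∈ decTest n u σ g})
      ≤ ENNReal.ofReal (η / 2) := by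
    have hset : {m' | m' ≠ m} = ((Finset.univ.erase m : Finset (Fin M)) : Set (Fin M)) := by
      ext; simp
    rw [hset]
    refine (measure_biUnion_finset_le _ _).trans ?_
    calc _ ≤ ∑ m' ∈ Finset.univ.erase m, ENNReal.ofReal (Real.exp (-(n * g))) :=
          Finset.sum_le_sum fun m' hm' => e2 m' (Finset.ne_of_mem_erase hm')
      _ = ENNReal.ofReal (((M : ℝ) - 1) * Real.exp (-(n * g))) := by
          have hM1 : 1 ≤ M := by have := m.2; omega
          rw [Finset.sum_const, Finset.card_erase_of_mem (Finset.mem_univ m), Finset.card_univ,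
            Fintype.card_fin, nsmul_eq_mul, ENNReal.ofReal_mul (by
              rw [sub_nonneg]; exact_mod_cast hM1)]
          congr 1
          rw [show (M : ℝ) - 1 = ((M - 1 : ℕ) : ℝ) by rw [Nat.cast_sub hM1, Nat.cast_one],
            ENNReal.ofReal_natCast]
      _ ≤ _ := by
          refine ENNReal.ofReal_le_ofReal (le_trans ?_ (h₂ n (le_trans (le_max_right _ _) hn)))
          calc _ ≤ Real.exp (n * R) * Real.exp (-(n * g)) := by gcongr
            _ = _ := by rw [← Real.exp_add]; congr 1; ring
  calc _ ≤ ENNReal.ofReal (η / 2) + ENNReal.ofReal (η / 2) := add_le_add e1 e3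
    _ = _ := by rw [← ENNReal.ofReal_add (by positivity) (by positivity), add_halves]

end Decoder

/-! ### Quantization cells and volume bounds on lists. -/

section Cells

/-- Lower corner of the quantization cell with index `w`, for cells of side `Δ`. -/
noncomputable def corner {n N : ℕ} (Δ : ℝ) (w : Fin n → Fin N) (t : Fin n) : ℝ :=
  ((w t : ℕ) : ℝ) * Δ - N * Δ / 2

/-- The quantization cell with index `w`. -/
def cell {n N : ℕ} (Δ : ℝ) (w : Fin n → Fin N) : Set (Fin n → ℝ) :=
  Set.univ.pi fun t => Set.Ico (corner Δ w t) (corner Δ w t + Δ)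

theorem measurableSet_cell {n N : ℕ} (Δ : ℝ) (w : Fin n → Fin N) : MeasurableSet (cell Δ w) :=
  MeasurableSet.univ_pi fun _ => measurableSet_Ico

theorem volume_cell {n N : ℕ} {Δ : ℝ} (hΔ : 0 < Δ) (w : Fin n → Fin N) :
    volume (cell Δ w) = ENNReal.ofReal (Δ ^ n) := by
  rw [cell, volume_pi_pi]
  simp [ENNReal.ofReal_pow hΔ.le]

theorem disjoint_cell {n N : ℕ} {Δ : ℝ} (hΔ : 0 < Δ) {w w' : Fin n → Fin N} (h : w ≠ w') :
    Disjoint (cell Δ w) (cell Δ w') := by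
  refine Set.disjoint_left.2 fun y hy hy' => h (funext fun t => Fin.ext ?_)
  have h1 := hy t trivial
  have h2 := hy' t trivial
  simp only [corner, Set.mem_Ico] at h1 h2
  have a1 : ((w t : ℕ) : ℝ) * Δ < ((w' t : ℕ) + 1 : ℝ) * Δ := by linarith
  have a2 : ((w' t : ℕ) : ℝ) * Δ < ((w t : ℕ) + 1 : ℝ) * Δ := by linarith
  have b1 := lt_of_mul_lt_mul_right a1 hΔ.le
  have b2 := lt_of_mul_lt_mul_right a2 hΔ.le
  have c1 : (w t : ℕ) < w' t + 1 := by exact_mod_cast b1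
  have c2 : (w' t : ℕ) < w t + 1 := by exact_mod_cast b2
  omega

/-- Scalar quantizer with `N + 1` cells of side `Δ`, clipped at both ends. -/
noncomputable def quant (N : ℕ) (Δ y : ℝ) : Fin (N + 1) :=
  ⟨min ⌊y / Δ + (N + 1) / 2⌋₊ N, by omega⟩

theorem measurable_quant (N : ℕ) (Δ : ℝ) : Measurable (quant N Δ) := by
  have h : Measurable fun y : ℝ => min ⌊y / Δ + (N + 1) / 2⌋₊ N :=
    (Nat.measurable_floor.comp (by fun_prop)).min measurable_const
  refine measurable_to_countable' fun i => ?_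
  have : quant N Δ ⁻¹' {i} = (fun y : ℝ => min ⌊y / Δ + (N + 1) / 2⌋₊ N) ⁻¹' {(i : ℕ)} := by
    ext y; simp [quant, Fin.ext_iff]
  rw [this]
  exact h (measurableSet_singleton _)

/-- Inside the box the clipping of `quant` is inactive, so a point lies in the cell of its own
index. -/
theorem mem_cell_quant {n N : ℕ} {Δ : ℝ} (hΔ : 0 < Δ) {y : Fin n → ℝ}
    (hy : ∀ t, |y t| < (N + 1) * Δ / 2) : y ∈ cell Δ fun t => quant N Δ (y t) := by
  intro t _
  have h1 := abs_lt.1 (hy t)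
  have h0 : 0 ≤ y t / Δ + ((N : ℝ) + 1) / 2 := by
    have : -(((N : ℝ) + 1) / 2) ≤ y t / Δ := by
      rw [le_div_iff₀ hΔ]; linarith [h1.1]
    linarith
  have hlt : y t / Δ + ((N : ℝ) + 1) / 2 < (N : ℝ) + 1 := by
    have : y t / Δ < ((N : ℝ) + 1) / 2 := by
      rw [div_lt_iff₀ hΔ]; linarith [h1.2]
    linarith
  have hfl : ⌊y t / Δ + ((N : ℝ) + 1) / 2⌋₊ ≤ N := by
    rw [← Nat.lt_succ_iff, Nat.floor_lt h0]
    push_cast; exact hlt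
  have f1 := Nat.floor_le h0
  have f2 := Nat.lt_floor_add_one (y t / Δ + ((N : ℝ) + 1) / 2)
  simp only [corner, quant, min_eq_left hfl, Set.mem_Ico, Nat.cast_add, Nat.cast_one]
  set j : ℝ := (⌊y t / Δ + ((N : ℝ) + 1) / 2⌋₊ : ℝ)
  have e : y t / Δ * Δ = y t := div_mul_cancel₀ _ hΔ.ne'
  constructor
  · nlinarith
  · nlinarith

/-- On the ball the Gaussian density of variance ρ is at least the inverse of the bound, and it
integrates to 1. -/
theorem volume_ball_le {n : ℕ} {ρ : ℝ} (hρ : 0 < ρ) (x : Fin n → ℝ) :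
    volume {y : Fin n → ℝ | ∑ t, (y t - x t) ^ 2 ≤ n * ρ}
      ≤ ENNReal.ofReal (Real.exp (n * ((Real.log (2 * Real.pi * ρ) + 1) / 2))) := by
  set S := {y : Fin n → ℝ | ∑ t, (y t - x t) ^ 2 ≤ n * ρ} with hS
  have hm : MeasurableSet S := measurableSet_le (by fun_prop) (by fun_prop)
  set c := Real.exp (n * ((Real.log (2 * Real.pi * ρ) + 1) / 2)) with hc
  have h1 : ∫⁻ y, ENNReal.ofReal (phv ρ (y - x)) = 1 := by
    rw [lintegral_sub_right_eq_self (fun y => ENNReal.ofReal (phv ρ y)) x]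
    have := lintegral_gv (n := n) hρ (g := fun _ => 1) measurable_const
    simpa using this.symm
  calc volume S = ∫⁻ y in S, 1 := by simp
    _ ≤ ∫⁻ y in S, ENNReal.ofReal c * ENNReal.ofReal (phv ρ (y - x)) := by
        refine setLIntegral_mono (by fun_prop) fun y hy => ?_
        rw [← ENNReal.ofReal_mul (Real.exp_pos _).le, ← ENNReal.ofReal_one]
        refine ENNReal.ofReal_le_ofReal ?_
        rw [phv_eq hρ, ← Real.exp_add]
        refine Real.one_le_exp ?_
        have hy' : ∑ t, (y - x) t ^ 2 ≤ n * ρ := hy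
        have : (∑ t, (y - x) t ^ 2) / (2 * ρ) ≤ n / 2 := by
          rw [div_le_iff₀ (by positivity)]; linarith
        linarith
    _ ≤ ∫⁻ y, ENNReal.ofReal c * ENNReal.ofReal (phv ρ (y - x)) := setLIntegral_le_lintegral _ _
    _ = _ := by rw [lintegral_const_mul _ (by fun_prop), h1, mul_one]

theorem add_sq_le_weighted {κ : ℝ} (hκ : 0 < κ) (a b : ℝ) :
    (a + b) ^ 2 ≤ (1 + κ) * a ^ 2 + (1 + κ⁻¹) * b ^ 2 := by
  have : (1 + κ) * a ^ 2 + (1 + κ⁻¹) * b ^ 2 - (a + b) ^ 2 = (κ * a - b) ^ 2 / κ := by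
    field_simp; ring
  have h2 : 0 ≤ (κ * a - b) ^ 2 / κ := by positivity
  linarith

theorem sum_sq_add_le {n : ℕ} {κ Δ r : ℝ} (hκ : 0 < κ) {a b : Fin n → ℝ}
    (ha : ∑ t, a t ^ 2 ≤ n * r) (hb : ∀ t, b t ^ 2 ≤ Δ ^ 2) :
    ∑ t, (a t + b t) ^ 2 ≤ n * ((1 + κ) * r + (1 + κ⁻¹) * Δ ^ 2) := by
  calc _ ≤ ∑ t, ((1 + κ) * a t ^ 2 + (1 + κ⁻¹) * Δ ^ 2) := by
        refine Finset.sum_le_sum fun t _ => (add_sq_le_weighted hκ _ _).trans ?_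
        have h0 : 0 ≤ 1 + κ⁻¹ := by positivity
        linarith [mul_le_mul_of_nonneg_left (hb t) h0]
    _ = (1 + κ) * ∑ t, a t ^ 2 + n * ((1 + κ⁻¹) * Δ ^ 2) := by
        rw [Finset.sum_add_distrib, ← Finset.mul_sum]; simp
    _ ≤ (1 + κ) * (n * r) + n * ((1 + κ⁻¹) * Δ ^ 2) := by gcongr
    _ = _ := by ring

/-- Lists of quantization cells: a point within energy `ρ₀` of a cell is listed, and the number
of listed cells is bounded by the volume of a ball of energy `ρ`. -/
theorem exists_cell_lists {s ρ c : ℝ} (hs : 0 < s) (hρ : s < ρ) :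
    ∃ Δ ρ₀ : ℝ, 0 < Δ ∧ Real.log Δ ≤ c ∧ s < ρ₀ ∧ ∀ n N : ℕ,
      ∃ L : (Fin n → Fin N) → Set (Fin n → ℝ), (∀ w, MeasurableSet (L w)) ∧
        (∀ w x y, y ∈ cell Δ w → ∑ t, (y t - x t) ^ 2 ≤ n * ρ₀ → x ∈ L w) ∧
        ∀ x, ∀ F : Finset (Fin n → Fin N), (∀ w ∈ F, x ∈ L w) →
          F.card * Δ ^ n ≤ Real.exp (n * ((Real.log (2 * Real.pi * ρ) + 1) / 2)) := by
  -- Three factors 1 + κ: one from s to ρ₀, one from the point y to the corner of its cell, one from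
  -- the corner back to an arbitrary point of the cell.
  obtain ⟨κ, hκ0, hκ⟩ : ∃ κ : ℝ, 0 < κ ∧ (1 + κ) * ((1 + κ) * ((1 + κ) * s)) < ρ := by
    have hc : Filter.Tendsto (fun κ : ℝ => (1 + κ) * ((1 + κ) * ((1 + κ) * s)))
        (nhdsWithin 0 (Set.Ioi 0)) (nhds ((1 + 0) * ((1 + 0) * ((1 + 0) * s)))) :=
      ((by fun_prop : Continuous fun κ : ℝ => (1 + κ) * ((1 + κ) * ((1 + κ) * s))).tendsto
        0).mono_left nhdsWithin_le_nhds
    have := (hc.eventually_lt_const (by linarith : _ < ρ)).and self_mem_nhdsWithin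
    obtain ⟨κ, h1, h2⟩ := this.exists
    exact ⟨κ, h2, h1⟩
  obtain ⟨Δ, hΔ0, hΔ1, hΔ⟩ : ∃ Δ : ℝ, 0 < Δ ∧ Δ < Real.exp c ∧ (1 + κ) * ((1 + κ) * ((1 + κ) * s)
      + (1 + κ⁻¹) * Δ ^ 2) + (1 + κ⁻¹) * Δ ^ 2 < ρ := by
    have hc : Filter.Tendsto (fun Δ : ℝ => (1 + κ) * ((1 + κ) * ((1 + κ) * s)
        + (1 + κ⁻¹) * Δ ^ 2) + (1 + κ⁻¹) * Δ ^ 2)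
        (nhdsWithin 0 (Set.Ioi 0)) (nhds ((1 + κ) * ((1 + κ) * ((1 + κ) * s)
        + (1 + κ⁻¹) * 0 ^ 2) + (1 + κ⁻¹) * 0 ^ 2)) :=
      ((by fun_prop : Continuous fun Δ : ℝ => (1 + κ) * ((1 + κ) * ((1 + κ) * s)
        + (1 + κ⁻¹) * Δ ^ 2) + (1 + κ⁻¹) * Δ ^ 2).tendsto 0).mono_left nhdsWithin_le_nhds
    have h3 : ∀ᶠ Δ : ℝ in nhdsWithin 0 (Set.Ioi 0), Δ < Real.exp c :=
      (Filter.tendsto_id.mono_left nhdsWithin_le_nhds).eventually_lt_const (Real.exp_pos c)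
    have := ((hc.eventually_lt_const (by simpa using hκ : _ < ρ)).and h3).and self_mem_nhdsWithin
    obtain ⟨Δ, ⟨h1, h3⟩, h2⟩ := this.exists
    exact ⟨Δ, h2, h3, h1⟩
  refine ⟨Δ, (1 + κ) * s, hΔ0, ?_, by nlinarith, fun n N => ?_⟩
  · rw [← Real.log_exp c]; exact Real.log_le_log hΔ0 hΔ1.le
  -- A cell is listed according to the distance from x to its corner.
  refine ⟨fun w => {x | ∑ t, (corner Δ w t - x t) ^ 2
    ≤ n * ((1 + κ) * ((1 + κ) * s) + (1 + κ⁻¹) * Δ ^ 2)}, fun w =>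
    measurableSet_le (by fun_prop) (by fun_prop), fun w x y hy hxy => ?_, fun x F hF => ?_⟩
  · have := sum_sq_add_le hκ0 hxy (b := fun t => corner Δ w t - y t) (Δ := Δ) fun t => by
      have := hy t trivial
      rw [Set.mem_Ico] at this
      exact sq_le_sq' (by linarith) (by linarith)
    simpa using this
  · have hρ0 : 0 < ρ := hs.trans hρ
    -- All listed cells fit entirely into one ball; being disjoint, they are counted by volume.
    have hsub : (⋃ w ∈ F, cell Δ w) ⊆ {y : Fin n → ℝ | ∑ t, (y t - x t) ^ 2 ≤ n * ρ} := by
      intro y hy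
      simp only [Set.mem_iUnion] at hy
      obtain ⟨w, hw, hy⟩ := hy
      have := sum_sq_add_le hκ0 (hF w hw) (b := fun t => y t - corner Δ w t) (Δ := Δ) fun t => by
        have := hy t trivial
        rw [Set.mem_Ico] at this
        exact sq_le_sq' (by linarith) (by linarith)
      have h2 : ∑ t, (y t - x t) ^ 2 ≤ n * ((1 + κ) * ((1 + κ) * ((1 + κ) * s)
          + (1 + κ⁻¹) * Δ ^ 2) + (1 + κ⁻¹) * Δ ^ 2) := by
        simpa [add_comm, add_sub_assoc] using this
      exact h2.trans (by gcongr)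
    have hvol := (measure_mono hsub).trans (volume_ball_le hρ0 x)
    rw [measure_biUnion_finset (fun w _ w' _ h => disjoint_cell hΔ0 h)
      fun w _ => measurableSet_cell Δ w] at hvol
    simp only [volume_cell hΔ0, Finset.sum_const, nsmul_eq_mul] at hvol
    rw [← ENNReal.ofReal_natCast, ← ENNReal.ofReal_mul (by positivity)] at hvol
    exact (ENNReal.ofReal_le_ofReal_iff (Real.exp_pos _).le).1 hvol

end Cells

/-! ### Typical sets and conditional densities of one side. -/

section Side

/-- Codeword, dummy signal and receiver noise of one base station and its user. -/
abbrev Side (n : ℕ) : Type := (Fin n → ℝ) × ((Fin n → ℝ) × (Fin n → ℝ))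

/-- The law of `Side n` for a Gaussian codeword. -/
noncomputable def idealSide (n : ℕ) (u v : ℝ) : Measure (Side n) :=
  (gv n u).prod ((gv n v).prod (gv n 1))

instance (n : ℕ) (u v : ℝ) : IsProbabilityMeasure (idealSide n u v) := by
  unfold idealSide; infer_instance

theorem gv_lin_three {n : ℕ} {u v : ℝ} (hu : 0 ≤ u) (hv : 0 ≤ v) (a b c : ℝ) :
    MeasurePreserving (fun p : Side n => a • p.1 + (b • p.2.1 + c • p.2.2)) (idealSide n u v)
      (gv n (a ^ 2 * u + (b ^ 2 * v + c ^ 2))) := by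
  have h := (gv_lin (n := n) (t := b ^ 2 * v + c ^ 2 * 1) hu (by positivity) a 1).comp
    ((MeasurePreserving.id (gv n u)).prod (gv_lin hv zero_le_one b c))
  simpa [Function.comp_def, idealSide] using h

theorem gv_lin_six {n : ℕ} {u v u' v' : ℝ} (hu : 0 ≤ u) (hv : 0 ≤ v) (hu' : 0 ≤ u') (hv' : 0 ≤ v')
    (a b c a' b' c' : ℝ) :
    MeasurePreserving (fun p : Side n × Side n => a • p.1.1 + (b • p.1.2.1 + c • p.1.2.2)
        + (a' • p.2.1 + (b' • p.2.2.1 + c' • p.2.2.2)))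
      ((idealSide n u v).prod (idealSide n u' v'))
      (gv n (a ^ 2 * u + (b ^ 2 * v + c ^ 2) + (a' ^ 2 * u' + (b' ^ 2 * v' + c' ^ 2)))) := by
  have h := (gv_lin (n := n) (s := a ^ 2 * u + (b ^ 2 * v + c ^ 2))
    (t := a' ^ 2 * u' + (b' ^ 2 * v' + c' ^ 2)) (by positivity) (by positivity) 1 1).comp
    ((gv_lin_three hu hv a b c).prod (gv_lin_three hu' hv' a' b' c'))
  simpa [Function.comp_def] using h

/-- Output of the own user. -/
def outY {n : ℕ} (α : ℝ) (p : Side n × Side n) : Fin n → ℝ :=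
  p.1.1 + p.1.2.1 + α • (p.2.1 + p.2.2.1) + p.1.2.2

/-- Output of the other user. -/
def outZ {n : ℕ} (α' : ℝ) (p : Side n × Side n) : Fin n → ℝ :=
  α' • (p.1.1 + p.1.2.1) + (p.2.1 + p.2.2.1) + p.2.2.2

/-- Both codewords and both outputs. -/
def wordsOut {n : ℕ} (α α' : ℝ) (p : Side n × Side n) :
    ((Fin n → ℝ) × (Fin n → ℝ)) × ((Fin n → ℝ) × (Fin n → ℝ)) :=
  ((p.1.1, p.2.1), (outY α p, outZ α' p))

@[fun_prop]
theorem measurable_outY {n : ℕ} (α : ℝ) : Measurable (outY α : Side n × Side n → _) := by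
  unfold outY; fun_prop

@[fun_prop]
theorem measurable_outZ {n : ℕ} (α' : ℝ) : Measurable (outZ α' : Side n × Side n → _) := by
  unfold outZ; fun_prop

@[fun_prop]
theorem measurable_wordsOut {n : ℕ} (α α' : ℝ) :
    Measurable (wordsOut α α' : Side n × Side n → _) := by
  unfold wordsOut; fun_prop

/-- Energy events of linear combinations of the ideal random variables. -/
theorem ideal_energy {u v u' v' : ℝ} (hu : 0 ≤ u) (hv : 0 ≤ v) (hu' : 0 ≤ u') (hv' : 0 ≤ v')
    (a b c a' b' c' : ℝ) {s : ℝ}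
    (hs : a ^ 2 * u + (b ^ 2 * v + c ^ 2) + (a' ^ 2 * u' + (b' ^ 2 * v' + c' ^ 2)) = s)
    {η : ℝ} (hη : 0 < η) :
    (∀ r > s, ∃ n₀ : ℕ, ∀ n ≥ n₀, ∀ ℓ : Side n × Side n → Fin n → ℝ,
      (∀ p, ℓ p = a • p.1.1 + (b • p.1.2.1 + c • p.1.2.2)
        + (a' • p.2.1 + (b' • p.2.2.1 + c' • p.2.2.2))) →
      ((idealSide n u v).prod (idealSide n u' v')) {p | n * r ≤ ∑ t, ℓ p t ^ 2}
        ≤ ENNReal.ofReal η) ∧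
    (∀ r < s, ∃ n₀ : ℕ, ∀ n ≥ n₀, ∀ ℓ : Side n × Side n → Fin n → ℝ,
      (∀ p, ℓ p = a • p.1.1 + (b • p.1.2.1 + c • p.1.2.2)
        + (a' • p.2.1 + (b' • p.2.2.1 + c' • p.2.2.2))) →
      ((idealSide n u v).prod (idealSide n u' v')) {p | ∑ t, ℓ p t ^ 2 ≤ n * r}
        ≤ ENNReal.ofReal η) := by
  subst hs
  constructor
  · intro r hr
    obtain ⟨n₀, h₀⟩ := gv_energy_ge (by positivity) hr hη
    refine ⟨n₀, fun n hn ℓ hℓ => ?_⟩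
    obtain rfl := funext hℓ
    refine le_trans (le_of_eq ?_) (h₀ n hn)
    refine (gv_lin_six hu hv hu' hv' a b c a' b' c').measure_preimage
      (s := {x | n * r ≤ ∑ t, x t ^ 2}) (MeasurableSet.nullMeasurableSet ?_)
    exact measurableSet_le (by fun_prop) (by fun_prop)
  · intro r hr
    obtain ⟨n₀, h₀⟩ := gv_energy_le (by positivity) hr hη
    refine ⟨n₀, fun n hn ℓ hℓ => ?_⟩
    obtain rfl := funext hℓ
    refine le_trans (le_of_eq ?_) (h₀ n hn)
    refine (gv_lin_six hu hv hu' hv' a b c a' b' c').measure_preimage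
      (s := {x | ∑ t, x t ^ 2 ≤ n * r}) (MeasurableSet.nullMeasurableSet ?_)
    exact measurableSet_le (by fun_prop) (by fun_prop)

/-- The reference density of the eavesdropper's output, given the other codeword. -/
noncomputable def refDens {n : ℕ} (α' u v v' : ℝ) (x' z : Fin n → ℝ) : ℝ :=
  phv (varB α' v v' + α' ^ 2 * u) (z - x')

/-- Words and outputs whose joint conditional density is small against the reference density. -/
def typPair (n : ℕ) (α α' u v v' a : ℝ) :
    Set (((Fin n → ℝ) × (Fin n → ℝ)) × ((Fin n → ℝ) × (Fin n → ℝ))) :=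
  {w | pairDens α α' v v' (w.1.1 + α • w.1.2) (α' • w.1.1 + w.1.2) w.2.1 w.2.2
    ≤ Real.exp (-(n * a)) * refDens α' u v v' w.1.2 w.2.2}

/-- Words and outputs for which the density of the eavesdropper's output is small against the
reference density. -/
def typMarg (n : ℕ) (α' u v v' a : ℝ) :
    Set (((Fin n → ℝ) × (Fin n → ℝ)) × ((Fin n → ℝ) × (Fin n → ℝ))) :=
  {w | phv (varB α' v v') (w.2.2 - (α' • w.1.1 + w.1.2))
    ≤ Real.exp (-(n * a)) * refDens α' u v v' w.1.2 w.2.2}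

theorem measurableSet_typPair (n : ℕ) (α α' u v v' a : ℝ) :
    MeasurableSet (typPair n α α' u v v' a) := by
  unfold typPair pairDens refDens
  exact measurableSet_le (by fun_prop) (by fun_prop)

theorem measurableSet_typMarg (n : ℕ) (α' u v v' a : ℝ) :
    MeasurableSet (typMarg n α' u v v' a) := by
  unfold typMarg refDens
  exact measurableSet_le (by fun_prop) (by fun_prop)

theorem gaussCap_div {s t : ℝ} (hs : 0 < s) (ht : 0 ≤ t) :
    gaussCap (t / s) = Real.log (2 * Real.pi * (s + t)) / 2 - Real.log (2 * Real.pi * s) / 2 := by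
  rw [gaussCap, ← sub_div, ← Real.log_div (by positivity) (by positivity),
    show 1 + t / s = 2 * Real.pi * (s + t) / (2 * Real.pi * s) by field_simp]
  ring

/-- The log-ratio of the conditional density of Z to the reference density concentrates at
nC(α'²u/`varB`), since both are Gaussian densities evaluated at blocks of typical energy. -/
theorem typMarg_prob {α' u v u' v' a η : ℝ} (α : ℝ) (hu : 0 ≤ u) (hv : 0 ≤ v) (hu' : 0 ≤ u')
    (hv' : 0 ≤ v') (ha : a < -gaussCap (α' ^ 2 * u / varB α' v v')) (hη : 0 < η) :
    ∃ n₀ : ℕ, ∀ n ≥ n₀, ((idealSide n u v).prod (idealSide n u' v'))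
      {p | wordsOut α α' p ∉ typMarg n α' u v v' a} ≤ ENNReal.ofReal η := by
  have hB := varB_pos (α' := α') hv hv'
  have hA : 0 < varB α' v v' + α' ^ 2 * u := by positivity
  set δ := -gaussCap (α' ^ 2 * u / varB α' v v') - a with hδ
  have hδ0 : 0 < δ := by linarith
  obtain ⟨n₁, h₁⟩ := (ideal_energy hu hv hu' hv' 0 α' 0 0 1 1 (s := varB α' v v')
    (by unfold varB; ring) (half_pos hη)).2 (varB α' v v' * (1 - δ)) (by nlinarith)
  have hz : 0 ≤ varB α' v v' + α' ^ 2 * u := hA.le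
  obtain ⟨n₂, h₂⟩ := (ideal_energy hu hv hu' hv' α' α' 0 0 1 1 (s := varB α' v v' + α' ^ 2 * u)
    (by unfold varB; ring) (half_pos hη)).1 ((varB α' v v' + α' ^ 2 * u) * (1 + δ)) (by nlinarith)
  refine ⟨max n₁ n₂, fun n hn => ?_⟩
  have k1 := h₁ n (le_trans (le_max_left _ _) hn)
    (fun p => outZ α' p - (α' • p.1.1 + p.2.1)) fun p => by
      ext t; simp [outZ]; ring
  have k2 := h₂ n (le_trans (le_max_right _ _) hn) (fun p => outZ α' p - p.2.1) fun p => by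
      ext t; simp [outZ]; ring
  refine le_trans (measure_mono fun p hp => ?_) ((measure_union_le _ _).trans
    ((add_le_add k1 k2).trans_eq (by
      rw [← ENNReal.ofReal_add (by positivity) (by positivity), add_halves])))
  by_contra hcon
  simp only [Set.mem_union, Set.mem_ofPred_eq, not_or, not_le] at hcon
  obtain ⟨c1, c2⟩ := hcon
  refine hp ?_
  simp only [typMarg, refDens, wordsOut, Set.mem_ofPred_eq]
  rw [phv_eq hB, phv_eq hA, ← Real.exp_add]
  refine Real.exp_le_exp.2 ?_
  have d1 : n * (1 - δ) / 2 ≤ (∑ t, (outZ α' p - (α' • p.1.1 + p.2.1)) t ^ 2)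
      / (2 * varB α' v v') := by
    rw [le_div_iff₀ (by positivity)]; linarith
  have d2 : (∑ t, (outZ α' p - p.2.1) t ^ 2) / (2 * (varB α' v v' + α' ^ 2 * u))
      ≤ n * (1 + δ) / 2 := by
    rw [div_le_iff₀ (by positivity)]; linarith
  have d3 := gaussCap_div hB (t := α' ^ 2 * u) (by positivity)
  have d4 : -((n : ℝ) * a) = n * (gaussCap (α' ^ 2 * u / varB α' v v')) + n * δ := by
    rw [hδ]; ring
  rw [d4, d3]
  linarith

/-- Chain rule: `pairDens` is the density of the regression remainder times the density treated by
`typMarg_prob`. The remainder has energy about n `varE`, hence density about exp(-n·½log(2πe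
`varE`)). -/
theorem typPair_prob {α α' u v u' v' a η : ℝ} (hu : 0 ≤ u) (hv : 0 ≤ v) (hu' : 0 ≤ u')
    (hv' : 0 ≤ v') (ha : a < (Real.log (2 * Real.pi * varE α α' v v') + 1) / 2
      - gaussCap (α' ^ 2 * u / varB α' v v')) (hη : 0 < η) :
    ∃ n₀ : ℕ, ∀ n ≥ n₀, ((idealSide n u v).prod (idealSide n u' v'))
      {p | wordsOut α α' p ∉ typPair n α α' u v v' a} ≤ ENNReal.ofReal η := by
  have hB := varB_pos (α' := α') hv hv'
  have hE := varE_pos (α := α) (α' := α') hv hv'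
  set δ := (Real.log (2 * Real.pi * varE α α' v v') + 1) / 2
      - gaussCap (α' ^ 2 * u / varB α' v v') - a with hδ
  have hδ0 : 0 < δ := by linarith
  -- These are the coefficients of the regression remainder; both codewords drop out.
  obtain ⟨n₁, h₁⟩ := (ideal_energy hu hv hu' hv' 0 (1 - regr α α' v v' * α') 1 0
    (α - regr α α' v v') (-regr α α' v v') (s := varE α α' v v')
    (by unfold regr varE; field_simp; unfold varB; ring) (half_pos hη)).2
    (varE α α' v v' * (1 - δ)) (by nlinarith)
  obtain ⟨n₂, h₂⟩ := typMarg_prob (α' := α') α hu hv hu' hv'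
    (a := -gaussCap (α' ^ 2 * u / varB α' v v') - δ / 2) (by linarith) (half_pos hη)
  refine ⟨max n₁ n₂, fun n hn => ?_⟩
  have k1 := h₁ n (le_trans (le_max_left _ _) hn)
    (fun p => outY α p - (p.1.1 + α • p.2.1)
      - regr α α' v v' • (outZ α' p - (α' • p.1.1 + p.2.1))) fun p => by
      ext t; simp [outZ, outY]; ring
  have k2 := h₂ n (le_trans (le_max_right _ _) hn)
  refine le_trans (measure_mono fun p hp => ?_) ((measure_union_le _ _).trans
    ((add_le_add k1 k2).trans_eq (by
      rw [← ENNReal.ofReal_add (by positivity) (by positivity), add_halves])))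
  by_contra hcon
  simp only [Set.mem_union, Set.mem_ofPred_eq, not_or, not_le, not_not] at hcon
  obtain ⟨c1, c2⟩ := hcon
  refine hp ?_
  simp only [typPair, pairDens, wordsOut, Set.mem_ofPred_eq]
  simp only [typMarg, wordsOut, Set.mem_ofPred_eq] at c2
  set e := outY α p - (p.1.1 + α • p.2.1)
      - regr α α' v v' • (outZ α' p - (α' • p.1.1 + p.2.1)) with he
  have c3 : phv (varE α α' v v') e
      ≤ Real.exp (-(n * ((Real.log (2 * Real.pi * varE α α' v v') + 1) / 2 - δ / 2))) := by
    rw [phv_eq hE]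
    refine Real.exp_le_exp.2 ?_
    have d1 : n * (1 - δ) / 2 ≤ (∑ t, e t ^ 2) / (2 * varE α α' v v') := by
      rw [le_div_iff₀ (by positivity)]; linarith
    linarith
  refine (mul_le_mul c3 c2 (phv_pos hB _).le (Real.exp_pos _).le).trans (le_of_eq ?_)
  rw [← mul_assoc, ← Real.exp_add]
  congr 2
  rw [hδ]; ring

/-- Law of the dummy signals and noises of both sides. -/
noncomputable def noisePair (n : ℕ) (v v' : ℝ) :
    Measure (((Fin n → ℝ) × (Fin n → ℝ)) × ((Fin n → ℝ) × (Fin n → ℝ))) :=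
  ((gv n v).prod (gv n 1)).prod ((gv n v').prod (gv n 1))

instance (n : ℕ) (v v' : ℝ) : IsProbabilityMeasure (noisePair n v v') := by
  unfold noisePair; infer_instance

/-- Insert the codewords `x`, `x'`. -/
def withWords {n : ℕ} (x x' : Fin n → ℝ)
    (p : ((Fin n → ℝ) × (Fin n → ℝ)) × ((Fin n → ℝ) × (Fin n → ℝ))) : Side n × Side n :=
  ((x, p.1), (x', p.2))

@[fun_prop]
theorem measurable_withWords {n : ℕ} (x x' : Fin n → ℝ) : Measurable (withWords x x') := by
  unfold withWords; fun_prop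

/-- Joint density of the event `q Y = w`, cut down to `T`, and of the output `Z`. -/
noncomputable def cutDens {n : ℕ} {Q : Type*} (α α' v v' : ℝ) (q : (Fin n → ℝ) → Q)
    (T : Set (((Fin n → ℝ) × (Fin n → ℝ)) × ((Fin n → ℝ) × (Fin n → ℝ)))) (w : Q)
    (x x' z : Fin n → ℝ) : ENNReal :=
  ∫⁻ y, {y | q y = w ∧ ((x, x'), (y, z)) ∈ T}.indicator
    (fun y => ENNReal.ofReal (pairDens α α' v v' (x + α • x') (α' • x + x') y z)) y

theorem measurable_pairDens {n : ℕ} (α α' v v' : ℝ) (x x' : Fin n → ℝ) :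
    Measurable fun w : (Fin n → ℝ) × (Fin n → ℝ) =>
      ENNReal.ofReal (pairDens α α' v v' (x + α • x') (α' • x + x') w.1 w.2) := by
  unfold pairDens; fun_prop

theorem measurableSet_cut {n : ℕ} {Q : Type*} [MeasurableSpace Q] [MeasurableSingletonClass Q]
    {q : (Fin n → ℝ) → Q} (hq : Measurable q)
    {T : Set (((Fin n → ℝ) × (Fin n → ℝ)) × ((Fin n → ℝ) × (Fin n → ℝ)))} (hT : MeasurableSet T)
    (w : Q) (x x' : Fin n → ℝ) :
    MeasurableSet {r : (Fin n → ℝ) × (Fin n → ℝ) | q r.1 = w ∧ ((x, x'), (r.1, r.2)) ∈ T} :=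
  ((hq.comp measurable_fst) (measurableSet_singleton w)).inter
    ((by fun_prop : Measurable fun r : (Fin n → ℝ) × (Fin n → ℝ) => ((x, x'), (r.1, r.2))) hT)

theorem measurable_cutDens {n : ℕ} {Q : Type*} [MeasurableSpace Q] [MeasurableSingletonClass Q]
    {α α' v v' : ℝ} {q : (Fin n → ℝ) → Q} (hq : Measurable q)
    {T : Set (((Fin n → ℝ) × (Fin n → ℝ)) × ((Fin n → ℝ) × (Fin n → ℝ)))} (hT : MeasurableSet T)
    (w : Q) (x x' : Fin n → ℝ) : Measurable (cutDens α α' v v' q T w x x') :=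
  Measurable.lintegral_prod_left' (f := {r : (Fin n → ℝ) × (Fin n → ℝ) |
      q r.1 = w ∧ ((x, x'), (r.1, r.2)) ∈ T}.indicator fun r =>
        ENNReal.ofReal (pairDens α α' v v' (x + α • x') (α' • x + x') r.1 r.2))
    ((measurable_pairDens α α' v v' x x').indicator (measurableSet_cut hq hT w x x'))

/-- For fixed codewords this supplies the subdensity required by the leftover hash lemma: the joint
density is integrated over those y that lie in cell w and in the typical set. -/
theorem cutDens_law {n : ℕ} {Q : Type*} [MeasurableSpace Q] [MeasurableSingletonClass Q]
    {α α' v v' : ℝ} (hv : 0 ≤ v) (hv' : 0 ≤ v') {q : (Fin n → ℝ) → Q} (hq : Measurable q)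
    {T : Set (((Fin n → ℝ) × (Fin n → ℝ)) × ((Fin n → ℝ) × (Fin n → ℝ)))} (hT : MeasurableSet T)
    (w : Q) (x x' : Fin n → ℝ) {S : Set (Fin n → ℝ)} (hS : MeasurableSet S) :
    noisePair n v v' {p | q (outY α (withWords x x' p)) = w ∧ outZ α' (withWords x x' p) ∈ S ∧
      wordsOut α α' (withWords x x' p) ∈ T} = ∫⁻ z in S, cutDens α α' v v' q T w x x' z := by
  set G : Set ((Fin n → ℝ) × (Fin n → ℝ)) :=
    {r | q r.1 = w ∧ ((x, x'), (r.1, r.2)) ∈ T} ∩ {r | r.2 ∈ S} with hG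
  have hGm : MeasurableSet G := (measurableSet_cut hq hT w x x').inter (measurable_snd hS)
  have h := lintegral_pair_dens (α := α) (α' := α') hv hv'
    (measurable_one.indicator hGm) (x + α • x') (α' • x + x')
  have e : ∀ p, (x + α • x' + (p.1.1 + α • p.2.1 + p.1.2),
      α' • x + x' + (α' • p.1.1 + p.2.1 + p.2.2))
      = (outY α (withWords x x' p), outZ α' (withWords x x' p)) := by
    intro p
    ext t <;> simp [outY, outZ, withWords] <;> ring
  have hm : Measurable fun p : ((Fin n → ℝ) × (Fin n → ℝ)) × ((Fin n → ℝ) × (Fin n → ℝ)) =>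
      (outY α (withWords x x' p), outZ α' (withWords x x' p)) := by fun_prop
  simp only [e] at h
  have hl : ∫⁻ p, G.indicator 1 (outY α (withWords x x' p), outZ α' (withWords x x' p))
      ∂(noisePair n v v') = noisePair n v v' ((fun p =>
        (outY α (withWords x x' p), outZ α' (withWords x x' p))) ⁻¹' G) :=
    lintegral_indicator_one (hm hGm)
  rw [← noisePair, hl] at h
  have hset : {p | q (outY α (withWords x x' p)) = w ∧ outZ α' (withWords x x' p) ∈ S ∧
      wordsOut α α' (withWords x x' p) ∈ T} = (fun p =>
        (outY α (withWords x x' p), outZ α' (withWords x x' p))) ⁻¹' G := by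
    ext p
    simp only [hG, Set.mem_ofPred_eq, Set.mem_preimage, Set.mem_inter_iff, wordsOut, withWords]
    tauto
  rw [hset, h, ← lintegral_indicator hS]
  refine lintegral_congr fun z => ?_
  by_cases hz : z ∈ S
  · rw [Set.indicator_of_mem hz]
    refine lintegral_congr fun y => ?_
    by_cases hy : q y = w ∧ ((x, x'), (y, z)) ∈ T
    · rw [Set.indicator_of_mem (show (y, z) ∈ G from ⟨hy, hz⟩), Set.indicator_of_mem
        (show y ∈ {y | q y = w ∧ ((x, x'), (y, z)) ∈ T} from hy)]
      simp
    · rw [Set.indicator_of_notMem (show (y, z) ∉ G from fun h => hy h.1),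
        Set.indicator_of_notMem 
          (show y ∉ {y | q y = w ∧ ((x, x'), (y, z)) ∈ T} from hy), mul_zero]
  · rw [Set.indicator_of_notMem hz]
    simp [hG, hz]

end Side

/-! ### Coding schemes for one side. -/

/-- Quantizer, lists, typical set and alphabet sizes used by one user and its base station, for
block length `n`, codebook rate `R`, key rate `r` and tolerance `η`. -/
structure Scheme (α α' u v u' v' : ℝ) (n : ℕ) (R r η : ℝ) where
  (N k f : ℕ)
  q : (Fin n → ℝ) → Fin n → Fin (N + 1)
  L : (Fin n → Fin (N + 1)) → Set (Fin n → ℝ)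
  T : Set (((Fin n → ℝ) × (Fin n → ℝ)) × ((Fin n → ℝ) × (Fin n → ℝ)))
  b : ℝ
  measurable_q : Measurable q
  measurableSet_L : ∀ w, MeasurableSet (L w)
  measurableSet_T : MeasurableSet T
  le_k : Real.exp (n * r) ≤ k
  log_k : Real.log k ≤ n * max r 0 + Real.log 2
  f_pos : 0 < f
  card_list : ∀ x w, ∀ F : Finset (Fin n → Fin (N + 1)),
    (∀ w' ∈ F, w' ≠ w ∧ x ∈ L w') → (F.card : ℝ) ≤ η * f
  prob : ((idealSide n u v).prod (idealSide n u' v'))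
    {p | p.1.1 + p.1.2.1 ∉ L (q (outY α p)) ∨ wordsOut α α' p ∉ T} ≤ ENNReal.ofReal η
  cutDens_le : ∀ w x x' z, cutDens α α' v v' q T w x x' z
    ≤ ENNReal.ofReal (b * refDens α' u v v' x' z)
  b_nonneg : 0 ≤ b
  b_le : ((k * f : ℕ) - 1 : ℝ) * b ≤ η ^ 2 * Real.exp (n * R)

section

theorem lintegral_phv {n : ℕ} {s : ℝ} (hs : 0 < s) (x : Fin n → ℝ) :
    ∫⁻ y, ENNReal.ofReal (phv s (y - x)) = 1 := by
  rw [lintegral_sub_right_eq_self (fun y => ENNReal.ofReal (phv s y)) x]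
  have := lintegral_gv (n := n) hs (g := fun _ => 1) measurable_const
  simpa using this.symm

theorem natCeil_exp_le {x : ℝ} (hx : 0 ≤ x) : (⌈Real.exp x⌉₊ : ℝ) ≤ 2 * Real.exp x := by
  have := (Nat.ceil_lt_add_one (Real.exp_pos x).le).le
  have := Real.one_le_exp hx
  linarith

/-- The maximum with 0 is there because the alphabet has size 1 when r is negative. -/
theorem log_natCeil_exp_le (n : ℕ) (r : ℝ) :
    Real.log (⌈Real.exp (n * r)⌉₊ : ℝ) ≤ n * max r 0 + Real.log 2 := by
  have hpos : (0 : ℝ) < ⌈Real.exp (n * r)⌉₊ := by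
    exact_mod_cast Nat.ceil_pos.2 (Real.exp_pos _)
  have h1 : (⌈Real.exp (n * r)⌉₊ : ℝ) ≤ ⌈Real.exp (n * max r 0)⌉₊ := by
    have : Real.exp (n * r) ≤ Real.exp (n * max r 0) :=
      Real.exp_le_exp.2 (mul_le_mul_of_nonneg_left (le_max_left _ _) (Nat.cast_nonneg _))
    exact_mod_cast Nat.ceil_mono this
  have h2 := h1.trans (natCeil_exp_le (x := n * max r 0) (by positivity))
  calc _ ≤ Real.log (2 * Real.exp (n * max r 0)) := Real.log_le_log hpos h2
    _ = _ := by rw [Real.log_mul (by norm_num) (Real.exp_pos _).ne', Real.log_exp]; ring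

/-- The key is extracted from the decoded codeword only. -/
theorem exists_scheme_word {α' u v u' v' R r η : ℝ} (α : ℝ) (hu : 0 ≤ u) (hv : 0 ≤ v) (hu' : 0 ≤ u')
    (hv' : 0 ≤ v') (hr : r + gaussCap (α' ^ 2 * u / varB α' v v') < R) (hη : 0 < η) :
    ∃ n₀ : ℕ, ∀ n ≥ n₀, Nonempty (Scheme α α' u v u' v' n R r η) := by
  set G := R - (r + gaussCap (α' ^ 2 * u / varB α' v v')) with hG
  have hG0 : 0 < G := by linarith
  -- Half of the slack G goes into typicality; the other half leaves the factor exp(-nG/2) ≤ η² in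
  -- `b_le`.
  set a := -gaussCap (α' ^ 2 * u / varB α' v v') - G / 2 with ha
  have hB := varB_pos (α' := α') hv hv'
  have hE := varE_pos (α := α) (α' := α') hv hv'
  obtain ⟨n₁, h₁⟩ := typMarg_prob (α' := α') (a := a) α hu hv hu' hv' (by linarith) hη
  obtain ⟨n₂, h₂⟩ := exists_exp_neg_le (half_pos hG0) (pow_pos hη 2)
  refine ⟨max n₁ n₂, fun n hn => ⟨{
    -- A single cell and a single public message: nothing about the output is used beyond decoding.
    N := 0
    k := ⌈Real.exp (n * r)⌉₊
    f := 1
    q := fun _ _ => 0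
    L := fun _ => Set.univ
    T := typMarg n α' u v v' a
    b := Real.exp (-(n * a))
    measurable_q := measurable_const
    measurableSet_L := fun _ => MeasurableSet.univ
    measurableSet_T := measurableSet_typMarg n α' u v v' a
    le_k := Nat.le_ceil _
    log_k := log_natCeil_exp_le n r
    f_pos := one_pos
    card_list := ?_
    prob := ?_
    cutDens_le := ?_
    b_nonneg := (Real.exp_pos _).le
    b_le := ?_ }⟩⟩
  · intro x w F hF
    have : F = ∅ := Finset.eq_empty_of_forall_notMem fun w' hw' =>
      (hF w' hw').1 (funext fun t => Fin.ext (by omega))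
    rw [this]
    simpa using hη.le
  · simpa using h₁ n (le_trans (le_max_left _ _) hn)
  · intro w x x' z
    by_cases hz : phv (varB α' v v') (z - (α' • x + x'))
        ≤ Real.exp (-(n * a)) * refDens α' u v v' x' z
    · refine le_trans ?_ (ENNReal.ofReal_le_ofReal hz)
      -- Integrating y out removes the regression factor, so only the density of Z remains.
      calc _ ≤ ∫⁻ y, ENNReal.ofReal (pairDens α α' v v' (x + α • x') (α' • x + x') y z) :=
            lintegral_mono (Set.indicator_le_self _ _)
        _ = _ := by
          simp only [pairDens, sub_sub]
          simp only [ENNReal.ofReal_mul (phv_pos hE _).le]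
          rw [lintegral_mul_const' _ _ ENNReal.ofReal_ne_top, lintegral_phv hE, one_mul]
    · refine le_trans (le_of_eq ?_) zero_le
      unfold cutDens
      have : ∀ y, {y | (fun (_ : Fin n) => (0 : Fin (0 + 1))) = w ∧
          ((x, x'), (y, z)) ∈ typMarg n α' u v v' a}.indicator
          (fun y => ENNReal.ofReal (pairDens α α' v v' (x + α • x') (α' • x + x') y z)) y = 0 :=
        fun y => Set.indicator_of_notMem (fun h => hz h.2) _
      simp only [this, lintegral_zero]
  · have h3 : ((⌈Real.exp (n * r)⌉₊ * 1 : ℕ) - 1 : ℝ) ≤ Real.exp (n * r) := by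
      rw [mul_one]
      linarith [Nat.ceil_lt_add_one (Real.exp_pos (n * r)).le]
    calc _ ≤ Real.exp (n * r) * Real.exp (-(n * a)) := by gcongr
      _ = Real.exp (-(n * (G / 2))) * Real.exp (n * R) := by
          rw [← Real.exp_add, ← Real.exp_add, ha]
          congr 1
          have : R = G + (r + gaussCap (α' ^ 2 * u / varB α' v v')) := by rw [hG]; ring
          rw [this]; ring
      _ ≤ _ := by gcongr; exact h₂ n (le_trans (le_max_right _ _) hn)

/-- The box may depend on n in any way: the number of cells enters neither the list bound nor the
density bound. -/
theorem exists_box (n : ℕ) (s : ℝ) {Δ η : ℝ} (hΔ : 0 < Δ) (hη : 0 < η) :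
    ∃ N : ℕ, gv n s {y | ¬ ∀ t, |y t| < (N + 1) * Δ / 2} ≤ ENNReal.ofReal η := by
  have hanti : Antitone fun N : ℕ => {y : Fin n → ℝ | ¬ ∀ t, |y t| < (N + 1) * Δ / 2} := by
    intro N N' h y hy hy'
    refine hy fun t => (hy' t).trans_le ?_
    have : (N : ℝ) ≤ N' := by exact_mod_cast h
    gcongr
  have hempty : ⋂ N : ℕ, {y : Fin n → ℝ | ¬ ∀ t, |y t| < (N + 1) * Δ / 2} = ∅ := by
    refine Set.eq_empty_of_forall_notMem fun y hy => ?_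
    obtain ⟨N, hN⟩ := exists_nat_gt (2 * (∑ t, |y t|) / Δ)
    refine (Set.mem_iInter.1 hy N) fun t => ?_
    have h1 : |y t| ≤ ∑ t, |y t| :=
      Finset.single_le_sum (f := fun t => |y t|) (fun t _ => abs_nonneg _) (Finset.mem_univ t)
    rw [div_lt_iff₀ hΔ] at hN
    linarith
  have hmeas : ∀ N : ℕ, MeasurableSet {y : Fin n → ℝ | ¬ ∀ t, |y t| < (N + 1) * Δ / 2} := by
    intro N
    have : {y : Fin n → ℝ | ¬ ∀ t, |y t| < (N + 1) * Δ / 2}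
        = (⋂ t, {y : Fin n → ℝ | |y t| < (N + 1) * Δ / 2})ᶜ := by ext; simp
    rw [this]
    exact (MeasurableSet.iInter fun t => measurableSet_lt (by fun_prop) measurable_const).compl
  have hlim := tendsto_measure_iInter_atTop (μ := gv n s)
    (fun N => (hmeas N).nullMeasurableSet) hanti ⟨0, measure_ne_top _ _⟩
  rw [hempty, measure_empty] at hlim
  obtain ⟨N, hN⟩ := (hlim.eventually_lt_const (ENNReal.ofReal_pos.2 hη)).exists
  exact ⟨N, hN.le⟩

/-- The key is extracted from the decoded codeword and the quantized output. -/
theorem exists_scheme_output {α α' u v u' v' R r η : ℝ} (hu : 0 ≤ u) (hv : 0 ≤ v) (hu' : 0 ≤ u')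
    (hv' : 0 ≤ v') (hr0 : 0 ≤ r) (hr : r + Real.log (1 + α ^ 2 * (u' + v')) / 2
      - Real.log (varE α α' v v') / 2 + gaussCap (α' ^ 2 * u / varB α' v v') < R) (hη : 0 < η) :
    ∃ n₀ : ℕ, ∀ n ≥ n₀, Nonempty (Scheme α α' u v u' v' n R r η) := by
  have hB := varB_pos (α' := α') hv hv'
  have hE := varE_pos (α := α) (α' := α') hv hv'
  set s := 1 + α ^ 2 * (u' + v') with hs
  have hs0 : 0 < s := by positivity
  set G := R - (r + Real.log s / 2
      - Real.log (varE α α' v v') / 2 + gaussCap (α' ^ 2 * u / varB α' v v')) with hG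
  have hG0 : 0 < G := by linarith
  -- Budget for the slack G: G/8 here, G/8 in c through ρ, and G/8 in φ. The remaining 5G/8 gives
  -- the decay in `b_le`.
  set a := (Real.log (2 * Real.pi * varE α α' v v') + 1) / 2
      - gaussCap (α' ^ 2 * u / varB α' v v') - G / 8 with ha
  set ρ := s * Real.exp (G / 4) with hρ
  have hρ0 : 0 < ρ := by positivity
  have hsρ : s < ρ := lt_mul_of_one_lt_right hs0 (Real.one_lt_exp_iff.2 (by positivity))
  set c := (Real.log (2 * Real.pi * ρ) + 1) / 2 with hc
  obtain ⟨Δ, ρ₀, hΔ, hΔc, hρ₀, hlist⟩ := exists_cell_lists (c := c) hs0 hsρ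
  -- Public rate: the exponent of the list size plus a margin that makes a list at most η times the
  -- number of messages. It is nonnegative because log Δ ≤ c.
  set φ := c - Real.log Δ + G / 8 with hφ
  have hφ0 : 0 ≤ φ := by linarith
  have hη3 : 0 < η / 3 := by positivity
  obtain ⟨n₁, h₁⟩ := typPair_prob (α := α) (α' := α') (a := a) hu hv hu' hv' (by linarith) hη3
  obtain ⟨n₂, h₂⟩ := exists_exp_neg_le (half_pos hG0) (show 0 < η ^ 2 / 4 by positivity)
  -- Given the transmitted block, the output deviates from it by receiver noise and interference, of
  -- total variance s.
  obtain ⟨n₃, h₃⟩ := (ideal_energy hu hv hu' hv' 0 0 1 α α 0 (s := s)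
    (by rw [hs]; ring) hη3).1 ρ₀ hρ₀
  obtain ⟨n₄, h₄⟩ := exists_exp_neg_le (show 0 < G / 8 by positivity) hη
  refine ⟨max (max n₁ n₂) (max n₃ n₄), fun n hn => ?_⟩
  have hn1 : n₁ ≤ n := le_trans (le_trans (le_max_left _ _) (le_max_left _ _)) hn
  have hn2 : n₂ ≤ n := le_trans (le_trans (le_max_right _ _) (le_max_left _ _)) hn
  have hn3 : n₃ ≤ n := le_trans (le_trans (le_max_left _ _) (le_max_right _ _)) hn
  have hn4 : n₄ ≤ n := le_trans (le_trans (le_max_right _ _) (le_max_right _ _)) hn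
  obtain ⟨N, hN⟩ := exists_box n (1 ^ 2 * u + (1 ^ 2 * v + 1 ^ 2) + (α ^ 2 * u'
    + (α ^ 2 * v' + 0 ^ 2))) hΔ hη3
  obtain ⟨L, hLm, hL, hLcard⟩ := hlist n (N + 1)
  set q : (Fin n → ℝ) → Fin n → Fin (N + 1) := fun y t => quant N Δ (y t) with hq
  have hqm : Measurable q :=
    measurable_pi_lambda _ fun t => (measurable_quant N Δ).comp (measurable_pi_apply t)
  have hbox : MeasurableSet {y : Fin n → ℝ | y ∈ cell Δ (q y)} := by
    have : {y : Fin n → ℝ | y ∈ cell Δ (q y)} = ⋃ w, (q ⁻¹' {w}) ∩ cell Δ w := by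
      ext y; simp
    rw [this]
    exact MeasurableSet.iUnion fun w =>
      (hqm (measurableSet_singleton w)).inter (measurableSet_cell Δ w)
  have hexpφ : (0 : ℝ) < Real.exp (n * φ) := Real.exp_pos _
  refine ⟨{
    N := N
    k := ⌈Real.exp (n * r)⌉₊
    f := ⌈Real.exp (n * φ)⌉₊
    q := q
    L := L
    -- Excluding clipped outputs restricts y to a cell of volume Δ^n, which is the factor Δ^n in b.
    T := {w | w.2.1 ∈ cell Δ (q w.2.1)} ∩ typPair n α α' u v v' a
    b := Δ ^ n * Real.exp (-(n * a))
    measurable_q := hqm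
    measurableSet_L := hLm
    measurableSet_T := ((by fun_prop : Measurable fun w : ((Fin n → ℝ) × (Fin n → ℝ)) ×
      ((Fin n → ℝ) × (Fin n → ℝ)) => w.2.1) hbox).inter (measurableSet_typPair n α α' u v v' a)
    le_k := Nat.le_ceil _
    log_k := log_natCeil_exp_le n r
    f_pos := Nat.ceil_pos.2 hexpφ
    card_list := ?_
    prob := ?_
    cutDens_le := ?_
    b_nonneg := by positivity
    b_le := ?_ }⟩
  · intro x w F hF
    have h5 := hLcard x F fun w' hw' => (hF w' hw').2
    have h6 : (F.card : ℝ) ≤ Real.exp (-(n * (G / 8))) * Real.exp (n * φ) := by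
      have e : Real.exp (n * c) = Real.exp (-(n * (G / 8))) * Real.exp (n * φ) * Δ ^ n := by
        rw [show Δ ^ n = Real.exp (n * Real.log Δ) by rw [Real.exp_nat_mul, Real.exp_log hΔ],
          ← Real.exp_add, ← Real.exp_add, hφ]
        congr 1; ring
      rw [← hc, e] at h5
      exact le_of_mul_le_mul_right h5 (by positivity)
    refine h6.trans ?_
    gcongr
    · exact h₄ n hn4
    · exact Nat.le_ceil _
  · have k3 := h₃ n hn3 (fun p => outY α p - (p.1.1 + p.1.2.1)) fun p => by
      ext t; simp [outY]; ring
    have k1 := h₁ n hn1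
    have k2 : ((idealSide n u v).prod (idealSide n u' v'))
        {p | outY α p ∉ cell Δ (q (outY α p))} ≤ ENNReal.ofReal (η / 3) := by
      have hmp := gv_lin_six (n := n) hu hv hu' hv' 1 1 1 α α 0
      refine le_trans (measure_mono fun p hp => ?_)
        ((hmp.measure_preimage_le {y | ¬ ∀ t, |y t| < (N + 1) * Δ / 2}).trans hN)
      refine fun hp' => hp (mem_cell_quant hΔ ?_)
      have e : outY α p = (1 : ℝ) • p.1.1 + ((1 : ℝ) • p.1.2.1 + (1 : ℝ) • p.1.2.2)
          + (α • p.2.1 + (α • p.2.2.1 + (0 : ℝ) • p.2.2.2)) := by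
        ext t; simp [outY]; ring
      rw [e]; exact hp'
    refine le_trans (measure_mono (t := ({p | n * ρ₀ ≤ ∑ t, (outY α p - (p.1.1 + p.1.2.1)) t ^ 2} ∪
      {p | outY α p ∉ cell Δ (q (outY α p))}) ∪ {p | wordsOut α α' p ∉ typPair n α α' u v v' a})
      fun p hp => ?_) ((measure_union_le _ _).trans ((add_le_add ((measure_union_le _ _).trans
        (add_le_add k3 k2)) k1).trans_eq ?_))
    · by_contra hcon
      simp only [Set.mem_union, Set.mem_ofPred_eq, not_or, not_le, not_not] at hcon
      obtain ⟨⟨c1, c2⟩, c3⟩ := hcon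
      rcases hp with hp | hp
      · exact hp (hL _ _ _ c2 c1.le)
      · exact hp ⟨c2, c3⟩
    · rw [← ENNReal.ofReal_add (by positivity) (by positivity),
        ← ENNReal.ofReal_add (by positivity) (by positivity)]
      congr 1; ring
  · intro w x x' z
    have hR0 : 0 ≤ Real.exp (-(n * a)) * refDens α' u v v' x' z := by
      have : 0 < varB α' v v' + α' ^ 2 * u := by positivity
      have := phv_pos this (z - x')
      unfold refDens; positivity
    calc _ ≤ ∫⁻ y in cell Δ w, ENNReal.ofReal (Real.exp (-(n * a)) * refDens α' u v v' x' z) := by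
          rw [← lintegral_indicator (measurableSet_cell Δ w)]
          refine lintegral_mono fun y => ?_
          by_cases hy : q y = w ∧ ((x, x'), (y, z)) ∈
              {w : ((Fin n → ℝ) × (Fin n → ℝ)) × ((Fin n → ℝ) × (Fin n → ℝ)) |
                w.2.1 ∈ cell Δ (q w.2.1)} ∩ typPair n α α' u v v' a
          · obtain ⟨rfl, hy1, hy2⟩ := hy
            rw [Set.indicator_of_mem (show y ∈ cell Δ (q y) from hy1)]
            exact (Set.indicator_le_self _ _ _).trans (ENNReal.ofReal_le_ofReal hy2)
          · refine le_trans (le_of_eq ?_) zero_le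
            exact Set.indicator_of_notMem (s := {y | q y = w ∧ ((x, x'), (y, z)) ∈
              {w : ((Fin n → ℝ) × (Fin n → ℝ)) × ((Fin n → ℝ) × (Fin n → ℝ)) |
                w.2.1 ∈ cell Δ (q w.2.1)} ∩ typPair n α α' u v v' a}) hy _
      _ = _ := by
          rw [setLIntegral_const, volume_cell hΔ, ← ENNReal.ofReal_mul hR0]
          congr 1; ring
  · have h5 : ((⌈Real.exp (n * r)⌉₊ * ⌈Real.exp (n * φ)⌉₊ : ℕ) - 1 : ℝ)
        ≤ 2 * Real.exp (n * r) * (2 * Real.exp (n * φ)) := by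
      push_cast
      have := mul_le_mul (natCeil_exp_le (x := n * r) (by positivity))
        (natCeil_exp_le (x := n * φ) (by positivity)) (by positivity) (by positivity)
      linarith
    have e : Real.exp (n * r) * Real.exp (n * φ) * (Δ ^ n * Real.exp (-(n * a)))
        = Real.exp (-(n * (G / 2))) * Real.exp (-(n * (G / 8))) * Real.exp (n * R) := by
      have hΔe : Δ ^ n = Real.exp (n * Real.log Δ) := by
        rw [Real.exp_nat_mul, Real.exp_log hΔ]
      rw [hΔe, ← Real.exp_add, ← Real.exp_add, ← Real.exp_add, ← Real.exp_add, ← Real.exp_add]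
      congr 1
      have hRG : R = G + (r + Real.log s / 2
        - Real.log (varE α α' v v') / 2 + gaussCap (α' ^ 2 * u / varB α' v v')) := by rw [hG]; ring
      have hlogρ : Real.log (2 * Real.pi * ρ) = Real.log (2 * Real.pi) + Real.log s + G / 4 := by
        rw [hρ, ← mul_assoc, Real.log_mul (by positivity) (by positivity),
          Real.log_mul (by positivity) hs0.ne', Real.log_exp]
      have hlogE : Real.log (2 * Real.pi * varE α α' v v')
          = Real.log (2 * Real.pi) + Real.log (varE α α' v v') :=
        Real.log_mul (by positivity) hE.ne'
      rw [hRG, ha, hφ, hc, hlogρ, hlogE]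
      ring
    calc _ ≤ 2 * Real.exp (n * r) * (2 * Real.exp (n * φ)) * (Δ ^ n * Real.exp (-(n * a))) := by
          gcongr
      _ = 4 * (Real.exp (-(n * (G / 2))) * Real.exp (-(n * (G / 8))) * Real.exp (n * R)) := by
          rw [← e]; ring
      _ ≤ 4 * (η ^ 2 / 4 * 1 * Real.exp (n * R)) := by
          gcongr
          · exact h₂ n hn2
          · exact Real.exp_le_one_iff.2 (by rw [neg_nonpos]; positivity)
      _ = _ := by ring

end

/-! ### The probability space of a run. -/

section Product

theorem measurePreserving_prod_comm {A B C D : Type*} [MeasurableSpace A] [MeasurableSpace B]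
    [MeasurableSpace C] [MeasurableSpace D] (μ : Measure A) (ν : Measure B) (ρ : Measure C)
    (σ : Measure D) [SFinite μ] [SFinite ν] [SFinite ρ] [SFinite σ] :
    MeasurePreserving (fun x : (A × B) × (C × D) => ((x.1.1, x.2.1), (x.1.2, x.2.2)))
      ((μ.prod ν).prod (ρ.prod σ)) ((μ.prod ρ).prod (ν.prod σ)) := by
  have h1 := measurePreserving_prodAssoc μ ν (ρ.prod σ)
  have h2 : MeasurePreserving (fun x : B × (C × D) => (x.2.1, (x.1, x.2.2)))
      (ν.prod (ρ.prod σ)) (ρ.prod (ν.prod σ)) :=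
    (measurePreserving_prodAssoc ρ ν σ).comp
      (((Measure.measurePreserving_swap (μ := ν) (ν := ρ)).prod (.id σ)).comp
        (measurePreserving_prodAssoc ν ρ σ).symm)
  exact (measurePreserving_prodAssoc μ ρ (ν.prod σ)).symm.comp
    (((MeasurePreserving.id μ).prod h2).comp h1)

/-- The uniform law on `Fin M`. -/
noncomputable def unif (M : ℕ) : Measure (Fin M) := (M : ENNReal)⁻¹ • Measure.count

instance (M : ℕ) [NeZero M] : IsProbabilityMeasure (unif M) := ⟨by
  have : (M : ENNReal) ≠ 0 := by exact_mod_cast NeZero.ne M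
  simp [unif, ENNReal.inv_mul_cancel this]⟩

instance (M : ℕ) : IsFiniteMeasure (unif M) := by
  rcases Nat.eq_zero_or_pos M with rfl | h
  · exact ⟨by rw [Set.univ_eq_empty_iff.2 inferInstance, measure_empty]; exact ENNReal.zero_lt_top⟩
  · have : NeZero M := ⟨h.ne'⟩
    infer_instance

theorem unif_singleton {M : ℕ} (m : Fin M) : unif M {m} = (M : ENNReal)⁻¹ := by
  simp [unif]

theorem lintegral_unif {M : ℕ} (f : Fin M → ENNReal) :
    ∫⁻ m, f m ∂(unif M) = ∑ m, (M : ENNReal)⁻¹ * f m := by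
  rw [lintegral_fintype]
  exact Finset.sum_congr rfl fun m _ => by rw [unif_singleton, mul_comm]

/-- Law of the messages, dummy signals and noises of a run. -/
noncomputable def runLaw (M M' n : ℕ) (v v' : ℝ) : Measure ((Fin M × Fin M') ×
    (((Fin n → ℝ) × (Fin n → ℝ)) × ((Fin n → ℝ) × (Fin n → ℝ)))) :=
  ((unif M).prod (unif M')).prod (noisePair n v v')

instance (M M' n : ℕ) [NeZero M] [NeZero M'] (v v' : ℝ) :
    IsProbabilityMeasure (runLaw M M' n v v') := by
  unfold runLaw; infer_instance

/-- Signals and noises of both sides in a run with codebooks `C`, `C'`. -/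
def inRun {M M' n : ℕ} (C : Fin M → Fin n → ℝ) (C' : Fin M' → Fin n → ℝ)
    (ω : (Fin M × Fin M') × (((Fin n → ℝ) × (Fin n → ℝ)) × ((Fin n → ℝ) × (Fin n → ℝ)))) :
    Side n × Side n :=
  withWords (C ω.1.1) (C' ω.1.2) ω.2

@[fun_prop]
theorem measurable_inRun {M M' n : ℕ} (C : Fin M → Fin n → ℝ) (C' : Fin M' → Fin n → ℝ) :
    Measurable (inRun C C') := by
  refine measurable_from_prod_countable_right fun m => ?_
  exact measurable_withWords (C m.1) (C' m.2)

end Product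

/-! ### Choice of the binning for fixed codebooks. -/

section Hash

variable {α α' u v u' v' R r η : ℝ} {n M M' : ℕ}

/-- The message is uniform and independent of dummy signals and noises, so the joint law with the
other message and output is 1/M times `cutDens`, summed over the other messages. -/
theorem runLaw_slice [NeZero M] (S : Scheme α α' u v u' v' n R r η) (hv : 0 ≤ v) (hv' : 0 ≤ v')
    (C : Fin M → Fin n → ℝ) (C' : Fin M' → Fin n → ℝ) (m : Fin M) (w : Fin n → Fin (S.N + 1))
    {A : Set ((Fin n → ℝ) × Fin M')} (hA : MeasurableSet A) :
    runLaw M M' n v v' {ω | (ω.1.1, S.q (outY α (inRun C C' ω))) = (m, w) ∧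
        (outZ α' (inRun C C' ω), ω.1.2) ∈ A ∧ wordsOut α α' (inRun C C' ω) ∈ S.T}
      = ∫⁻ z in A, (M : ENNReal)⁻¹ * cutDens α α' v v' S.q S.T w (C m) (C' z.2) z.1
          ∂((volume : Measure (Fin n → ℝ)).prod (unif M')) := by
  have hAj : ∀ j, MeasurableSet {z | (z, j) ∈ A} := fun j => measurable_prodMk_right hA
  have hmeas : MeasurableSet {ω : (Fin M × Fin M') ×
      (((Fin n → ℝ) × (Fin n → ℝ)) × ((Fin n → ℝ) × (Fin n → ℝ))) |
      (ω.1.1, S.q (outY α (inRun C C' ω))) = (m, w) ∧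
        (outZ α' (inRun C C' ω), ω.1.2) ∈ A ∧ wordsOut α α' (inRun C C' ω) ∈ S.T} := by
    have h1 : Measurable fun ω : (Fin M × Fin M') ×
      (((Fin n → ℝ) × (Fin n → ℝ)) × ((Fin n → ℝ) × (Fin n → ℝ))) =>
        (ω.1.1, S.q (outY α (inRun C C' ω))) :=
      (by fun_prop : Measurable _).prodMk (S.measurable_q.comp (by fun_prop))
    exact (h1 (measurableSet_singleton _)).inter
      (((by fun_prop : Measurable fun ω : (Fin M × Fin M') ×
      (((Fin n → ℝ) × (Fin n → ℝ)) × ((Fin n → ℝ) × (Fin n → ℝ))) =>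
        (outZ α' (inRun C C' ω), ω.1.2)) hA).inter
      ((by fun_prop : Measurable fun ω : (Fin M × Fin M') ×
      (((Fin n → ℝ) × (Fin n → ℝ)) × ((Fin n → ℝ) × (Fin n → ℝ))) =>
        wordsOut α α' (inRun C C' ω)) S.measurableSet_T))
  have hcm : ∀ j, Measurable (cutDens α α' v v' S.q S.T w (C m) (C' j)) := fun j =>
    measurable_cutDens S.measurable_q S.measurableSet_T w (C m) (C' j)
  have hcm2 : Measurable fun z : (Fin n → ℝ) × Fin M' =>
      (M : ENNReal)⁻¹ * cutDens α α' v v' S.q S.T w (C m) (C' z.2) z.1 :=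
    measurable_from_prod_countable_left fun j => (hcm j).const_mul _
  rw [runLaw, Measure.prod_apply hmeas, lintegral_prod _
    (measurable_measure_prodMk_left hmeas).aemeasurable, lintegral_unif,
    Finset.sum_eq_single m]
  · rw [lintegral_unif, ← lintegral_indicator hA,
      lintegral_prod_symm _ (hcm2.indicator hA).aemeasurable,
      lintegral_unif, Finset.mul_sum]
    refine Finset.sum_congr rfl fun j _ => ?_
    have e1 := cutDens_law (α := α) (α' := α') hv hv' S.measurable_q S.measurableSet_T w
      (C m) (C' j) (hAj j)
    have e2 : (Prod.mk (m, j) ⁻¹' {ω : (Fin M × Fin M') ×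
      (((Fin n → ℝ) × (Fin n → ℝ)) × ((Fin n → ℝ) × (Fin n → ℝ))) |
      (ω.1.1, S.q (outY α (inRun C C' ω))) = (m, w) ∧
        (outZ α' (inRun C C' ω), ω.1.2) ∈ A ∧ wordsOut α α' (inRun C C' ω) ∈ S.T})
        = {p | S.q (outY α (withWords (C m) (C' j) p)) = w ∧
          outZ α' (withWords (C m) (C' j) p) ∈ {z | (z, j) ∈ A} ∧
          wordsOut α α' (withWords (C m) (C' j) p) ∈ S.T} := by
      ext p; simp [inRun]
    rw [e2, e1, ← lintegral_indicator (hAj j), mul_left_comm,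
      ← lintegral_const_mul' _ _ (ENNReal.inv_ne_top.2 (by exact_mod_cast NeZero.ne M))]
    congr 1
    refine lintegral_congr fun z => ?_
    by_cases hz : (z, j) ∈ A
    · rw [Set.indicator_of_mem hz, Set.indicator_of_mem (s := {z | (z, j) ∈ A}) hz]
    · rw [Set.indicator_of_notMem hz, Set.indicator_of_notMem (s := {z | (z, j) ∈ A}) hz, mul_zero]
  · intro m' _ hm'
    have e3 : ∀ j : Fin M', noisePair n v v' (Prod.mk (m', j) ⁻¹' {ω : (Fin M × Fin M') ×
      (((Fin n → ℝ) × (Fin n → ℝ)) × ((Fin n → ℝ) × (Fin n → ℝ))) |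
      (ω.1.1, S.q (outY α (inRun C C' ω))) = (m, w) ∧
        (outZ α' (inRun C C' ω), ω.1.2) ∈ A ∧ wordsOut α α' (inRun C C' ω) ∈ S.T}) = 0 := by
      intro j
      rw [show Prod.mk (m', j) ⁻¹' {ω : (Fin M × Fin M') ×
        (((Fin n → ℝ) × (Fin n → ℝ)) × ((Fin n → ℝ) × (Fin n → ℝ))) |
        (ω.1.1, S.q (outY α (inRun C C' ω))) = (m, w) ∧
        (outZ α' (inRun C C' ω), ω.1.2) ∈ A ∧ wordsOut α α' (inRun C C' ω) ∈ S.T} = ∅ by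
        ext p; simp [hm'], measure_empty]
    rw [lintegral_congr e3, lintegral_zero, mul_zero]
  · simp

/-- The runs in which a second listed cell has the same public message. -/
def collision (S : Scheme α α' u v u' v' n R r η) (C : Fin M → Fin n → ℝ) (C' : Fin M' → Fin n → ℝ)
    (h : Fin M × (Fin n → Fin (S.N + 1)) → Fin S.k × Fin S.f) :
    Set ((Fin M × Fin M') × (((Fin n → ℝ) × (Fin n → ℝ)) × ((Fin n → ℝ) × (Fin n → ℝ)))) :=
  {ω | ∃ w', w' ≠ S.q (outY α (inRun C C' ω)) ∧ (inRun C C' ω).1.1 + (inRun C C' ω).1.2.1 ∈ S.L w' ∧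
    (h (ω.1.1, w')).2 = (h (ω.1.1, S.q (outY α (inRun C C' ω)))).2}

theorem measurableSet_collision (S : Scheme α α' u v u' v' n R r η) (C : Fin M → Fin n → ℝ)
    (C' : Fin M' → Fin n → ℝ) (h : Fin M × (Fin n → Fin (S.N + 1)) → Fin S.k × Fin S.f) :
    MeasurableSet (collision S C C' h) := by
  have h1 : Measurable fun ω : (Fin M × Fin M') ×
      (((Fin n → ℝ) × (Fin n → ℝ)) × ((Fin n → ℝ) × (Fin n → ℝ))) =>
        (ω.1.1, S.q (outY α (inRun C C' ω))) :=
    (by fun_prop : Measurable _).prodMk (S.measurable_q.comp (by fun_prop))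
  have e : collision S C C' h = ⋃ w', ((fun ω => (ω.1.1, S.q (outY α (inRun C C' ω)))) ⁻¹'
      {x | w' ≠ x.2 ∧ (h (x.1, w')).2 = (h x).2}) ∩
      ((fun ω => (inRun C C' ω).1.1 + (inRun C C' ω).1.2.1) ⁻¹' S.L w') := by
    ext ω
    simp only [collision, Set.mem_ofPred_eq, Set.mem_iUnion, Set.mem_inter_iff, Set.mem_preimage]
    exact exists_congr fun w' => by tauto
  rw [e]
  refine MeasurableSet.iUnion fun w' => (h1 (Set.toFinite _).measurableSet).inter ?_
  exact (by fun_prop : Measurable fun ω => (inRun C C' ω).1.1 + (inRun C C' ω).1.2.1)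
    (S.measurableSet_L w')

/-- For each run there are at most η f competing cells, and each shares the public message in a
fraction 1/f of all binnings. -/
theorem sum_collision_le [NeZero M] [NeZero M'] (S : Scheme α α' u v u' v' n R r η)
    (C : Fin M → Fin n → ℝ)
    (C' : Fin M' → Fin n → ℝ) :
    ∑ h, (runLaw M M' n v v').real (collision S C C' h)
      ≤ Fintype.card (Fin M × (Fin n → Fin (S.N + 1)) → Fin S.k × Fin S.f) * η := by
  classical
  have hk : (0 : ℝ) < S.k := (Real.exp_pos _).trans_le S.le_k
  have hf : (0 : ℝ) < S.f := by exact_mod_cast S.f_pos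
  set H : ℝ := (Fintype.card (Fin M × (Fin n → Fin (S.N + 1)) → Fin S.k × Fin S.f) : ℝ) with hH
  have hpt : ∀ ω, ∑ h, (collision S C C' h).indicator (fun _ => (1 : ℝ)) ω ≤ H * η := by
    intro ω
    set w := S.q (outY α (inRun C C' ω)) with hw
    set F : Finset (Fin n → Fin (S.N + 1)) := Finset.univ.filter fun w' =>
      w' ≠ w ∧ (inRun C C' ω).1.1 + (inRun C C' ω).1.2.1 ∈ S.L w' with hF
    have h1 : ∀ h, (collision S C C' h).indicator (fun _ => (1 : ℝ)) ω
        ≤ ∑ w' ∈ F, if (h (ω.1.1, w')).2 = (h (ω.1.1, w)).2 then (1 : ℝ) else 0 := by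
      intro h
      by_cases hc : ω ∈ collision S C C' h
      · rw [Set.indicator_of_mem hc]
        obtain ⟨w', h2, h3, h4⟩ := hc
        have hmem : w' ∈ F := by rw [hF, Finset.mem_filter]; exact ⟨Finset.mem_univ _, h2, h3⟩
        refine le_trans ?_ (Finset.single_le_sum (fun _ _ => by positivity) hmem)
        rw [if_pos h4]
      · rw [Set.indicator_of_notMem hc]
        exact Finset.sum_nonneg fun _ _ => by positivity
    have h5 : ∀ w' ∈ F, ∑ h : Fin M × (Fin n → Fin (S.N + 1)) → Fin S.k × Fin S.f,
        (if (h (ω.1.1, w')).2 = (h (ω.1.1, w)).2 then (1 : ℝ) else 0) = H / S.f := by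
      intro w' hw'
      have hne : w' ≠ w := (Finset.mem_filter.1 hw').2.1
      have := sum_hash_pair (I := Fin S.k × Fin S.f) (w := (ω.1.1, w')) (w' := (ω.1.1, w))
        (fun h => hne (Prod.ext_iff.1 h).2.symm) (fun i j => if i.2 = j.2 then (1 : ℝ) else 0)
        (c := S.k) fun j => by
          rw [Fintype.sum_prod_type]
          simp
      rw [Fintype.card_prod, Fintype.card_fin, Fintype.card_fin, Nat.cast_mul, ← hH] at this
      rw [eq_div_iff hf.ne']
      refine mul_left_cancel₀ hk.ne' ?_
      rw [← this]; ring
    calc _ ≤ ∑ h : Fin M × (Fin n → Fin (S.N + 1)) → Fin S.k × Fin S.f, ∑ w' ∈ F,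
          (if (h (ω.1.1, w')).2 = (h (ω.1.1, w)).2 then (1 : ℝ) else 0) :=
          Finset.sum_le_sum fun h _ => h1 h
      _ = F.card * (H / S.f) := by
          rw [Finset.sum_comm, Finset.sum_congr rfl h5, Finset.sum_const, nsmul_eq_mul]
      _ ≤ η * S.f * (H / S.f) := by
          gcongr
          exact S.card_list _ w F fun w' hw' => (Finset.mem_filter.1 hw').2
      _ = H * η := by field_simp
  have hint : ∀ h, Integrable ((collision S C C' h).indicator fun _ => (1 : ℝ))
      (runLaw M M' n v v') := fun h =>
    (integrable_const _).indicator (measurableSet_collision S C C' h)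
  calc _ = ∫ ω, ∑ h, (collision S C C' h).indicator (fun _ => (1 : ℝ)) ω ∂(runLaw M M' n v v') := by
        rw [integral_finsetSum _ fun h _ => hint h]
        refine Finset.sum_congr rfl fun h _ => ?_
        rw [integral_indicator (measurableSet_collision S C C' h)]
        simp
    _ ≤ ∫ _, H * η ∂(runLaw M M' n v v') :=
        integral_mono (integrable_finsetSum _ fun h _ => hint h) (integrable_const _) hpt
    _ = _ := by simp

/-- For fixed codebooks there is a binning with few collisions and a nearly uniform pair
(key, public message), given the other user's output and message. -/
theorem exists_hash [NeZero M] [NeZero M'] (S : Scheme α α' u v u' v' n R r η)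
    (hη : 0 < η) (hu : 0 ≤ u) (hv : 0 ≤ v)
    (hv' : 0 ≤ v') (hM : Real.exp (n * R) ≤ M) (C : Fin M → Fin n → ℝ) (C' : Fin M' → Fin n → ℝ) :
    ∃ h : Fin M × (Fin n → Fin (S.N + 1)) → Fin S.k × Fin S.f,
      (runLaw M M' n v v').real (collision S C C' h) ≤ 2 * η ∧
      NearUniform (runLaw M M' n v v') (fun ω => h (ω.1.1, S.q (outY α (inRun C C' ω))))
        (fun ω => (outZ α' (inRun C C' ω), ω.1.2))
        (2 * η + (runLaw M M' n v v').real {ω | wordsOut α α' (inRun C C' ω) ∉ S.T}) := by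
  classical
  have hk : (0 : ℝ) < S.k := (Real.exp_pos _).trans_le S.le_k
  have : NeZero S.k := ⟨by rintro h; rw [h] at hk; simp at hk⟩
  have : NeZero S.f := ⟨S.f_pos.ne'⟩
  have hB := varB_pos (α' := α') hv hv'
  have hA : 0 < varB α' v v' + α' ^ 2 * u := by positivity
  have hM0 : (0 : ℝ) < M := (Real.exp_pos _).trans_le hM
  have hT : MeasurableSet {ω | wordsOut α α' (inRun C C' ω) ∈ S.T} :=
    (by fun_prop : Measurable fun ω => wordsOut α α' (inRun C C' ω)) S.measurableSet_T
  have hX : Measurable fun ω : (Fin M × Fin M') ×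
      (((Fin n → ℝ) × (Fin n → ℝ)) × ((Fin n → ℝ) × (Fin n → ℝ))) =>
        (ω.1.1, S.q (outY α (inRun C C' ω))) :=
    (by fun_prop : Measurable _).prodMk (S.measurable_q.comp (by fun_prop))
  obtain ⟨δ, hδ1, hδ0, hδ⟩ := exists_nearUniform_binning (I := Fin S.k × Fin S.f)
    (μ := runLaw M M' n v v') (ref := (volume : Measure (Fin n → ℝ)).prod (unif M'))
    (X := fun ω => (ω.1.1, S.q (outY α (inRun C C' ω))))
    (V := fun ω => (outZ α' (inRun C C' ω), ω.1.2)) hX (by fun_prop) hT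
    -- The factor 1/M is the gain from the decoded message: it turns b into b/M, and M ≥ exp(nR).
    (p := fun x z => (M : ℝ)⁻¹ * (cutDens α α' v v' S.q S.T x.2 (C x.1) (C' z.2) z.1).toReal)
    (P := fun z => refDens α' u v v' (C' z.2) z.1) (b := S.b / M) (τ := η) hη
    (fun x => measurable_from_prod_countable_left fun j =>
      (measurable_cutDens S.measurable_q S.measurableSet_T x.2 (C x.1)
        (C' j)).ennreal_toReal.const_mul _)
    (fun x z => by positivity)
    (measurable_from_prod_countable_left fun j => by unfold refDens; fun_prop)
    (fun z => phv_pos hA _)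
    (by
      rw [lintegral_prod_symm _ (measurable_from_prod_countable_left fun j => by
        unfold refDens; fun_prop).aemeasurable]
      simp only [refDens, lintegral_phv hA, lintegral_const, measure_univ, mul_one])
    (fun x z => by
      have h1 := S.cutDens_le x.2 (C x.1) (C' z.2) z.1
      have h2 := ENNReal.toReal_mono ENNReal.ofReal_ne_top h1
      have h0 : 0 < refDens α' u v v' (C' z.2) z.1 := phv_pos hA _
      rw [ENNReal.toReal_ofReal (mul_nonneg S.b_nonneg h0.le)] at h2
      calc _ ≤ (M : ℝ)⁻¹ * (S.b * refDens α' u v v' (C' z.2) z.1) := by gcongr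
        _ = _ := by ring)
    (by
      have h1 := S.b_le
      rw [Fintype.card_prod, Fintype.card_fin, Fintype.card_fin]
      rw [← mul_div_assoc, div_le_iff₀ hM0]
      exact h1.trans (by gcongr))
    (fun x A hA => by
      rw [show x = (x.1, x.2) from rfl]
      refine (runLaw_slice S hv hv' C C' x.1 x.2 hA).trans (lintegral_congr fun z => ?_)
      rw [ENNReal.ofReal_mul (by positivity), ENNReal.ofReal_toReal (ne_top_of_le_ne_top
        ENNReal.ofReal_ne_top (S.cutDens_le x.2 (C x.1) (C' z.2) z.1)),
        ENNReal.ofReal_inv_of_pos hM0, ENNReal.ofReal_natCast])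
  have hsum := add_le_add hδ1 (sum_collision_le (M := M) (M' := M') S C C')
  rw [← Finset.sum_add_distrib, ← mul_add] at hsum
  -- Secrecy error and collision probability each average to at most η, so some binning keeps their
  -- sum within 2η.
  obtain ⟨h, hh⟩ : ∃ h, δ h + (runLaw M M' n v v').real (collision S C C' h) ≤ η + η := by
    by_contra hcon
    push Not at hcon
    have hlt := Finset.sum_lt_sum_of_nonempty (Finset.univ_nonempty) fun h _ => hcon h
    rw [Finset.sum_const, Finset.card_univ, nsmul_eq_mul] at hlt
    linarith
  refine ⟨h, by linarith [hδ0 h], (hδ h).mono ?_⟩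
  have h1 : 0 ≤ (runLaw M M' n v v').real (collision S C C' h) := measureReal_nonneg
  have h2 : {ω | wordsOut α α' (inRun C C' ω) ∈ S.T}ᶜ
      = {ω | wordsOut α α' (inRun C C' ω) ∉ S.T} := rfl
  rw [h2]
  linarith

end Hash

/-! ### Failure events and choice of the codebooks. -/

section Fails

variable {α α' u v u' v' R r η : ℝ} {n M M' : ℕ}

/-- Power violation, a decoding error at the user or at its base station (which adds the dummy
noise `e` to its own signal), or an atypical run. -/
def SideFails (S : Scheme α α' u v u' v' n R r η) (D : Set ((Fin n → ℝ) × (Fin n → ℝ))) (P : ℝ)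
    (C : Fin M → Fin n → ℝ) (e : Fin n → ℝ) (C' : Fin M' → Fin n → ℝ) (m : Fin M) (m' : Fin M')
    (p : ((Fin n → ℝ) × (Fin n → ℝ)) × ((Fin n → ℝ) × (Fin n → ℝ))) : Prop :=
  n * P < ∑ t, (C m + p.1.1) t ^ 2 ∨
  (C, p.1.1 + p.1.2 + α • (C' m' + p.2.1)) ∈ decFail D m ∨
  (C, e + p.1.1) ∈ decFail D m ∨
  (C m + p.1.1 ∉ S.L (S.q (outY α (withWords (C m) (C' m') p))) ∨
    wordsOut α α' (withWords (C m) (C' m') p) ∉ S.T)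

theorem measurableSet_list (S : Scheme α α' u v u' v' n R r η) :
    MeasurableSet {p : Side n × Side n | p.1.1 + p.1.2.1 ∉ S.L (S.q (outY α p)) ∨
      wordsOut α α' p ∉ S.T} := by
  have e : {p : Side n × Side n | p.1.1 + p.1.2.1 ∉ S.L (S.q (outY α p)) ∨ wordsOut α α' p ∉ S.T}
      = (⋃ w, ((fun p => S.q (outY α p)) ⁻¹' {w}) ∩ ((fun p => p.1.1 + p.1.2.1) ⁻¹' (S.L w)ᶜ))
        ∪ (wordsOut α α' ⁻¹' S.Tᶜ) := by
    ext p; simp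
  rw [e]
  refine (MeasurableSet.iUnion fun w => ?_).union (measurable_wordsOut α α' S.measurableSet_T.compl)
  exact ((S.measurable_q.comp (measurable_outY α)) (measurableSet_singleton w)).inter
    ((by fun_prop : Measurable fun p : Side n × Side n => p.1.1 + p.1.2.1)
      (S.measurableSet_L w).compl)

/-- Law of the codebooks and dummy noises. -/
noncomputable def codeLaw (M M' n : ℕ) (u u' σ σ' : ℝ) :
    Measure (((Fin M → Fin n → ℝ) × (Fin n → ℝ)) × ((Fin M' → Fin n → ℝ) × (Fin n → ℝ))) :=
  ((codebook M n u).prod (gv n σ)).prod ((codebook M' n u').prod (gv n σ'))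

instance (M M' n : ℕ) (u u' σ σ' : ℝ) : IsProbabilityMeasure (codeLaw M M' n u u' σ σ') := by
  unfold codeLaw; infer_instance

theorem measurableSet_sideFails (S : Scheme α α' u v u' v' n R r η)
    {D : Set ((Fin n → ℝ) × (Fin n → ℝ))} (hD : MeasurableSet D) (P : ℝ) (m : Fin M)
    (m' : Fin M') :
    MeasurableSet {x : (((Fin M → Fin n → ℝ) × (Fin n → ℝ)) ×
      ((Fin M' → Fin n → ℝ) × (Fin n → ℝ))) ×
      (((Fin n → ℝ) × (Fin n → ℝ)) × ((Fin n → ℝ) × (Fin n → ℝ))) |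
      SideFails S D P x.1.1.1 x.1.1.2 x.1.2.1 m m' x.2} := by
  refine MeasurableSet.union (measurableSet_lt measurable_const
    (by fun_prop : Measurable fun x : (((Fin M → Fin n → ℝ) × (Fin n → ℝ)) ×
      ((Fin M' → Fin n → ℝ) × (Fin n → ℝ))) ×
      (((Fin n → ℝ) × (Fin n → ℝ)) × ((Fin n → ℝ) × (Fin n → ℝ))) =>
      ∑ t, (x.1.1.1 m + x.2.1.1) t ^ 2)) (MeasurableSet.union ?_ (MeasurableSet.union ?_ ?_))
  · exact (by fun_prop : Measurable fun x : (((Fin M → Fin n → ℝ) × (Fin n → ℝ)) ×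
      ((Fin M' → Fin n → ℝ) × (Fin n → ℝ))) ×
      (((Fin n → ℝ) × (Fin n → ℝ)) × ((Fin n → ℝ) × (Fin n → ℝ))) =>
      (x.1.1.1, x.2.1.1 + x.2.1.2 + α • (x.1.2.1 m' + x.2.2.1))) (measurableSet_decFail hD m)
  · exact (by fun_prop : Measurable fun x : (((Fin M → Fin n → ℝ) × (Fin n → ℝ)) ×
      ((Fin M' → Fin n → ℝ) × (Fin n → ℝ))) ×
      (((Fin n → ℝ) × (Fin n → ℝ)) × ((Fin n → ℝ) × (Fin n → ℝ))) =>
      (x.1.1.1, x.1.1.2 + x.2.1.1)) (measurableSet_decFail hD m)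
  · exact (by unfold withWords; fun_prop : Measurable fun x : (((Fin M → Fin n → ℝ) × (Fin n → ℝ)) ×
      ((Fin M' → Fin n → ℝ) × (Fin n → ℝ))) ×
      (((Fin n → ℝ) × (Fin n → ℝ)) × ((Fin n → ℝ) × (Fin n → ℝ))) =>
      withWords (x.1.1.1 m) (x.1.2.1 m') x.2) (measurableSet_list S)

/-- Each of the four failure events costs η, since averaged over random codebooks all signals are
exactly Gaussian with the right variances. -/
theorem sideFails_le (S : Scheme α α' u v u' v' n R r η) {D : Set ((Fin n → ℝ) × (Fin n → ℝ))}
    (hD : MeasurableSet D) {P σ' : ℝ} (hu : 0 ≤ u) (hv : 0 ≤ v) (hu' : 0 ≤ u') (hv' : 0 ≤ v')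
    (hη : 0 ≤ η)
    (hpow : gv n (u + v) {x | n * P < ∑ t, x t ^ 2} ≤ ENNReal.ofReal η)
    (hdec : ∀ m, ((codebook M n u).prod (gv n (v + 1 + α ^ 2 * (u' + v')))) (decFail D m)
      ≤ ENNReal.ofReal η) (m : Fin M) (m' : Fin M') :
    ((codeLaw M M' n u u' (1 + α ^ 2 * (u' + v')) σ').prod (noisePair n v v'))
      {x | SideFails S D P x.1.1.1 x.1.1.2 x.1.2.1 m m' x.2} ≤ ENNReal.ofReal (4 * η) := by
  set σ := 1 + α ^ 2 * (u' + v') with hσ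
  have hσ0 : 0 ≤ σ := by positivity
  have hc := measurePreserving_prod_comm ((codebook M n u).prod (gv n σ))
    ((codebook M' n u').prod (gv n σ')) ((gv n v).prod (gv n 1)) ((gv n v').prod (gv n 1))
  have hword := (measurePreserving_codeword M n u m).comp
    (measurePreserving_fst (μ := codebook M n u) (ν := gv n σ))
  have hword' := (measurePreserving_codeword M' n u' m').comp
    (measurePreserving_fst (μ := codebook M' n u') (ν := gv n σ'))
  have hdum := measurePreserving_fst (μ := gv n v) (ν := gv n 1)
  have hdum' := measurePreserving_fst (μ := gv n v') (ν := gv n 1)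
  -- own transmitted block
  have hX : MeasurePreserving (fun x : (((Fin M → Fin n → ℝ) × (Fin n → ℝ)) ×
      ((Fin M' → Fin n → ℝ) × (Fin n → ℝ))) ×
      (((Fin n → ℝ) × (Fin n → ℝ)) × ((Fin n → ℝ) × (Fin n → ℝ))) => x.1.1.1 m + x.2.1.1)
      ((codeLaw M M' n u u' σ σ').prod (noisePair n v v')) (gv n (u + v)) := by
    have h := (gv_lin (n := n) hu hv 1 1).comp
      ((hword.prod hdum).comp (measurePreserving_fst.comp hc))
    simpa [Function.comp_def, codeLaw, noisePair] using h
  have hX' : MeasurePreserving (fun x : ((Fin M' → Fin n → ℝ) × (Fin n → ℝ)) ×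
      ((Fin n → ℝ) × (Fin n → ℝ)) => x.1.1 m' + x.2.1)
      (((codebook M' n u').prod (gv n σ')).prod ((gv n v').prod (gv n 1))) (gv n (u' + v')) := by
    have h := (gv_lin (n := n) hu' hv' 1 1).comp (hword'.prod hdum')
    simpa [Function.comp_def] using h
  -- The dummy noise e has the variance of the user's interference and receiver noise. The station
  -- thus faces the same Gaussian channel as the user, and the same decoder works.
  have hst : MeasurePreserving (fun x : (((Fin M → Fin n → ℝ) × (Fin n → ℝ)) ×
      ((Fin M' → Fin n → ℝ) × (Fin n → ℝ))) ×
      (((Fin n → ℝ) × (Fin n → ℝ)) × ((Fin n → ℝ) × (Fin n → ℝ))) =>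
      (x.1.1.1, x.1.1.2 + x.2.1.1)) ((codeLaw M M' n u u' σ σ').prod (noisePair n v v'))
      ((codebook M n u).prod (gv n (v + 1 + α ^ 2 * (u' + v')))) := by
    have h := (((MeasurePreserving.id (codebook M n u)).prod (gv_lin (n := n) hσ0 hv 1 1)).comp
      (measurePreserving_prodAssoc _ _ _)).comp
      (((MeasurePreserving.id ((codebook M n u).prod (gv n σ))).prod hdum).comp
        (measurePreserving_fst.comp hc))
    rw [show (1 : ℝ) ^ 2 * σ + 1 ^ 2 * v = v + 1 + α ^ 2 * (u' + v') by rw [hσ]; ring] at h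
    simpa [Function.comp_def, codeLaw, noisePair, MeasurableEquiv.prodAssoc] using h
  have hus : MeasurePreserving (fun x : (((Fin M → Fin n → ℝ) × (Fin n → ℝ)) ×
      ((Fin M' → Fin n → ℝ) × (Fin n → ℝ))) ×
      (((Fin n → ℝ) × (Fin n → ℝ)) × ((Fin n → ℝ) × (Fin n → ℝ))) =>
      (x.1.1.1, x.2.1.1 + x.2.1.2 + α • (x.1.2.1 m' + x.2.2.1)))
      ((codeLaw M M' n u u' σ σ').prod (noisePair n v v'))
      ((codebook M n u).prod (gv n (v + 1 + α ^ 2 * (u' + v')))) := by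
    have h1 := (measurePreserving_fst (μ := codebook M n u) (ν := gv n σ)).prod
      (gv_lin (n := n) hv zero_le_one 1 1)
    have h := ((MeasurePreserving.id (codebook M n u)).prod
      (gv_lin (n := n) (s := 1 ^ 2 * v + 1 ^ 2 * 1) (t := u' + v') (by positivity) (by positivity)
        1 α)).comp ((measurePreserving_prodAssoc _ _ _).comp ((h1.prod hX').comp hc))
    rw [show (1 : ℝ) ^ 2 * (1 ^ 2 * v + 1 ^ 2 * 1) + α ^ 2 * (u' + v')
      = v + 1 + α ^ 2 * (u' + v') by ring] at h
    simpa [Function.comp_def, codeLaw, noisePair, MeasurableEquiv.prodAssoc] using h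
  have hid : MeasurePreserving (fun x : (((Fin M → Fin n → ℝ) × (Fin n → ℝ)) ×
      ((Fin M' → Fin n → ℝ) × (Fin n → ℝ))) ×
      (((Fin n → ℝ) × (Fin n → ℝ)) × ((Fin n → ℝ) × (Fin n → ℝ))) =>
      withWords (x.1.1.1 m) (x.1.2.1 m') x.2) ((codeLaw M M' n u u' σ σ').prod (noisePair n v v'))
      ((idealSide n u v).prod (idealSide n u' v')) :=
    (measurePreserving_prod_comm _ _ _ _).comp ((hword.prod hword').prod (.id (noisePair n v v')))
  have b1 := (hX.measure_preimage (s := {x | n * P < ∑ t, x t ^ 2})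
    (measurableSet_lt (by fun_prop) (by fun_prop)).nullMeasurableSet).le.trans hpow
  have b2 := (hus.measure_preimage (measurableSet_decFail hD m).nullMeasurableSet).le.trans (hdec m)
  have b3 := (hst.measure_preimage (measurableSet_decFail hD m).nullMeasurableSet).le.trans (hdec m)
  have b4 := (hid.measure_preimage (measurableSet_list S).nullMeasurableSet).le.trans S.prob
  have e : ENNReal.ofReal (4 * η) = ENNReal.ofReal η + (ENNReal.ofReal η + (ENNReal.ofReal η
      + ENNReal.ofReal η)) := by
    rw [← ENNReal.ofReal_add hη hη, ← ENNReal.ofReal_add hη (by positivity),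
      ← ENNReal.ofReal_add hη (by positivity)]
    congr 1; ring
  rw [e]
  refine (measure_union_le _ _).trans (add_le_add b1 ?_)
  refine (measure_union_le _ _).trans (add_le_add b2 ?_)
  exact (measure_union_le _ _).trans (add_le_add b3 b4)

/-- A random code is at least as good as its average over the messages for some realization. -/
theorem exists_runLaw_le {Θ : Type*} [MeasurableSpace Θ] {τ : Measure Θ} [IsProbabilityMeasure τ]
    [NeZero M] [NeZero M'] {B : Θ → Fin M → Fin M' →
      Set (((Fin n → ℝ) × (Fin n → ℝ)) × ((Fin n → ℝ) × (Fin n → ℝ)))}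
    (hB : ∀ m m', MeasurableSet {x : Θ × _ | x.2 ∈ B x.1 m m'}) {c : ENNReal}
    (hc : ∀ m m', (τ.prod (noisePair n v v')) {x | x.2 ∈ B x.1 m m'} ≤ c) :
    ∃ θ, runLaw M M' n v v' {ω | ω.2 ∈ B θ ω.1.1 ω.1.2} ≤ c := by
  have hθ : ∀ θ m m', MeasurableSet (B θ m m') := fun θ m m' => measurable_prodMk_left (hB m m')
  have hm : ∀ θ, MeasurableSet {ω : (Fin M × Fin M') × _ | ω.2 ∈ B θ ω.1.1 ω.1.2} := by
    intro θ
    have e : {ω : (Fin M × Fin M') × _ | ω.2 ∈ B θ ω.1.1 ω.1.2}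
        = ⋃ m : Fin M × Fin M', {m} ×ˢ B θ m.1 m.2 := by
      ext ω
      simp only [Set.mem_ofPred_eq, Set.mem_iUnion, Set.mem_prod, Set.mem_singleton_iff]
      exact ⟨fun h => ⟨_, rfl, h⟩, by rintro ⟨m, rfl, h⟩; exact h⟩
    rw [e]
    exact MeasurableSet.iUnion fun m => (measurableSet_singleton m).prod (hθ θ m.1 m.2)
  have hmf : ∀ m m', Measurable fun θ => noisePair n v v' (B θ m m') := fun m m' =>
    measurable_measure_prodMk_left (hB m m')
  have hrun : ∀ θ, runLaw M M' n v v' {ω | ω.2 ∈ B θ ω.1.1 ω.1.2}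
      = ∫⁻ m, noisePair n v v' (B θ m.1 m.2) ∂((unif M).prod (unif M')) := fun θ => by
    rw [runLaw, Measure.prod_apply (hm θ)]; rfl
  have hjoint : Measurable fun x : Θ × (Fin M × Fin M') => noisePair n v v' (B x.1 x.2.1 x.2.2) :=
    measurable_from_prod_countable_left fun m => hmf m.1 m.2
  obtain ⟨θ, hle⟩ := exists_le_lintegral (μ := τ)
    (f := fun θ => runLaw M M' n v v' {ω | ω.2 ∈ B θ ω.1.1 ω.1.2}) (by
      simp only [hrun]
      exact hjoint.lintegral_prod_right'.aemeasurable)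
  refine ⟨θ, hle.trans ?_⟩
  simp only [hrun]
  rw [lintegral_lintegral_swap hjoint.aemeasurable]
  calc _ ≤ ∫⁻ _, c ∂((unif M).prod (unif M')) := lintegral_mono fun m => by
        refine le_trans (le_of_eq ?_) (hc m.1 m.2)
        rw [Measure.prod_apply (hB m.1 m.2)]; rfl
    _ = c := by simp

/-- Codebooks and dummy noises for which a run fails on either side only rarely. -/
theorem exists_codebooks {α₁ α₂ u₁ v₁ u₂ v₂ R₁ R₂ r₁ r₂ : ℝ} {M₁ M₂ : ℕ} [NeZero M₁] [NeZero M₂]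
    (S₁ : Scheme α₁ α₂ u₁ v₁ u₂ v₂ n R₁ r₁ η) (S₂ : Scheme α₂ α₁ u₂ v₂ u₁ v₁ n R₂ r₂ η)
    {D₁ D₂ : Set ((Fin n → ℝ) × (Fin n → ℝ))} (hD₁ : MeasurableSet D₁) (hD₂ : MeasurableSet D₂)
    {P₁ P₂ : ℝ} (hu₁ : 0 ≤ u₁) (hv₁ : 0 ≤ v₁) (hu₂ : 0 ≤ u₂) (hv₂ : 0 ≤ v₂) (hη : 0 ≤ η)
    (hpow₁ : gv n (u₁ + v₁) {x | n * P₁ < ∑ t, x t ^ 2} ≤ ENNReal.ofReal η)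
    (hpow₂ : gv n (u₂ + v₂) {x | n * P₂ < ∑ t, x t ^ 2} ≤ ENNReal.ofReal η)
    (hdec₁ : ∀ m, ((codebook M₁ n u₁).prod (gv n (v₁ + 1 + α₁ ^ 2 * (u₂ + v₂)))) (decFail D₁ m)
      ≤ ENNReal.ofReal η)
    (hdec₂ : ∀ m, ((codebook M₂ n u₂).prod (gv n (v₂ + 1 + α₂ ^ 2 * (u₁ + v₁)))) (decFail D₂ m)
      ≤ ENNReal.ofReal η) :
    ∃ (C₁ : Fin M₁ → Fin n → ℝ) (e₁ : Fin n → ℝ) (C₂ : Fin M₂ → Fin n → ℝ) (e₂ : Fin n → ℝ),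
      runLaw M₁ M₂ n v₁ v₂ {ω | SideFails S₁ D₁ P₁ C₁ e₁ C₂ ω.1.1 ω.1.2 ω.2 ∨
        SideFails S₂ D₂ P₂ C₂ e₂ C₁ ω.1.2 ω.1.1 ω.2.swap} ≤ ENNReal.ofReal (8 * η) := by
  have hswap := (Measure.measurePreserving_swap
      (μ := (codebook M₁ n u₁).prod (gv n (1 + α₁ ^ 2 * (u₂ + v₂))))
      (ν := (codebook M₂ n u₂).prod (gv n (1 + α₂ ^ 2 * (u₁ + v₁))))).prod
    (Measure.measurePreserving_swap (μ := (gv n v₁).prod (gv n 1)) (ν := (gv n v₂).prod (gv n 1)))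
  have hm₁ := measurableSet_sideFails (M := M₁) (M' := M₂) S₁ hD₁ P₁
  have hm₂ := measurableSet_sideFails (M := M₂) (M' := M₁) S₂ hD₂ P₂
  obtain ⟨θ, hθ⟩ := exists_runLaw_le (n := n) (v := v₁) (v' := v₂) (M := M₁) (M' := M₂)
    (τ := codeLaw M₁ M₂ n u₁ u₂ (1 + α₁ ^ 2 * (u₂ + v₂)) (1 + α₂ ^ 2 * (u₁ + v₁)))
    (B := fun θ m m' => {p | SideFails S₁ D₁ P₁ θ.1.1 θ.1.2 θ.2.1 m m' p ∨
      SideFails S₂ D₂ P₂ θ.2.1 θ.2.2 θ.1.1 m' m p.swap})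
    (fun m m' => (hm₁ m m').union (hswap.measurable (hm₂ m' m)))
    (c := ENNReal.ofReal (8 * η)) (fun m m' => by
      rw [show 8 * η = 4 * η + 4 * η by ring, ENNReal.ofReal_add (by positivity) (by positivity)]
      refine (measure_union_le _ _).trans (add_le_add
        (sideFails_le S₁ hD₁ hu₁ hv₁ hu₂ hv₂ hη hpow₁ hdec₁ m m') ?_)
      exact (hswap.measure_preimage (hm₂ m' m).nullMeasurableSet).le.trans
        (sideFails_le S₂ hD₂ hu₂ hv₂ hu₁ hv₁ hη hpow₂ hdec₂ m' m))
  exact ⟨θ.1.1, θ.1.2, θ.2.1, θ.2.2, hθ⟩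

end Fails

/-! ### Maps of the users and of the base stations. -/

section Maps

variable {n M : ℕ}

/-- Any word passing the test may be chosen: off the failure event it is the only one. The default 0
is never used there. -/
theorem exists_decode [NeZero M] {D : Set ((Fin n → ℝ) × (Fin n → ℝ))} (hD : MeasurableSet D)
    (C : Fin M → Fin n → ℝ) : ∃ d : (Fin n → ℝ) → Fin M, Measurable d ∧
      ∀ m w, (C, w) ∉ decFail D m → d (C m + w) = m := by
  classical
  let g : (Fin M → Prop) → Fin M := fun b => if h : ∃ m, b m then h.choose else 0
  have hg : Measurable g := measurable_of_finite g
  refine ⟨fun y => g fun m => (C m, y) ∈ D, hg.comp (measurable_pi_lambda _ fun m => ?_), ?_⟩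
  · exact measurable_mem.2 (measurable_prodMk_left hD : MeasurableSet (Prod.mk (C m) ⁻¹' D))
  · intro m w hw
    simp only [decFail, Set.mem_union, Set.mem_ofPred_eq, Set.mem_iUnion, not_or, not_not,
      not_exists] at hw
    have hex : ∃ m', (C m', C m + w) ∈ D := ⟨m, hw.1⟩
    show (if h : ∃ m', (C m', C m + w) ∈ D then h.choose else 0) = m
    rw [dif_pos hex]
    by_contra hne
    exact hw.2 _ hne hex.choose_spec

/-- The station decodes its own message from x + e and picks a listed cell with the received public
message; without a collision that cell is the user's. -/
theorem exists_station {W : Type*} [Finite W] {k f : ℕ} [NeZero k] {d : (Fin n → ℝ) → Fin M}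
    (hd : Measurable d) {L : W → Set (Fin n → ℝ)} (hL : ∀ w, MeasurableSet (L w)) (e : Fin n → ℝ)
    (h : Fin M × W → Fin k × Fin f) : ∃ st : (Fin n → ℝ) × Fin f → Fin k, Measurable st ∧
      ∀ x m w, d (x + e) = m → x ∈ L w →
        (∀ w', w' ≠ w → x ∈ L w' → (h (m, w')).2 ≠ (h (m, w)).2) →
        st (x, (h (m, w)).2) = (h (m, w)).1 := by
  classical
  let g : (Fin M × Fin f) × (W → Prop) → Fin k := fun b =>
    if hb : ∃ w, b.2 w ∧ (h (b.1.1, w)).2 = b.1.2 then (h (b.1.1, hb.choose)).1 else 0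
  have hg : Measurable g := measurable_of_finite g
  refine ⟨fun p => g ((d (p.1 + e), p.2), fun w => p.1 ∈ L w),
    hg.comp (Measurable.prodMk ?_ (measurable_pi_lambda _ fun w => ?_)), ?_⟩
  · exact (hd.comp (by fun_prop)).prodMk measurable_snd
  · exact measurable_mem.2 (hL w) |>.comp measurable_fst
  · rintro x m w rfl hw hun
    have hex : ∃ w', x ∈ L w' ∧ (h (d (x + e), w')).2 = (h (d (x + e), w)).2 := ⟨w, hw, rfl⟩
    show (if hb : ∃ w', x ∈ L w' ∧ (h (d (x + e), w')).2 = (h (d (x + e), w)).2 then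
      (h (d (x + e), hb.choose)).1 else 0) = _
    rw [dif_pos hex]
    obtain ⟨h1, h2⟩ := hex.choose_spec
    have : hex.choose = w := by
      by_contra hne
      exact hun _ hne h1 h2
    rw [this]

end Maps

/-! ### Secrecy and agreement for one side. -/

section OneSide

variable {α α' u v u' v' R r η : ℝ} {n M M' : ℕ}

/-- Maps of a user and of its base station that give a shared, nearly uniform key which is nearly
independent of the other output and of the public message. -/
theorem exists_user_station [NeZero M] [NeZero M'] (S : Scheme α α' u v u' v' n R r η) (hη : 0 < η)
    (hu : 0 ≤ u) (hv : 0 ≤ v) (hv' : 0 ≤ v') (hM : Real.exp (n * R) ≤ M)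
    {D : Set ((Fin n → ℝ) × (Fin n → ℝ))} (hD : MeasurableSet D) {P : ℝ} (C : Fin M → Fin n → ℝ)
    (e : Fin n → ℝ) (C' : Fin M' → Fin n → ℝ) {B : Set ((Fin M × Fin M') ×
      (((Fin n → ℝ) × (Fin n → ℝ)) × ((Fin n → ℝ) × (Fin n → ℝ))))}
    (hB : (runLaw M M' n v v').real B ≤ 8 * η)
    (hoff : ∀ ω ∉ B, ¬ SideFails S D P C e C' ω.1.1 ω.1.2 ω.2) :
    ∃ (us : (Fin n → ℝ) → Fin S.k × Fin S.f) (st : (Fin n → ℝ) × Fin S.f → Fin S.k),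
      Measurable us ∧ Measurable st ∧ ∀ X Y Z : (Fin M × Fin M') ×
        (((Fin n → ℝ) × (Fin n → ℝ)) × ((Fin n → ℝ) × (Fin n → ℝ))) → Fin n → ℝ, Measurable Y →
        (∀ ω ∉ B, X ω = C ω.1.1 + ω.2.1.1 ∧ Y ω = outY α (inRun C C' ω) ∧
          Z ω = outZ α' (inRun C C' ω)) →
        NearUniform (runLaw M M' n v v') (fun ω => (us (Y ω)).1) (fun ω => (Z ω, (us (Y ω)).2))
          (36 * η) ∧
        (runLaw M M' n v v').real {ω | (us (Y ω)).1 ≠ st (X ω, (us (Y ω)).2)} ≤ 10 * η := by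
  have hk : (0 : ℝ) < S.k := (Real.exp_pos _).trans_le S.le_k
  have : NeZero S.k := ⟨by rintro h; rw [h] at hk; simp at hk⟩
  obtain ⟨h, hcol, hnear⟩ := exists_hash S hη hu hv hv' hM C C'
  obtain ⟨d, hd, hdec⟩ := exists_decode hD C
  obtain ⟨st, hst, hstat⟩ := exists_station hd S.measurableSet_L e h
  have hh : Measurable h := measurable_of_finite h
  have hus : Measurable fun y => h (d y, S.q y) := hh.comp (hd.prodMk S.measurable_q)
  refine ⟨fun y => h (d y, S.q y), st, hus, hst, fun X Y Z hY hoffB => ?_⟩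
  have hkey : ∀ ω ∉ B, h (d (Y ω), S.q (Y ω)) = h (ω.1.1, S.q (outY α (inRun C C' ω))) := by
    intro ω hω
    have hf := hoff ω hω
    simp only [SideFails, not_or] at hf
    rw [(hoffB ω hω).2.1]
    congr 2
    rw [← hdec _ _ hf.2.1]
    congr 1
    ext t
    simp [outY, inRun, withWords]
    ring
  have hT : {ω | wordsOut α α' (inRun C C' ω) ∉ S.T} ⊆ B := by
    intro ω hω
    by_contra hωB
    have hf := hoff ω hωB
    simp only [SideFails, not_or] at hf
    exact hf.2.2.2.2 hω
  constructor
  · have hW : Measurable fun ω : (Fin M × Fin M') ×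
        (((Fin n → ℝ) × (Fin n → ℝ)) × ((Fin n → ℝ) × (Fin n → ℝ))) =>
        h (ω.1.1, S.q (outY α (inRun C C' ω))) :=
      hh.comp ((by fun_prop : Measurable fun ω : (Fin M × Fin M') ×
        (((Fin n → ℝ) × (Fin n → ℝ)) × ((Fin n → ℝ) × (Fin n → ℝ))) => ω.1.1).prodMk
        (S.measurable_q.comp (by fun_prop)))
    -- Split off the public message, forget the other message, then replace the ideal signals by the
    -- actual ones, which agree off B.
    have h1 := ((hnear.fst hW (by fun_prop)).comp (g := fun x => (x.1.1, x.2))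
      (by fun_prop)).congr_off
      (K' := fun ω => (h (d (Y ω), S.q (Y ω))).1)
      (V' := fun ω => (Z ω, (h (d (Y ω), S.q (Y ω))).2)) (measurable_fst.comp (hus.comp hY))
      (measurableSet_toMeasurable (runLaw M M' n v v') B) (fun ω hω => by
        have hω' : ω ∉ B := fun hB => hω (subset_toMeasurable _ _ hB)
        rw [hkey ω hω', (hoffB ω hω').2.2]
        exact ⟨rfl, rfl⟩)
    -- 36 = 2(2 + 8) + 2·8: splitting doubles the binning error and the atypical mass, and the
    -- replacement costs twice the mass of B.
    refine h1.mono ?_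
    have h2 := measureReal_mono (μ := runLaw M M' n v v') hT
    have h3 : (runLaw M M' n v v').real (toMeasurable (runLaw M M' n v v') B) ≤ 8 * η := by
      rwa [Measure.real, measure_toMeasurable]
    linarith
  · have hsub : {ω | (h (d (Y ω), S.q (Y ω))).1 ≠ st (X ω, (h (d (Y ω), S.q (Y ω))).2)}
        ⊆ B ∪ collision S C C' h := by
      intro ω hω
      by_contra hcon
      rw [Set.mem_union, not_or] at hcon
      have hf := hoff ω hcon.1
      simp only [SideFails, not_or] at hf
      refine hω ?_
      rw [hkey ω hcon.1, (hoffB ω hcon.1).1]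
      refine (hstat _ _ _ ?_ ?_ ?_).symm
      · exact (congrArg d (by abel)).trans (hdec _ _ hf.2.2.1)
      · exact not_not.1 hf.2.2.2.1
      · exact fun w' h1 h2 h3 => hcon.2 ⟨w', h1, h2, h3⟩
    exact (measureReal_mono hsub).trans ((measureReal_union_le _ _).trans (by linarith))

end OneSide

/-! ### Realizing the code and its law. -/

section Code

variable {n : ℕ} {P₁ P₂ α₁ α₂ : ℝ}

theorem measurePreserving_compProd_dirac {Ω A B : Type*} [MeasurableSpace Ω] [MeasurableSpace A]
    [MeasurableSpace B] {μ : Measure Ω} {ν : Measure A} [SFinite ν] {g : Ω → A}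
    (hg : MeasurePreserving g μ ν) {κ : Kernel A B} {f : A → B} (hf : Measurable f)
    (hκ : ∀ x, κ x = Measure.dirac (f x)) :
    MeasurePreserving (fun ω => (g ω, f (g ω))) μ (ν.compProd κ) := by
  have e : κ = Kernel.deterministic f hf := by
    ext1 x
    rw [hκ, Kernel.deterministic_apply]
  rw [e, Measure.compProd_deterministic]
  exact ((measurable_id.prodMk hf).measurePreserving ν).comp hg

theorem entropyOf_comp {Ω Ω' A : Type*} [MeasurableSpace Ω] [MeasurableSpace Ω'] [MeasurableSpace A]
    [Fintype A] {μ : Measure Ω} {ν : Measure Ω'} {G : Ω → Ω'} (hG : MeasurePreserving G μ ν)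
    {K : Ω' → A} (hK : Measurable K) : entropyOf ν K = entropyOf μ (fun ω => K (G ω)) := by
  simp only [entropyOf, ← hG.map_eq, Measure.map_map hK hG.measurable]
  rfl

theorem mutualInfo_comp {Ω Ω' A B : Type*} [MeasurableSpace Ω] [MeasurableSpace Ω']
    [MeasurableSpace A] [MeasurableSpace B] {μ : Measure Ω} {ν : Measure Ω'} {G : Ω → Ω'}
    (hG : MeasurePreserving G μ ν) {K : Ω' → A} (hK : Measurable K) {V : Ω' → B}
    (hV : Measurable V) :
    mutualInfo ν K V = mutualInfo μ (fun ω => K (G ω)) (fun ω => V (G ω)) := by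
  simp only [mutualInfo, ← hG.map_eq, Measure.map_map hK hG.measurable,
    Measure.map_map hV hG.measurable, Measure.map_map (hK.prodMk hV) hG.measurable]
  rfl

instance (n : ℕ) : IsProbabilityMeasure (KeyCode.noise n) := by
  unfold KeyCode.noise; infer_instance

/-- A run of a code with deterministic users and base stations that ignore the other public
message, for inputs `x`, `x'` and outputs `y`, `y'`. -/
def KeyCode.detRun (c : KeyCode P₁ P₂ n) (us₁ : (Fin n → ℝ) → Fin c.k₁ × Fin c.f₁)
    (us₂ : (Fin n → ℝ) → Fin c.k₂ × Fin c.f₂) (st₁ : (Fin n → ℝ) × Fin c.f₁ → Fin c.k₁)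
    (st₂ : (Fin n → ℝ) × Fin c.f₂ → Fin c.k₂) (x x' y y' : Fin n → ℝ) : c.Run :=
  ((((x, x'), (y, y')), (us₁ y, us₂ y')), (st₁ (x, (us₁ y).2), st₂ (x', (us₂ y').2)))

section Run

variable {c : KeyCode P₁ P₂ n} {us₁ : (Fin n → ℝ) → Fin c.k₁ × Fin c.f₁}
  {us₂ : (Fin n → ℝ) → Fin c.k₂ × Fin c.f₂} {st₁ : (Fin n → ℝ) × Fin c.f₁ → Fin c.k₁}
  {st₂ : (Fin n → ℝ) × Fin c.f₂ → Fin c.k₂} {Ω : Type*} [MeasurableSpace Ω] {μ : Measure Ω}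

/-- With deterministic kernels the law of the code is the image of the run space, so all
requirements can be checked on explicit random variables. -/
theorem measurePreserving_detRun (hus₁ : Measurable us₁) (hus₂ : Measurable us₂)
    (hst₁ : Measurable st₁) (hst₂ : Measurable st₂)
    (h₁ : ∀ y, c.user₁ y = Measure.dirac (us₁ y)) (h₂ : ∀ y, c.user₂ y = Measure.dirac (us₂ y))
    (g₁ : ∀ x, c.station₁ x = Measure.dirac (st₁ (x.1, x.2.1)))
    (g₂ : ∀ x, c.station₂ x = Measure.dirac (st₂ (x.1, x.2.2)))
    {X₁ X₂ N₁ N₂ : Ω → Fin n → ℝ}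
    (hX : MeasurePreserving (fun ω => ((X₁ ω, X₂ ω), (N₁ ω, N₂ ω))) μ
      ((c.input₁.prod c.input₂).prod ((KeyCode.noise n).prod (KeyCode.noise n)))) :
    MeasurePreserving (fun ω => c.detRun us₁ us₂ st₁ st₂ (X₁ ω) (X₂ ω)
      (X₁ ω + α₁ • X₂ ω + N₁ ω) (α₂ • X₁ ω + X₂ ω + N₂ ω)) μ (c.law α₁ α₂) := by
  have hch : MeasurePreserving (fun ω =>
      ((X₁ ω, X₂ ω), (X₁ ω + α₁ • X₂ ω + N₁ ω, α₂ • X₁ ω + X₂ ω + N₂ ω))) μ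
      (c.channelLaw α₁ α₂) :=
    (Measurable.measurePreserving (f := fun z : ((Fin n → ℝ) × (Fin n → ℝ)) ×
      ((Fin n → ℝ) × (Fin n → ℝ)) => ((z.1.1, z.1.2),
      (fun t => z.1.1 t + α₁ * z.1.2 t + z.2.1 t, fun t => α₂ * z.1.1 t + z.1.2 t + z.2.2 t)))
      (by fun_prop) _).comp hX
  have : SFinite (c.channelLaw α₁ α₂) := by unfold KeyCode.channelLaw; infer_instance
  have huser := measurePreserving_compProd_dirac hch
    (κ := (c.user₁.parallelComp c.user₂).comap (fun z => z.2) measurable_snd)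
    (f := fun z => (us₁ z.2.1, us₂ z.2.2)) (by fun_prop) (fun z => by
      rw [Kernel.comap_apply, Kernel.parallelComp_apply, h₁, h₂, Measure.dirac_prod_dirac])
  have : SFinite (c.userLaw α₁ α₂) := by unfold KeyCode.userLaw; infer_instance
  exact measurePreserving_compProd_dirac huser
    (κ := (c.station₁.parallelComp c.station₂).comap
      (fun z => ((z.1.1.1, (z.2.1.2, z.2.2.2)), (z.1.1.2, (z.2.1.2, z.2.2.2)))) (by fun_prop))
    (f := fun z => (st₁ (z.1.1.1, z.2.1.2), st₂ (z.1.1.2, z.2.2.2))) (by fun_prop) (fun z => by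
      rw [Kernel.comap_apply, Kernel.parallelComp_apply, g₁, g₂, Measure.dirac_prod_dirac])

variable {X₁ X₂ Y₁ Y₂ : Ω → Fin n → ℝ} {δ ε : ℝ} [IsProbabilityMeasure μ]

/-- The second user's key and public message are functions of its output, so the eavesdropper's view
reduces to that output and the first public message. -/
theorem bounds_first (hG : MeasurePreserving (fun ω => c.detRun us₁ us₂ st₁ st₂ (X₁ ω) (X₂ ω)
      (Y₁ ω) (Y₂ ω)) μ (c.law α₁ α₂))
    (hus₁ : Measurable us₁) (hus₂ : Measurable us₂) (hY₁ : Measurable Y₁) (hY₂ : Measurable Y₂)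
    (hn : NearUniform μ (fun ω => (us₁ (Y₁ ω)).1) (fun ω => (Y₂ ω, (us₁ (Y₁ ω)).2)) δ)
    (he : μ.real {ω | (us₁ (Y₁ ω)).1 ≠ st₁ (X₁ ω, (us₁ (Y₁ ω)).2)} ≤ ε) :
    Real.log c.k₁ - δ * (1 + Real.log c.k₁) ≤ entropyOf (c.law α₁ α₂) c.K₁ ∧
      (c.law α₁ α₂).real {ω | c.K₁ ω ≠ c.K₁hat ω} ≤ ε ∧
      mutualInfo (c.law α₁ α₂) c.K₁ (fun ω => (c.K₂ ω, c.Y₂ ω, c.F₁ ω, c.F₂ ω))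
        ≤ ENNReal.ofReal (δ * (1 + Real.log c.k₁)) := by
  have mK : Measurable c.K₁ := by unfold KeyCode.K₁; fun_prop
  have mV : Measurable fun ω => (c.K₂ ω, c.Y₂ ω, c.F₁ ω, c.F₂ ω) := by
    unfold KeyCode.K₂ KeyCode.Y₂ KeyCode.F₁ KeyCode.F₂; fun_prop
  have mh : Measurable c.K₁hat := by unfold KeyCode.K₁hat; fun_prop
  refine ⟨?_, ?_, ?_⟩
  · rw [entropyOf_comp hG mK]
    have := hn.le_entropyOf (by fun_prop)
    rwa [Fintype.card_fin] at this
  · exact (hG.measureReal_preimage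
      (measurableSet_eq_fun mK mh).compl.nullMeasurableSet).symm.le.trans he
  · rw [mutualInfo_comp hG mK mV]
    have := (hn.comp (g := fun x => ((us₂ x.1).1, x.1, x.2, (us₂ x.1).2))
      (by fun_prop)).mutualInfo_le
      (by fun_prop) (by fun_prop)
    rwa [Fintype.card_fin] at this

theorem bounds_second (hG : MeasurePreserving (fun ω => c.detRun us₁ us₂ st₁ st₂ (X₁ ω) (X₂ ω)
      (Y₁ ω) (Y₂ ω)) μ (c.law α₁ α₂))
    (hus₁ : Measurable us₁) (hus₂ : Measurable us₂) (hY₁ : Measurable Y₁) (hY₂ : Measurable Y₂)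
    (hn : NearUniform μ (fun ω => (us₂ (Y₂ ω)).1) (fun ω => (Y₁ ω, (us₂ (Y₂ ω)).2)) δ)
    (he : μ.real {ω | (us₂ (Y₂ ω)).1 ≠ st₂ (X₂ ω, (us₂ (Y₂ ω)).2)} ≤ ε) :
    Real.log c.k₂ - δ * (1 + Real.log c.k₂) ≤ entropyOf (c.law α₁ α₂) c.K₂ ∧
      (c.law α₁ α₂).real {ω | c.K₂ ω ≠ c.K₂hat ω} ≤ ε ∧
      mutualInfo (c.law α₁ α₂) c.K₂ (fun ω => (c.K₁ ω, c.Y₁ ω, c.F₁ ω, c.F₂ ω))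
        ≤ ENNReal.ofReal (δ * (1 + Real.log c.k₂)) := by
  have mK : Measurable c.K₂ := by unfold KeyCode.K₂; fun_prop
  have mV : Measurable fun ω => (c.K₁ ω, c.Y₁ ω, c.F₁ ω, c.F₂ ω) := by
    unfold KeyCode.K₁ KeyCode.Y₁ KeyCode.F₁ KeyCode.F₂; fun_prop
  have mh : Measurable c.K₂hat := by unfold KeyCode.K₂hat; fun_prop
  refine ⟨?_, ?_, ?_⟩
  · rw [entropyOf_comp hG mK]
    have := hn.le_entropyOf (by fun_prop)
    rwa [Fintype.card_fin] at this
  · exact (hG.measureReal_preimage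
      (measurableSet_eq_fun mK mh).compl.nullMeasurableSet).symm.le.trans he
  · rw [mutualInfo_comp hG mK mV]
    have := (hn.comp (g := fun x => ((us₁ x.1).1, x.1, (us₁ x.1).2, x.2))
      (by fun_prop)).mutualInfo_le
      (by fun_prop) (by fun_prop)
    rwa [Fintype.card_fin] at this

end Run

theorem measurePreserving_runLaw (M₁ M₂ : ℕ) (v₁ v₂ : ℝ) :
    MeasurePreserving (fun ω : (Fin M₁ × Fin M₂) ×
      (((Fin n → ℝ) × (Fin n → ℝ)) × ((Fin n → ℝ) × (Fin n → ℝ))) =>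
      (((ω.1.1, ω.2.1.1), (ω.1.2, ω.2.2.1)), (ω.2.1.2, ω.2.2.2))) (runLaw M₁ M₂ n v₁ v₂)
      ((((unif M₁).prod (gv n v₁)).prod ((unif M₂).prod (gv n v₂))).prod
        ((gv n 1).prod (gv n 1))) :=
  ((measurePreserving_prod_comm _ _ _ _).prod (.id _)).comp
    ((measurePreserving_prodAssoc _ _ _).symm.comp
      ((MeasurePreserving.id _).prod (measurePreserving_prod_comm _ _ _ _)))

theorem measurePreserving_runLaw_swap (M₁ M₂ : ℕ) (v₁ v₂ : ℝ) :
    MeasurePreserving (fun ω : (Fin M₁ × Fin M₂) ×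
      (((Fin n → ℝ) × (Fin n → ℝ)) × ((Fin n → ℝ) × (Fin n → ℝ))) => (ω.1.swap, ω.2.swap))
      (runLaw M₁ M₂ n v₁ v₂) (runLaw M₂ M₁ n v₂ v₁) :=
  Measure.measurePreserving_swap.prod Measure.measurePreserving_swap

/-- The transmitted block: `x`, unless it violates the power constraint. -/
noncomputable def truncPower {n : ℕ} (P : ℝ) (x : Fin n → ℝ) : Fin n → ℝ :=
  {x : Fin n → ℝ | ∑ t, x t ^ 2 ≤ n * P}.indicator id x

@[fun_prop]
theorem measurable_truncPower {n : ℕ} (P : ℝ) : Measurable (truncPower P : (Fin n → ℝ) → _) :=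
  measurable_id.indicator (measurableSet_le (by fun_prop) (by fun_prop))

theorem truncPower_of_le {n : ℕ} {P : ℝ} {x : Fin n → ℝ} (h : ∑ t, x t ^ 2 ≤ n * P) :
    truncPower P x = x :=
  Set.indicator_of_mem (show x ∈ {x : Fin n → ℝ | ∑ t, x t ^ 2 ≤ n * P} from h) id

theorem sum_truncPower_le {n : ℕ} {P : ℝ} (hP : 0 ≤ P) (x : Fin n → ℝ) :
    ∑ t, truncPower P x t ^ 2 ≤ n * P := by
  by_cases h : ∑ t, x t ^ 2 ≤ n * P
  · rwa [truncPower_of_le h]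
  · rw [truncPower, Set.indicator_of_notMem (s := {x : Fin n → ℝ | ∑ t, x t ^ 2 ≤ n * P}) h]
    simp; positivity

/-- Law of the transmitted block. -/
noncomputable def inputLaw {M n : ℕ} (C : Fin M → Fin n → ℝ) (v P : ℝ) : Measure (Fin n → ℝ) :=
  ((unif M).prod (gv n v)).map fun p => truncPower P (C p.1 + p.2)

theorem measurable_transmit {M n : ℕ} (C : Fin M → Fin n → ℝ) (P : ℝ) {Ω : Type*}
    [MeasurableSpace Ω] {m : Ω → Fin M} {y : Ω → Fin n → ℝ} (hm : Measurable m)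
    (hy : Measurable y) : Measurable fun ω => truncPower P (C (m ω) + y ω) :=
  (measurable_truncPower P).comp (((measurable_of_finite C).comp hm).add hy)

theorem measurable_codeword_add {M n : ℕ} (C : Fin M → Fin n → ℝ) (P : ℝ) :
    Measurable fun p : Fin M × (Fin n → ℝ) => truncPower P (C p.1 + p.2) :=
  measurable_transmit C P measurable_fst measurable_snd

theorem isProbabilityMeasure_inputLaw {M n : ℕ} [NeZero M] (C : Fin M → Fin n → ℝ) (v P : ℝ) :
    IsProbabilityMeasure (inputLaw C v P) :=
  Measure.isProbabilityMeasure_map (measurable_codeword_add C P).aemeasurable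

theorem ae_inputLaw {M n : ℕ} (C : Fin M → Fin n → ℝ) (v : ℝ) {P : ℝ} (hP : 0 ≤ P) :
    ∀ᵐ x ∂(inputLaw C v P), ∑ t, x t ^ 2 ≤ n * P := by
  rw [inputLaw, ae_map_iff (measurable_codeword_add C P).aemeasurable
    (measurableSet_le (by fun_prop) (by fun_prop))]
  exact Filter.Eventually.of_forall fun p => sum_truncPower_le hP _

/-- A code from the deterministic maps of users and base stations. The second half of the bounds is
checked on the sample space `Ω'`. -/
theorem exists_keyCode_of_maps {k₁ k₂ f₁ f₂ : ℕ} {Ω Ω' : Type*} [MeasurableSpace Ω]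
    [MeasurableSpace Ω'] {μ : Measure Ω} [IsProbabilityMeasure μ] {μ' : Measure Ω'}
    [IsProbabilityMeasure μ'] {s : Ω' → Ω} (hs : MeasurePreserving s μ' μ)
    {I₁ I₂ : Measure (Fin n → ℝ)} (hI₁ : IsProbabilityMeasure I₁) (hI₂ : IsProbabilityMeasure I₂)
    (hP₁ : ∀ᵐ x ∂I₁, ∑ t, x t ^ 2 ≤ n * P₁) (hP₂ : ∀ᵐ x ∂I₂, ∑ t, x t ^ 2 ≤ n * P₂)
    {X₁ X₂ N₁ N₂ Y₁ Y₂ : Ω → Fin n → ℝ}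
    (hX : MeasurePreserving (fun ω => ((X₁ ω, X₂ ω), (N₁ ω, N₂ ω))) μ
      ((I₁.prod I₂).prod ((KeyCode.noise n).prod (KeyCode.noise n))))
    (hY₁ : Y₁ = fun ω => X₁ ω + α₁ • X₂ ω + N₁ ω) (hY₂ : Y₂ = fun ω => α₂ • X₁ ω + X₂ ω + N₂ ω)
    (mY₁ : Measurable Y₁) (mY₂ : Measurable Y₂)
    {us₁ : (Fin n → ℝ) → Fin k₁ × Fin f₁} (hus₁ : Measurable us₁)
    {us₂ : (Fin n → ℝ) → Fin k₂ × Fin f₂} (hus₂ : Measurable us₂)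
    {st₁ : (Fin n → ℝ) × Fin f₁ → Fin k₁} (hst₁ : Measurable st₁)
    {st₂ : (Fin n → ℝ) × Fin f₂ → Fin k₂} (hst₂ : Measurable st₂) {δ ε : ℝ}
    (n₁ : NearUniform μ (fun ω => (us₁ (Y₁ ω)).1) (fun ω => (Y₂ ω, (us₁ (Y₁ ω)).2)) δ)
    (b₁ : μ.real {ω | (us₁ (Y₁ ω)).1 ≠ st₁ (X₁ ω, (us₁ (Y₁ ω)).2)} ≤ ε)
    (n₂ : NearUniform μ' (fun ω => (us₂ (Y₂ (s ω))).1)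
      (fun ω => (Y₁ (s ω), (us₂ (Y₂ (s ω))).2)) δ)
    (b₂ : μ'.real {ω | (us₂ (Y₂ (s ω))).1 ≠ st₂ (X₂ (s ω), (us₂ (Y₂ (s ω))).2)} ≤ ε) :
    ∃ c : KeyCode P₁ P₂ n,
      Real.log k₁ - δ * (1 + Real.log k₁) ≤ entropyOf (c.law α₁ α₂) c.K₁ ∧
      Real.log k₂ - δ * (1 + Real.log k₂) ≤ entropyOf (c.law α₁ α₂) c.K₂ ∧
      (c.law α₁ α₂).real {ω | c.K₁ ω ≠ c.K₁hat ω} ≤ ε ∧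
      (c.law α₁ α₂).real {ω | c.K₂ ω ≠ c.K₂hat ω} ≤ ε ∧
      mutualInfo (c.law α₁ α₂) c.K₁ (fun ω => (c.K₂ ω, c.Y₂ ω, c.F₁ ω, c.F₂ ω))
        ≤ ENNReal.ofReal (δ * (1 + Real.log k₁)) ∧
      mutualInfo (c.law α₁ α₂) c.K₂ (fun ω => (c.K₁ ω, c.Y₁ ω, c.F₁ ω, c.F₂ ω))
        ≤ ENNReal.ofReal (δ * (1 + Real.log k₂)) := by
  let c : KeyCode P₁ P₂ n :=
    { k₁ := k₁
      k₂ := k₂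
      f₁ := f₁
      f₂ := f₂
      input₁ := I₁
      input₂ := I₂
      prob₁ := hI₁
      prob₂ := hI₂
      power₁ := hP₁
      power₂ := hP₂
      user₁ := Kernel.deterministic us₁ hus₁
      user₂ := Kernel.deterministic us₂ hus₂
      markov_user₁ := inferInstance
      markov_user₂ := inferInstance
      station₁ := Kernel.deterministic (fun x => st₁ (x.1, x.2.1)) (hst₁.comp (by fun_prop))
      station₂ := Kernel.deterministic (fun x => st₂ (x.1, x.2.2)) (hst₂.comp (by fun_prop))
      markov_station₁ := inferInstance
      markov_station₂ := inferInstance }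
  have hlaw := measurePreserving_detRun (c := c) (α₁ := α₁) (α₂ := α₂) hus₁ hus₂ hst₁ hst₂
    (Kernel.deterministic_apply hus₁) (Kernel.deterministic_apply hus₂)
    (Kernel.deterministic_apply (hst₁.comp (by fun_prop)))
    (Kernel.deterministic_apply (hst₂.comp (by fun_prop))) hX
  subst hY₁ hY₂
  obtain ⟨p₁, p₂, p₃⟩ := bounds_first hlaw hus₁ hus₂ mY₁ mY₂ n₁ b₁
  obtain ⟨q₁, q₂, q₃⟩ := bounds_second (c := c) (us₁ := us₁) (us₂ := us₂) (st₁ := st₁) (st₂ := st₂)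
    (X₁ := fun ω => X₁ (s ω)) (X₂ := fun ω => X₂ (s ω)) (hlaw.comp hs) hus₁ hus₂
    (mY₁.comp hs.measurable) (mY₂.comp hs.measurable) n₂ b₂
  exact ⟨c, p₁, q₁, p₂, q₂, p₃, q₃⟩

/-- Codes from schemes, decoders and power estimates. -/
theorem exists_keyCode {u₁ v₁ u₂ v₂ R₁ R₂ r₁ r₂ η : ℝ} {M₁ M₂ : ℕ} [NeZero M₁] [NeZero M₂]
    (hP₁ : 0 ≤ P₁) (hP₂ : 0 ≤ P₂)
    (S₁ : Scheme α₁ α₂ u₁ v₁ u₂ v₂ n R₁ r₁ η) (S₂ : Scheme α₂ α₁ u₂ v₂ u₁ v₁ n R₂ r₂ η)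
    {D₁ D₂ : Set ((Fin n → ℝ) × (Fin n → ℝ))} (hD₁ : MeasurableSet D₁) (hD₂ : MeasurableSet D₂)
    (hu₁ : 0 ≤ u₁) (hv₁ : 0 ≤ v₁) (hu₂ : 0 ≤ u₂) (hv₂ : 0 ≤ v₂) (hη : 0 < η)
    (hM₁ : Real.exp (n * R₁) ≤ M₁) (hM₂ : Real.exp (n * R₂) ≤ M₂)
    (hpow₁ : gv n (u₁ + v₁) {x | n * P₁ < ∑ t, x t ^ 2} ≤ ENNReal.ofReal η)
    (hpow₂ : gv n (u₂ + v₂) {x | n * P₂ < ∑ t, x t ^ 2} ≤ ENNReal.ofReal η)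
    (hdec₁ : ∀ m, ((codebook M₁ n u₁).prod (gv n (v₁ + 1 + α₁ ^ 2 * (u₂ + v₂)))) (decFail D₁ m)
      ≤ ENNReal.ofReal η)
    (hdec₂ : ∀ m, ((codebook M₂ n u₂).prod (gv n (v₂ + 1 + α₂ ^ 2 * (u₁ + v₁)))) (decFail D₂ m)
      ≤ ENNReal.ofReal η) :
    ∃ c : KeyCode P₁ P₂ n,
      Real.log S₁.k - 36 * η * (1 + Real.log S₁.k) ≤ entropyOf (c.law α₁ α₂) c.K₁ ∧
      Real.log S₂.k - 36 * η * (1 + Real.log S₂.k) ≤ entropyOf (c.law α₁ α₂) c.K₂ ∧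
      (c.law α₁ α₂).real {ω | c.K₁ ω ≠ c.K₁hat ω} ≤ 10 * η ∧
      (c.law α₁ α₂).real {ω | c.K₂ ω ≠ c.K₂hat ω} ≤ 10 * η ∧
      mutualInfo (c.law α₁ α₂) c.K₁ (fun ω => (c.K₂ ω, c.Y₂ ω, c.F₁ ω, c.F₂ ω))
        ≤ ENNReal.ofReal (36 * η * (1 + Real.log S₁.k)) ∧
      mutualInfo (c.law α₁ α₂) c.K₂ (fun ω => (c.K₁ ω, c.Y₁ ω, c.F₁ ω, c.F₂ ω))
        ≤ ENNReal.ofReal (36 * η * (1 + Real.log S₂.k)) := by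
  obtain ⟨C₁, e₁, C₂, e₂, hfail⟩ := exists_codebooks S₁ S₂ hD₁ hD₂ hu₁ hv₁ hu₂ hv₂ hη.le hpow₁ hpow₂
    hdec₁ hdec₂
  have hsw := measurePreserving_runLaw_swap (n := n) M₂ M₁ v₂ v₁
  -- A measurable hull of the failure event, of the same mass.
  set B := toMeasurable (runLaw M₁ M₂ n v₁ v₂) {ω | SideFails S₁ D₁ P₁ C₁ e₁ C₂ ω.1.1 ω.1.2 ω.2 ∨
    SideFails S₂ D₂ P₂ C₂ e₂ C₁ ω.1.2 ω.1.1 ω.2.swap} with hB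
  have hBm : MeasurableSet B := measurableSet_toMeasurable _ _
  have hB₁ : (runLaw M₁ M₂ n v₁ v₂).real B ≤ 8 * η := by
    rw [Measure.real, hB, measure_toMeasurable]
    exact ENNReal.toReal_le_of_le_ofReal (by positivity) hfail
  have hoff : ∀ ω ∉ B, ¬ SideFails S₁ D₁ P₁ C₁ e₁ C₂ ω.1.1 ω.1.2 ω.2 ∧
      ¬ SideFails S₂ D₂ P₂ C₂ e₂ C₁ ω.1.2 ω.1.1 ω.2.swap := fun ω hω =>
    not_or.1 fun h => hω (subset_toMeasurable _ _ h)
  set B' := (fun ω : (Fin M₂ × Fin M₁) × (((Fin n → ℝ) × (Fin n → ℝ)) ×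
    ((Fin n → ℝ) × (Fin n → ℝ))) => (ω.1.swap, ω.2.swap)) ⁻¹' B with hB'
  have hB₂ : (runLaw M₂ M₁ n v₂ v₁).real B' ≤ 8 * η := by
    rw [hB', hsw.measureReal_preimage hBm.nullMeasurableSet]; exact hB₁
  obtain ⟨us₁, st₁, hus₁, hst₁, h₁⟩ := exists_user_station S₁ hη hu₁ hv₁ hv₂ hM₁ hD₁ C₁ e₁ C₂ hB₁
    fun ω hω => (hoff ω hω).1
  obtain ⟨us₂, st₂, hus₂, hst₂, h₂⟩ := exists_user_station S₂ hη hu₂ hv₂ hv₁ hM₂ hD₂ C₂ e₂ C₁ hB₂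
    fun ω hω => (hoff _ hω).2
  set X₁ : (Fin M₁ × Fin M₂) × (((Fin n → ℝ) × (Fin n → ℝ)) × ((Fin n → ℝ) × (Fin n → ℝ))) →
    Fin n → ℝ := fun ω => truncPower P₁ (C₁ ω.1.1 + ω.2.1.1) with hX₁
  set X₂ : (Fin M₁ × Fin M₂) × (((Fin n → ℝ) × (Fin n → ℝ)) × ((Fin n → ℝ) × (Fin n → ℝ))) →
    Fin n → ℝ := fun ω => truncPower P₂ (C₂ ω.1.2 + ω.2.2.1) with hX₂
  set Y₁ := fun ω => X₁ ω + α₁ • X₂ ω + ω.2.1.2 with hY₁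
  set Y₂ := fun ω => α₂ • X₁ ω + X₂ ω + ω.2.2.2 with hY₂
  have hmX₁ : Measurable X₁ := measurable_transmit C₁ P₁ (by fun_prop) (by fun_prop)
  have hmX₂ : Measurable X₂ := measurable_transmit C₂ P₂ (by fun_prop) (by fun_prop)
  have hmY₁ : Measurable Y₁ := (hmX₁.add (hmX₂.const_smul α₁)).add
    (by fun_prop : Measurable fun ω : (Fin M₁ × Fin M₂) × (((Fin n → ℝ) × (Fin n → ℝ)) ×
      ((Fin n → ℝ) × (Fin n → ℝ))) => ω.2.1.2)
  have hmY₂ : Measurable Y₂ := ((hmX₁.const_smul α₂).add hmX₂).add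
    (by fun_prop : Measurable fun ω : (Fin M₁ × Fin M₂) × (((Fin n → ℝ) × (Fin n → ℝ)) ×
      ((Fin n → ℝ) × (Fin n → ℝ))) => ω.2.2.2)
  have hmp : MeasurePreserving (fun ω => ((X₁ ω, X₂ ω), (ω.2.1.2, ω.2.2.2)))
      (runLaw M₁ M₂ n v₁ v₂) (((inputLaw C₁ v₁ P₁).prod (inputLaw C₂ v₂ P₂)).prod
        ((KeyCode.noise n).prod (KeyCode.noise n))) := by
    have := isProbabilityMeasure_inputLaw C₁ v₁ P₁
    have := isProbabilityMeasure_inputLaw C₂ v₂ P₂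
    rw [noise_eq_gv]
    exact ((((measurable_codeword_add C₁ P₁).measurePreserving ((unif M₁).prod (gv n v₁))).prod
      ((measurable_codeword_add C₂ P₂).measurePreserving ((unif M₂).prod (gv n v₂)))).prod
      (.id _)).comp (measurePreserving_runLaw M₁ M₂ v₁ v₂)
  -- Off B the power constraint holds, so truncation changes nothing.
  have hgood : ∀ ω ∉ B, X₁ ω = C₁ ω.1.1 + ω.2.1.1 ∧ X₂ ω = C₂ ω.1.2 + ω.2.2.1 := by
    intro ω hω
    obtain ⟨f₁, f₂⟩ := hoff ω hω
    simp only [SideFails, not_or, not_lt] at f₁ f₂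
    exact ⟨truncPower_of_le f₁.1, truncPower_of_le f₂.1⟩
  obtain ⟨n₁, b₁⟩ := h₁ X₁ Y₁ Y₂ hmY₁ fun ω hω => by
    obtain ⟨g₁, g₂⟩ := hgood ω hω
    refine ⟨g₁, ?_, ?_⟩
    · simp only [hY₁, g₁, g₂]; rfl
    · simp only [hY₂, g₁, g₂]; rfl
  -- The second side is the first one with the roles exchanged, so it is evaluated on the swapped
  -- run space.
  obtain ⟨n₂, b₂⟩ := h₂ (fun ω => X₂ (ω.1.swap, ω.2.swap)) (fun ω => Y₂ (ω.1.swap, ω.2.swap))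
    (fun ω => Y₁ (ω.1.swap, ω.2.swap)) (hmY₂.comp hsw.measurable) fun ω hω => by
    obtain ⟨g₁, g₂⟩ := hgood _ hω
    refine ⟨g₂, ?_, ?_⟩
    · simp only [hY₂, g₁, g₂, outY, inRun, withWords]
      rw [add_comm (α₂ • _)]; rfl
    · simp only [hY₁, g₁, g₂, outZ, inRun, withWords]
      rw [add_comm (α₁ • _)]; rfl
  exact exists_keyCode_of_maps hsw (isProbabilityMeasure_inputLaw C₁ v₁ P₁)
    (isProbabilityMeasure_inputLaw C₂ v₂ P₂) (ae_inputLaw C₁ v₁ hP₁) (ae_inputLaw C₂ v₂ hP₂)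
    hmp hY₁ hY₂ hmY₁ hmY₂ hus₁ hus₂ hst₁ hst₂ n₁ b₁ n₂ b₂

end Code

/-! ### Rates, power allocation and conclusion. -/

section Rates

/-- Rate of the part of the key that is extracted from the codeword. -/
noncomputable def wordRate (α α' u v u' v' : ℝ) : ℝ :=
  gaussCap (u / (v + 1 + α ^ 2 * (u' + v'))) - gaussCap (α' ^ 2 * u / varB α' v v')

/-- Rate of the part of the key that is extracted from the quantized output. -/
noncomputable def outputRate (α α' v u' v' : ℝ) : ℝ :=
  Real.log (varE α α' v v') / 2 - Real.log (1 + α ^ 2 * (u' + v')) / 2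

/-- The output is quantized only when this raises the rate. -/
theorem exists_scheme {α α' u v u' v' ρ : ℝ} (hu : 0 ≤ u) (hv : 0 ≤ v) (hu' : 0 ≤ u') (hv' : 0 ≤ v')
    (hw : 0 ≤ wordRate α α' u v u' v')
    (hρ : ρ < wordRate α α' u v u' v' + plusPart (outputRate α α' v u' v')) :
    ∃ R r, ρ ≤ r ∧ R < gaussCap (u / (v + 1 + α ^ 2 * (u' + v'))) ∧ ∀ η > 0,
      ∃ n₀ : ℕ, ∀ n ≥ n₀, Nonempty (Scheme α α' u v u' v' n R r η) := by
  unfold wordRate outputRate plusPart at *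
  rcases le_total (Real.log (varE α α' v v') / 2 - Real.log (1 + α ^ 2 * (u' + v')) / 2) 0
    with hB | hB
  · rw [max_eq_right hB] at hρ
    obtain ⟨R, h1, h2⟩ := exists_between (show ρ + gaussCap (α' ^ 2 * u / varB α' v v')
      < gaussCap (u / (v + 1 + α ^ 2 * (u' + v'))) by linarith)
    exact ⟨R, ρ, le_rfl, h2, fun η hη => exists_scheme_word α hu hv hu' hv' h1 hη⟩
  · rw [max_eq_left hB] at hρ
    -- A negative target needs no output randomness; the quantized scheme is set up for r ≥ 0 only.
    rcases lt_or_ge ρ 0 with h0 | h0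
    · obtain ⟨R, h1, h2⟩ := exists_between (show ρ + gaussCap (α' ^ 2 * u / varB α' v v')
        < gaussCap (u / (v + 1 + α ^ 2 * (u' + v'))) by linarith)
      exact ⟨R, ρ, le_rfl, h2, fun η hη => exists_scheme_word α hu hv hu' hv' h1 hη⟩
    · obtain ⟨R, h1, h2⟩ := exists_between (show ρ + Real.log (1 + α ^ 2 * (u' + v')) / 2
        - Real.log (varE α α' v v') / 2 + gaussCap (α' ^ 2 * u / varB α' v v')
        < gaussCap (u / (v + 1 + α ^ 2 * (u' + v'))) by linarith)
      exact ⟨R, ρ, le_rfl, h2, fun η hη => exists_scheme_output hu hv hu' hv' h0 h1 hη⟩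

theorem gv_zero (n : ℕ) : gv n 0 = Measure.dirac 0 := by
  have h := (gv_lin (n := n) (s := 0) (t := 0) le_rfl le_rfl 0 0).map_eq
  simpa using h.symm

/-- Concentration needs strict slack; the alternative s = 0 covers P = 0, where the signal vanishes
identically. -/
theorem exists_power {s P η : ℝ} (hs : 0 ≤ s) (hP : 0 ≤ P) (h : s < P ∨ s = 0) (hη : 0 < η) :
    ∃ n₀ : ℕ, ∀ n ≥ n₀, gv n s {x | n * P < ∑ t, x t ^ 2} ≤ ENNReal.ofReal η := by
  rcases h with h | rfl
  · obtain ⟨n₀, h₀⟩ := gv_energy_ge hs h hη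
    exact ⟨n₀, fun n hn => (measure_mono
      (Set.ofPred_subset_ofPred.2 fun x hx => le_of_lt hx)).trans (h₀ n hn)⟩
  · refine ⟨0, fun n _ => ?_⟩
    rw [gv_zero, Measure.dirac_apply' _ (measurableSet_lt measurable_const (by fun_prop)),
      Set.indicator_of_notMem]
    · simp
    · show ¬ ((n : ℝ) * P < ∑ t, (0 : Fin n → ℝ) t ^ 2)
      simp; positivity

/-- For n ≥ 1, 1 + log k is at most (2 + max r 0) n, so an error δ in total variation costs at most
δ(2 + max r 0) per channel use. -/
theorem key_estimates {n : ℕ} (hn : 1 ≤ n) {k ρ r ε δ H : ℝ} (h1 : Real.exp (n * r) ≤ k)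
    (h2 : Real.log k ≤ n * max r 0 + Real.log 2) (hρ : ρ ≤ r) (hδ0 : 0 ≤ δ)
    (hδ : δ * (2 + max r 0) < ε) (hH : Real.log k - δ * (1 + Real.log k) ≤ H) :
    ρ - ε < H / n ∧ δ * (1 + Real.log k) < ε * n := by
  have hn' : (1 : ℝ) ≤ n := by exact_mod_cast hn
  have hl : n * r ≤ Real.log k := by
    rw [← Real.log_exp (n * r)]
    exact Real.log_le_log (Real.exp_pos _) h1
  have hlog2 : Real.log 2 ≤ 1 := by linarith [Real.log_two_lt_d9]
  have h0 : 0 ≤ max r 0 := le_max_right _ _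
  have h3 : δ * (1 + Real.log k) < ε * n :=
    calc δ * (1 + Real.log k) ≤ δ * ((2 + max r 0) * n) := by
          gcongr
          nlinarith
      _ = δ * (2 + max r 0) * n := by ring
      _ < ε * n := by gcongr
  refine ⟨?_, h3⟩
  rw [lt_div_iff₀ (by linarith)]
  nlinarith

theorem achievable_of_lt {α₁ α₂ P₁ P₂ u₁ v₁ u₂ v₂ ρ₁ ρ₂ : ℝ} (hP₁ : 0 ≤ P₁) (hP₂ : 0 ≤ P₂)
    (hu₁ : 0 ≤ u₁) (hv₁ : 0 ≤ v₁) (hu₂ : 0 ≤ u₂) (hv₂ : 0 ≤ v₂)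
    (hp₁ : u₁ + v₁ < P₁ ∨ u₁ + v₁ = 0) (hp₂ : u₂ + v₂ < P₂ ∨ u₂ + v₂ = 0)
    (hw₁ : 0 ≤ wordRate α₁ α₂ u₁ v₁ u₂ v₂) (hw₂ : 0 ≤ wordRate α₂ α₁ u₂ v₂ u₁ v₁)
    (hρ₁ : ρ₁ < wordRate α₁ α₂ u₁ v₁ u₂ v₂ + plusPart (outputRate α₁ α₂ v₁ u₂ v₂))
    (hρ₂ : ρ₂ < wordRate α₂ α₁ u₂ v₂ u₁ v₁ + plusPart (outputRate α₂ α₁ v₂ u₁ v₁)) :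
    AchievableKeyRates α₁ α₂ P₁ P₂ ρ₁ ρ₂ := by
  intro ε hε
  obtain ⟨R₁, r₁, hr₁, hR₁, hS₁⟩ := exists_scheme hu₁ hv₁ hu₂ hv₂ hw₁ hρ₁
  obtain ⟨R₂, r₂, hr₂, hR₂, hS₂⟩ := exists_scheme hu₂ hv₂ hu₁ hv₁ hw₂ hρ₂
  have m₁ : 0 ≤ max r₁ 0 := le_max_right _ _
  have m₂ : 0 ≤ max r₂ 0 := le_max_right _ _
  -- Small enough for the errors 36η(2 + max r 0) and 10η of `exists_keyCode` to stay below ε.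
  set η := ε / (100 * (2 + max r₁ 0 + max r₂ 0)) with hηdef
  have hη : 0 < η := by positivity
  have hηε : η * (100 * (2 + max r₁ 0 + max r₂ 0)) = ε := by
    rw [hηdef]; field_simp
  have hx₁ := mul_nonneg hη.le m₁
  have hx₂ := mul_nonneg hη.le m₂
  obtain ⟨a₁, hs₁⟩ := hS₁ η hη
  obtain ⟨a₂, hs₂⟩ := hS₂ η hη
  obtain ⟨a₃, hd₁⟩ := exists_decoder hu₁ (by positivity) hR₁ hη
  obtain ⟨a₄, hd₂⟩ := exists_decoder hu₂ (by positivity) hR₂ hη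
  obtain ⟨a₅, hq₁⟩ := exists_power (by positivity) hP₁ hp₁ hη
  obtain ⟨a₆, hq₂⟩ := exists_power (by positivity) hP₂ hp₂ hη
  refine ⟨a₁ + a₂ + a₃ + a₄ + a₅ + a₆ + 1, fun n hn => ?_⟩
  obtain ⟨S₁⟩ := hs₁ n (by omega)
  obtain ⟨S₂⟩ := hs₂ n (by omega)
  obtain ⟨D₁, hD₁, hdec₁⟩ := hd₁ n (by omega)
  obtain ⟨D₂, hD₂, hdec₂⟩ := hd₂ n (by omega)
  have hM : ∀ x : ℝ, (⌈Real.exp x⌉₊ : ℝ) - 1 ≤ Real.exp x := fun x => by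
    linarith [Nat.ceil_lt_add_one (Real.exp_pos x).le]
  have : NeZero ⌈Real.exp (n * R₁)⌉₊ := ⟨(Nat.ceil_pos.2 (Real.exp_pos _)).ne'⟩
  have : NeZero ⌈Real.exp (n * R₂)⌉₊ := ⟨(Nat.ceil_pos.2 (Real.exp_pos _)).ne'⟩
  obtain ⟨c, e₁, e₂, p₁, p₂, i₁, i₂⟩ := exists_keyCode hP₁ hP₂ S₁ S₂ hD₁ hD₂ hu₁ hv₁ hu₂ hv₂ hη
    (Nat.le_ceil (Real.exp (n * R₁))) (Nat.le_ceil (Real.exp (n * R₂))) (hq₁ n (by omega))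
    (hq₂ n (by omega)) (hdec₁ _ (hM _)) (hdec₂ _ (hM _))
  obtain ⟨x₁, y₁⟩ := key_estimates (ε := ε) (by omega) S₁.le_k S₁.log_k hr₁ (by positivity)
    (by nlinarith) e₁
  obtain ⟨x₂, y₂⟩ := key_estimates (ε := ε) (by omega) S₂.le_k S₂.log_k hr₂ (by positivity)
    (by nlinarith) e₂
  have hn0 : (n : ENNReal) ≠ 0 := by
    exact_mod_cast (by omega : n ≠ 0)
  have hinfo : ∀ {I : ENNReal} {x : ℝ}, I ≤ ENNReal.ofReal x → x < ε * n →
      I / n < ENNReal.ofReal ε := by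
    intro I x hI hx
    refine ENNReal.div_lt_of_lt_mul (hI.trans_lt ?_)
    rw [← ENNReal.ofReal_natCast, ← ENNReal.ofReal_mul hε.le, ENNReal.ofReal_lt_ofReal_iff]
    · exact hx
    · have : 0 < n := by omega
      positivity
  exact ⟨c, x₁, x₂, p₁.trans_lt (by nlinarith), p₂.trans_lt (by nlinarith), hinfo i₁ y₁,
    hinfo i₂ y₂⟩

theorem achievable_of_forall_sub {α₁ α₂ P₁ P₂ R₁ R₂ : ℝ}
    (h : ∀ ε > 0, AchievableKeyRates α₁ α₂ P₁ P₂ (R₁ - ε) (R₂ - ε)) :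
    AchievableKeyRates α₁ α₂ P₁ P₂ R₁ R₂ := by
  intro ε hε
  obtain ⟨n₀, h₀⟩ := h (ε / 2) (by positivity) (ε / 2) (by positivity)
  refine ⟨n₀, fun n hn => ?_⟩
  obtain ⟨c, h1, h2, h3, h4, h5, h6⟩ := h₀ n hn
  have hle : ENNReal.ofReal (ε / 2) ≤ ENNReal.ofReal ε := ENNReal.ofReal_le_ofReal (by linarith)
  exact ⟨c, by linarith, by linarith, by linarith, by linarith, h5.trans_le hle, h6.trans_le hle⟩

/-- A codeword of power `u` is used only if it increases the key rate. -/
noncomputable def usedPower (α α' u v u' v' : ℝ) : ℝ :=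
  if 0 < wordRate α α' u v u' v' then u else 0

theorem usedPower_nonneg {α α' u v u' v' : ℝ} (hu : 0 ≤ u) : 0 ≤ usedPower α α' u v u' v' := by
  unfold usedPower; split_ifs <;> simp [hu]

theorem usedPower_le {α α' u v u' v' : ℝ} (hu : 0 ≤ u) : usedPower α α' u v u' v' ≤ u := by
  unfold usedPower; split_ifs <;> simp [hu]

/-- Less codeword power on the other side raises the decoding capacity and leaves the leakage term
alone. A suppressed codeword has word rate exactly 0. -/
theorem plusPart_le_wordRate {α α' u v u' v' w : ℝ} (hu : 0 ≤ u) (hv : 0 ≤ v) (hv' : 0 ≤ v')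
    (hw : 0 ≤ w) (hwu : w ≤ u') :
    plusPart (wordRate α α' u v u' v') ≤ wordRate α α' (usedPower α α' u v u' v') v w v' := by
  unfold usedPower plusPart
  split_ifs with h
  · rw [max_eq_left h.le]
    have : 0 ≤ u' := hw.trans hwu
    unfold wordRate gaussCap
    gcongr
  · rw [max_eq_right (not_lt.1 h)]
    simp [wordRate, gaussCap]

/-- The other codeword enters only through the interference in the subtracted logarithm; `varE`
involves dummy powers alone. -/
theorem outputRate_mono {α α' v u' v' w : ℝ} (hv' : 0 ≤ v') (hw : 0 ≤ w) (hwu : w ≤ u') :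
    plusPart (outputRate α α' v u' v') ≤ plusPart (outputRate α α' v w v') := by
  unfold outputRate plusPart
  gcongr

/-- Sum rate of both parts of a key for total powers `γ a`, `γ a'`. -/
noncomputable def scaledRate (α α' l l' a a' γ : ℝ) : ℝ :=
  plusPart (wordRate α α' (γ * ((1 - l) * a)) (γ * (l * a)) (γ * ((1 - l') * a')) (γ * (l' * a'))) +
    plusPart (outputRate α α' (γ * (l * a)) (γ * ((1 - l') * a')) (γ * (l' * a')))

theorem continuousAt_scaledRate {α α' l l' a a' : ℝ} (hl : l ∈ Set.Icc (0 : ℝ) 1)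
    (hl' : l' ∈ Set.Icc (0 : ℝ) 1) (ha : 0 ≤ a) (ha' : 0 ≤ a') :
    ContinuousAt (scaledRate α α' l l' a a') 1 := by
  have h1 := hl.1
  have h2 : 0 ≤ 1 - l := by linarith [hl.2]
  have h3 := hl'.1
  have h4 : 0 ≤ 1 - l' := by linarith [hl'.2]
  unfold scaledRate plusPart wordRate outputRate gaussCap varE varB
  have d1 : (0 : ℝ) < 1 * (l * a) + 1 + α ^ 2 * (1 * ((1 - l') * a') + 1 * (l' * a')) := by
    positivity
  have d2 : (0 : ℝ) < 1 + α' ^ 2 * (1 * (l * a)) + 1 * (l' * a') := by positivity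
  fun_prop (disch := positivity)

/-- Shrinking all powers slightly gives strict power slack, and by continuity keeps both strict rate
inequalities. -/
theorem exists_scale {α₁ α₂ l₁ l₂ a₁ a₂ x₁ x₂ : ℝ} (hl₁ : l₁ ∈ Set.Icc (0 : ℝ) 1)
    (hl₂ : l₂ ∈ Set.Icc (0 : ℝ) 1) (ha₁ : 0 ≤ a₁) (ha₂ : 0 ≤ a₂)
    (h₁ : x₁ < scaledRate α₁ α₂ l₁ l₂ a₁ a₂ 1) (h₂ : x₂ < scaledRate α₂ α₁ l₂ l₁ a₂ a₁ 1) :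
    ∃ γ, 0 < γ ∧ γ < 1 ∧ x₁ < scaledRate α₁ α₂ l₁ l₂ a₁ a₂ γ ∧
      x₂ < scaledRate α₂ α₁ l₂ l₁ a₂ a₁ γ := by
  have e := ((continuousAt_scaledRate (α := α₁) (α' := α₂) hl₁ hl₂ ha₁
    ha₂).eventually_const_lt h₁).and
    ((continuousAt_scaledRate (α := α₂) (α' := α₁) hl₂ hl₁ ha₂ ha₁).eventually_const_lt h₂)
  obtain ⟨γ, ⟨h3, h4⟩, h5, h6⟩ := ((e.filter_mono (nhdsWithin_le_nhds (s := Set.Iio 1))).and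
    (Ioo_mem_nhdsLT (zero_lt_one' ℝ))).exists
  exact ⟨γ, h5, h6, h3, h4⟩

theorem corollary3 (α₁ α₂ P₁ P₂ : ℝ) (hα₁ : α₁ ^ 2 ≤ 1) (hα₂ : α₂ ^ 2 ≤ 1)
    (hP₁ : 0 ≤ P₁) (hP₂ : 0 ≤ P₂) (β₁ β₂ l₁ l₂ : ℝ)
    (hβ₁ : β₁ ∈ Set.Icc (0 : ℝ) 1) (hβ₂ : β₂ ∈ Set.Icc (0 : ℝ) 1)
    (hl₁ : l₁ ∈ Set.Icc (0 : ℝ) 1) (hl₂ : l₂ ∈ Set.Icc (0 : ℝ) 1) :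
    artificialNoiseRegion α₁ α₂ P₁ P₂ β₁ β₂ l₁ l₂ ⊆ secretKeyCapacityRegion α₁ α₂ P₁ P₂ := by
  rintro ⟨R₁, R₂⟩ ⟨⟨-, h₁⟩, -, h₂⟩
  have ha₁ : 0 ≤ β₁ * P₁ := mul_nonneg hβ₁.1 hP₁
  have ha₂ : 0 ≤ β₂ * P₂ := mul_nonneg hβ₂.1 hP₂
  -- At γ = 1 the two brackets of the region are the word rate and the output rate, because u' + v'
  -- = β'P'.
  have e₁ : R₁ ≤ scaledRate α₁ α₂ l₁ l₂ (β₁ * P₁) (β₂ * P₂) 1 := by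
    refine h₁.trans (le_of_eq ?_)
    unfold scaledRate wordRate outputRate gaussCap varE varB
    ring_nf
  have e₂ : R₂ ≤ scaledRate α₂ α₁ l₂ l₁ (β₂ * P₂) (β₁ * P₁) 1 := by
    refine h₂.trans (le_of_eq ?_)
    unfold scaledRate wordRate outputRate gaussCap varE varB
    ring_nf
  refine achievable_of_forall_sub fun ε hε => ?_
  obtain ⟨γ, hγ0, hγ1, g₁, g₂⟩ := exists_scale hl₁ hl₂ ha₁ ha₂ ((sub_lt_self R₁ hε).trans_le e₁)
    ((sub_lt_self R₂ hε).trans_le e₂)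
  have hv₁ : 0 ≤ γ * (l₁ * (β₁ * P₁)) := mul_nonneg hγ0.le (mul_nonneg hl₁.1 ha₁)
  have hv₂ : 0 ≤ γ * (l₂ * (β₂ * P₂)) := mul_nonneg hγ0.le (mul_nonneg hl₂.1 ha₂)
  have hu₁ : 0 ≤ γ * ((1 - l₁) * (β₁ * P₁)) :=
    mul_nonneg hγ0.le (mul_nonneg (sub_nonneg.2 hl₁.2) ha₁)
  have hu₂ : 0 ≤ γ * ((1 - l₂) * (β₂ * P₂)) :=
    mul_nonneg hγ0.le (mul_nonneg (sub_nonneg.2 hl₂.2) ha₂)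
  have hpow : ∀ {β l P u : ℝ}, β ∈ Set.Icc (0 : ℝ) 1 → l ∈ Set.Icc (0 : ℝ) 1 → 0 ≤ P → 0 ≤ u →
      u ≤ γ * ((1 - l) * (β * P)) → u + γ * (l * (β * P)) < P ∨ u + γ * (l * (β * P)) = 0 := by
    intro β l P u hβ hl hP hu hle
    rcases hP.eq_or_lt with rfl | hP0
    · right
      simp only [mul_zero] at *
      linarith
    · left
      have : γ * (β * P) < P := by
        have : β * P ≤ P := mul_le_of_le_one_left hP hβ.2
        nlinarith [mul_nonneg hβ.1 hP]
      nlinarith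
  have c₁ := usedPower_nonneg (α := α₁) (α' := α₂) (v := γ * (l₁ * (β₁ * P₁)))
    (u' := γ * ((1 - l₂) * (β₂ * P₂))) (v' := γ * (l₂ * (β₂ * P₂))) hu₁
  have c₂ := usedPower_nonneg (α := α₂) (α' := α₁) (v := γ * (l₂ * (β₂ * P₂)))
    (u' := γ * ((1 - l₁) * (β₁ * P₁))) (v' := γ * (l₁ * (β₁ * P₁))) hu₂
  have d₁ := usedPower_le (α := α₁) (α' := α₂) (v := γ * (l₁ * (β₁ * P₁)))
    (u' := γ * ((1 - l₂) * (β₂ * P₂))) (v' := γ * (l₂ * (β₂ * P₂))) hu₁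
  have d₂ := usedPower_le (α := α₂) (α' := α₁) (v := γ * (l₂ * (β₂ * P₂)))
    (u' := γ * ((1 - l₁) * (β₁ * P₁))) (v' := γ * (l₁ * (β₁ * P₁))) hu₂
  -- Both suppressions are decided with the full powers; since each one only helps the other side,
  -- doing both at once is harmless.
  have w₁ := plusPart_le_wordRate (α := α₁) (α' := α₂) hu₁ hv₁ hv₂ c₂ d₂
  have w₂ := plusPart_le_wordRate (α := α₂) (α' := α₁) hu₂ hv₂ hv₁ c₁ d₁
  have o₁ := outputRate_mono (α := α₁) (α' := α₂) (v := γ * (l₁ * (β₁ * P₁))) hv₂ c₂ d₂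
  have o₂ := outputRate_mono (α := α₂) (α' := α₁) (v := γ * (l₂ * (β₂ * P₂))) hv₁ c₁ d₁
  exact achievable_of_lt hP₁ hP₂ c₁ hv₁ c₂ hv₂ (hpow hβ₁ hl₁ hP₁ c₁ d₁) (hpow hβ₂ hl₂ hP₂ c₂ d₂)
    ((le_max_right _ _).trans w₁) ((le_max_right _ _).trans w₂)
    (g₁.trans_le (add_le_add w₁ o₁)) (g₂.trans_le (add_le_add w₂ o₂))

end Rates
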